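/- **Setting.** Let $d\ge 1$ and let $A$ be a real expanding $d\times d$ matrix (all complex eigenvalues have modulus $>1$); put $q=|\det A|$. Let $(\mathcal A,\Gamma)$ be a finite directed graph (loops and parallel edges allowed); the edge $e$ goes from $s(e)$ to $t(e)$ and carries a map $g_e(x)=A^{-1}(x+d_e)$ with $d_e\in\mathbb R^d$. Let $M=(m_{ij})$, where $m_{ij}$ is the number of edges from $j$ to $i$. Assume that $M$ is primitive, that its maximal (Perron) eigenvalue $\lambda_M$ satisfies $\lambda_M>1$, and that the open set condition holds: there are nonempty open sets $U_i\subset\mathbb R^d$ ($i\in\mathcal A$) such that for each $i$ the sets $g_e(U_{t(e)})$, $s(e)=i$, are pairwise disjoint and contained in $U_i$. Let $(E_i)_{i\in\mathcal A}$ be the nonempty compact sets with $E_i=\bigcup_{s(e)=i}g_e(E_{t(e)})$. Let $\prec$ be a partial order on $\Gamma$ in which two edges are comparable if and only if they have the same initial vertex, and assume that the system is *linear*: for all $i\in\mathcal A$, $k\ge1$, if two walks $v=v_1\cdots v_k$ and $w=w_1\cdots w_k$ of length $k$ starting at $i$ are consecutive in the lexicographic order on such walks, then $E_v\cap E_w\ne\emptyset$,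 where $E_v=g_{v_1}\circ\cdots\circ g_{v_k}(E_{t(v_k)})$. **Pseudo-norm.** Fix $\delta\in(0,\frac12)$ and a nonnegative even $C^\infty$ function $\phi$ on $\mathbb R^d$ with $\phi(0)>0$, vanishing outside $B(0,\delta)$, $\int\phi=1$. With $V=A(B(0,1))\setminus B(0,1)$ and $h=\chi_V*\phi$ put $\|x\|_\omega=\sum_{n\in\mathbb Z}q^{-n/d}h(A^nx)$. Let $\mathcal H^s_\omega$ and $\dim_\omega$ be the Hausdorff measure and dimension defined with diameters taken in $\|\cdot\|_\omega$: $\operatorname{diam}_\omega U=\sup_{x,y\in U}\|x-y\|_\omega$, $\mathcal H^s_\omega(S)=\lim_{\eta\to0}\inf\{\sum_n(\operatorname{diam}_\omega U_n)^s: S\subset\bigcup_n U_n,\ \operatorname{diam}_\omega U_n\le\eta\}$ (countable covers), and $\dim_\omega S=\inf\{s\ge0:\mathcal H^s_\omega(S)=0\}$. **Optimal parametrization.** Let $j\in\mathcal A$, $\alpha=\dim_\omega E_j$, and let $\mathcal L$ be Lebesgue measure. A continuous surjection $\psi:[0,1]\to E_j$ is called an optimal parametrization of $E_j$ if (i) it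 is a measure isomorphism between $([0,1],\mathcal L)$ and $(E_j,\mathcal H^\alpha_\omega)$: there are Borel sets $I'\subset[0,1]$ and $E'\subset E_j$ of full measure such that $\psi:I'\to E'$ is a bijection, and, with $c=\mathcal H^\alpha_\omega(E_j)$, $\mathcal H^\alpha_\omega(\psi(F))=c\,\mathcal L(F)$ and $\mathcal L(\psi^{-1}(B))=c^{-1}\mathcal H^\alpha_\omega(B)$ for all Borel $F\subset[0,1]$, $B\subset E_j$; (ii) there is a constant $c'>0$ with $\|\psi(x)-\psi(y)\|_\omega\le c'|x-y|^{1/\alpha}$ for all $x,y\in[0,1]$. **Corollary 1.2.** Let $\lambda_{\max}$ and $\lambda_{\min}$ be the largest and smallest moduli of the (complex) eigenvalues of $A$. Then for every $j\in\mathcal A$ the set $E_j$ has an optimal parametrization, and for every optimal parametrization $\psi_j$ of $E_j$ and every $0<\varepsilon<\lambda_{\min}-1$ there are constants $C_1,C_2>0$ such that for all $x,y\in[0,1]$, in the Euclidean norm, $$\|\psi_j(x)-\psi_j(y)\|\le C_1|x-y|^{\ln(\lambda_{\max}+\varepsilon)/\ln\lambda_M}\quad\text{if }\|\psi_j(x)-\psi_j(y)\|\ge1,$$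 $$\|\psi_j(x)-\psi_j(y)\|\le C_2|x-y|^{\ln(\lambda_{\min}-\varepsilon)/\ln\lambda_M}\quad\text{if }\|\psi_j(x)-\psi_j(y)\|\le1.$$ -/

import Mathlib

open MeasureTheory
open scoped ENNReal ContDiff

noncomputable section

/-! ### Eigenvalues -/

/-- The set of moduli of the complex eigenvalues of a real square matrix. -/
def eigenvalueModuli {d : ℕ} (A : Matrix (Fin d) (Fin d) ℝ) : Set ℝ :=
  {r | ∃ μ : ℂ, Module.End.HasEigenvalue (Matrix.toLin' (A.map (fun t : ℝ => (t : ℂ)))) μ ∧ r = ‖μ‖}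

/-- A real square matrix is expanding if all its complex eigenvalues have modulus `> 1`. -/
def IsExpanding {d : ℕ} (A : Matrix (Fin d) (Fin d) ℝ) : Prop :=
  ∀ r ∈ eigenvalueModuli A, 1 < r

/-- The largest modulus of an eigenvalue of `A` (a maximum over a finite set, nonempty for
`d ≥ 1`). -/
def maxModulus {d : ℕ} (A : Matrix (Fin d) (Fin d) ℝ) : ℝ := sSup (eigenvalueModuli A)

/-- The smallest modulus of an eigenvalue of `A` (a minimum over a finite set, nonempty for
`d ≥ 1`). -/
def minModulus {d : ℕ} (A : Matrix (Fin d) (Fin d) ℝ) : ℝ := sInf (eigenvalueModuli A)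

/-- The maximal (real) eigenvalue of a square matrix; for a primitive matrix this is the
Perron eigenvalue. -/
def maxEigenvalue {V : Type*} [Fintype V] [DecidableEq V] (M : Matrix V V ℝ) : ℝ :=
  sSup {t : ℝ | Module.End.HasEigenvalue (Matrix.toLin' M) t}

/-! ### Pseudo-norm, Hausdorff measure and Hausdorff dimension attached to `A` -/

/-- The smoothing kernels allowed in the definition of the pseudo-norm: smooth, even, nonnegative
functions that are positive at the origin, vanish outside `B(0, δ)`, and have integral `1`. -/
structure IsSmoothingKernel {d : ℕ} (δ : ℝ) (φ : EuclideanSpace ℝ (Fin d) → ℝ) : Prop where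
  contDiff : ContDiff ℝ ∞ φ
  nonneg : ∀ x, 0 ≤ φ x
  pos_zero : 0 < φ 0
  support_subset : Function.support φ ⊆ Metric.ball 0 δ
  even : ∀ x, φ (-x) = φ x
  integral_eq_one : ∫ x, φ x = 1

/-- The set `V = A(B(0,1)) \ B(0,1)`. -/
def annulusSet {d : ℕ} (A : Matrix (Fin d) (Fin d) ℝ) : Set (EuclideanSpace ℝ (Fin d)) :=
  (Matrix.toEuclideanLin A '' Metric.ball 0 1) \ Metric.ball 0 1

/-- The function `h = χ_V * φ`. -/
def smoothedIndicator {d : ℕ} (A : Matrix (Fin d) (Fin d) ℝ)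
    (φ : EuclideanSpace ℝ (Fin d) → ℝ) (x : EuclideanSpace ℝ (Fin d)) : ℝ :=
  ∫ y, (annulusSet A).indicator (fun _ => (1 : ℝ)) (x - y) * φ y

/-- The pseudo-norm `‖x‖_ω = ∑_{n ∈ ℤ} q^{-n/d} h(Aⁿ x)` with `q = |det A|`. For an expanding `A`
and a smoothing kernel only finitely many terms are nonzero. -/
def pseudoNorm {d : ℕ} (A : Matrix (Fin d) (Fin d) ℝ)
    (φ : EuclideanSpace ℝ (Fin d) → ℝ) (x : EuclideanSpace ℝ (Fin d)) : ℝ :=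
  ∑' n : ℤ, |A.det| ^ (-(n : ℝ) / (d : ℝ)) *
    smoothedIndicator A φ (Matrix.toEuclideanLin (A ^ n) x)

/-- The `ω`-diameter `sup {‖x - y‖_ω : x, y ∈ S}`. -/
def omegaDiam {d : ℕ} (A : Matrix (Fin d) (Fin d) ℝ)
    (φ : EuclideanSpace ℝ (Fin d) → ℝ) (S : Set (EuclideanSpace ℝ (Fin d))) : ℝ≥0∞ :=
  ⨆ x ∈ S, ⨆ y ∈ S, ENNReal.ofReal (pseudoNorm A φ (x - y))

/-- `H^s_{ω,δ}(S)`, the infimum of `∑ (diam_ω Uₙ)^s` over countable covers of `S` by sets of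
`ω`-diameter at most `δ`; empty sets of a cover contribute `0`. -/
def omegaHausdorffPre {d : ℕ} (A : Matrix (Fin d) (Fin d) ℝ)
    (φ : EuclideanSpace ℝ (Fin d) → ℝ) (s δ : ℝ) (S : Set (EuclideanSpace ℝ (Fin d))) : ℝ≥0∞ :=
  ⨅ (U : ℕ → Set (EuclideanSpace ℝ (Fin d))) (_ : S ⊆ ⋃ n, U n)
    (_ : ∀ n, omegaDiam A φ (U n) ≤ ENNReal.ofReal δ),
    ∑' n, ⨆ (_ : (U n).Nonempty), omegaDiam A φ (U n) ^ s

/-- `H^s_ω(S) = lim_{δ → 0} H^s_{ω,δ}(S)`; the limit is a supremum by monotonicity in `δ`. -/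
def omegaHausdorff {d : ℕ} (A : Matrix (Fin d) (Fin d) ℝ)
    (φ : EuclideanSpace ℝ (Fin d) → ℝ) (s : ℝ) (S : Set (EuclideanSpace ℝ (Fin d))) : ℝ≥0∞ :=
  ⨆ (δ : ℝ) (_ : 0 < δ), omegaHausdorffPre A φ s δ S

/-- The Hausdorff dimension with respect to the pseudo-norm. -/
def omegaDim {d : ℕ} (A : Matrix (Fin d) (Fin d) ℝ)
    (φ : EuclideanSpace ℝ (Fin d) → ℝ) (S : Set (EuclideanSpace ℝ (Fin d))) : ℝ :=
  sInf {s : ℝ | 0 ≤ s ∧ omegaHausdorff A φ s S = 0}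

/-! ### Optimal parametrizations -/

/-- `ψ : [0,1] → S` is a measure isomorphism between `[0,1]` with Lebesgue measure and `S` with the
set function `H`, where `H` is rescaled by its total value `c = H(S)`. -/
def IsMeasureIso {d : ℕ} (H : Set (EuclideanSpace ℝ (Fin d)) → ℝ≥0∞)
    (S : Set (EuclideanSpace ℝ (Fin d))) (ψ : unitInterval → EuclideanSpace ℝ (Fin d)) : Prop :=
  (∃ (I' : Set unitInterval) (S' : Set (EuclideanSpace ℝ (Fin d))),
      MeasurableSet I' ∧ MeasurableSet S' ∧ S' ⊆ S ∧
      volume I'ᶜ = 0 ∧ H (S \ S') = 0 ∧ Set.BijOn ψ I' S') ∧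
  (∀ F : Set unitInterval, MeasurableSet F → H (ψ '' F) = H S * volume F) ∧
  (∀ B : Set (EuclideanSpace ℝ (Fin d)), MeasurableSet B → B ⊆ S →
      volume (ψ ⁻¹' B) = (H S)⁻¹ * H B)

/-- `ψ` is an optimal parametrization of `S` with respect to the pseudo-norm: a continuous
surjection `[0,1] → S` that is a measure isomorphism onto `S` with the `α`-dimensional Hausdorff
measure of the pseudo-norm and is `1/α`-Hölder for the pseudo-norm, `α` being the dimension
of `S` with respect to the pseudo-norm. -/
structure IsOptimalParametrization {d : ℕ} (A : Matrix (Fin d) (Fin d) ℝ)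
    (φ : EuclideanSpace ℝ (Fin d) → ℝ) (S : Set (EuclideanSpace ℝ (Fin d)))
    (ψ : unitInterval → EuclideanSpace ℝ (Fin d)) : Prop where
  continuous : Continuous ψ
  range_eq : Set.range ψ = S
  measureIso : IsMeasureIso (omegaHausdorff A φ (omegaDim A φ S)) S ψ
  holder : ∃ c : ℝ, 0 < c ∧ ∀ x y : unitInterval,
    pseudoNorm A φ (ψ x - ψ y) ≤ c * |(x : ℝ) - (y : ℝ)| ^ (1 / omegaDim A φ S)

/-! ### Single-matrix graph-directed iterated function systems -/

/-- A directed graph with vertex set `V` and edge set `Γ` (loops and parallel edges allowed),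
a matrix `A`, and a translation vector for every edge. -/
structure SingleMatrixGIFS (d : ℕ) (V Γ : Type*) where
  /-- initial vertex of an edge -/
  src : Γ → V
  /-- terminal vertex of an edge -/
  tgt : Γ → V
  /-- the common matrix -/
  A : Matrix (Fin d) (Fin d) ℝ
  /-- the translation vector of an edge -/
  trans : Γ → EuclideanSpace ℝ (Fin d)

namespace SingleMatrixGIFS

variable {d : ℕ} {V Γ : Type*}

/-- The map `g_e(x) = A⁻¹ (x + d_e)`. -/
def map (G : SingleMatrixGIFS d V Γ) (e : Γ) (x : EuclideanSpace ℝ (Fin d)) :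
    EuclideanSpace ℝ (Fin d) :=
  Matrix.toEuclideanLin G.A⁻¹ (x + G.trans e)

/-- The associated matrix: the `(i, j)` entry is the number of edges from `j` to `i`. -/
def assocMatrix (G : SingleMatrixGIFS d V Γ) : Matrix V V ℝ :=
  Matrix.of fun i j => (Nat.card {e : Γ // G.src e = j ∧ G.tgt e = i} : ℝ)

/-- The family of invariant sets: nonempty compact sets with `E i = ⋃ g_e(E_{t(e)})`, the union
over the edges `e` starting at `i`. -/
def IsInvariantFamily (G : SingleMatrixGIFS d V Γ)
    (E : V → Set (EuclideanSpace ℝ (Fin d))) : Prop :=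
  (∀ i, (E i).Nonempty) ∧ (∀ i, IsCompact (E i)) ∧
    ∀ i, E i = ⋃ (e : Γ) (_ : G.src e = i), G.map e '' E (G.tgt e)

/-- The open set condition. -/
def OpenSetCondition (G : SingleMatrixGIFS d V Γ) : Prop :=
  ∃ U : V → Set (EuclideanSpace ℝ (Fin d)),
    (∀ i, IsOpen (U i)) ∧ (∀ i, (U i).Nonempty) ∧
    (∀ e, G.map e '' U (G.tgt e) ⊆ U (G.src e)) ∧
    ∀ e f, e ≠ f → G.src e = G.src f →
      Disjoint (G.map e '' U (G.tgt e)) (G.map f '' U (G.tgt f))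

/-- Ordered GIFS: the partial order on the edges is linear on the edges starting at a common
vertex, and edges with different initial vertices are not comparable. -/
def IsOrdered [PartialOrder Γ] (G : SingleMatrixGIFS d V Γ) : Prop :=
  ∀ e f : Γ, (e ≤ f ∨ f ≤ e) ↔ G.src e = G.src f

/-- `G.IsWalk i w`: the list of edges `w` is a walk starting at the vertex `i`. -/
def IsWalk (G : SingleMatrixGIFS d V Γ) : V → List Γ → Prop
  | _, [] => True
  | i, e :: w => G.src e = i ∧ IsWalk G (G.tgt e) w

/-- The terminal vertex of a walk starting at `i`. -/
def walkEnd (G : SingleMatrixGIFS d V Γ) : V → List Γ → V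
  | i, [] => i
  | _, e :: w => walkEnd G (G.tgt e) w

/-- The composition `g_{w₁} ∘ ⋯ ∘ g_{wₙ}` along a walk. -/
def walkMap (G : SingleMatrixGIFS d V Γ) :
    List Γ → EuclideanSpace ℝ (Fin d) → EuclideanSpace ℝ (Fin d)
  | [] => id
  | e :: w => G.map e ∘ walkMap G w

/-- The cylinder set `E_w = g_w(E_{t(w)})` of a walk `w` starting at `i`. -/
def cylinderSet (G : SingleMatrixGIFS d V Γ) (E : V → Set (EuclideanSpace ℝ (Fin d)))
    (i : V) (w : List Γ) : Set (EuclideanSpace ℝ (Fin d)) :=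
  G.walkMap w '' E (G.walkEnd i w)

/-- The set `Γ_i^k` of walks of length `k` starting at `i`. -/
def walks (G : SingleMatrixGIFS d V Γ) (i : V) (k : ℕ) : Set (List Γ) :=
  {w | w.length = k ∧ G.IsWalk i w}

/-- `v` immediately precedes `w` in the lexicographic order on the walks of length `k`
starting at `i`. -/
def IsAdjacent [PartialOrder Γ] (G : SingleMatrixGIFS d V Γ) (i : V) (k : ℕ)
    (v w : List Γ) : Prop :=
  v ∈ G.walks i k ∧ w ∈ G.walks i k ∧ List.Lex (· < ·) v w ∧
    ¬ ∃ u ∈ G.walks i k, List.Lex (· < ·) v u ∧ List.Lex (· < ·) u w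

/-- Linear GIFS: the cylinder sets of adjacent walks of any length `k ≥ 1` intersect. -/
def IsLinear [PartialOrder Γ] (G : SingleMatrixGIFS d V Γ)
    (E : V → Set (EuclideanSpace ℝ (Fin d))) : Prop :=
  ∀ (i : V) (k : ℕ), 1 ≤ k → ∀ v w : List Γ, G.IsAdjacent i k v w →
    (G.cylinderSet E i v ∩ G.cylinderSet E i w).Nonempty

end SingleMatrixGIFS

end

/-! The pseudo-norm is built so that `A` multiplies it by q^(1/d) (`pseudoNorm_zpow`). Measured in
it, every edge map is a similarity of ratio κ = q^(-1/d), and the theory of self-similar sets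
applies with the exponent α given by κ^α = 1/λ_M. No quasi-triangle inequality is used: a
configuration at scale κ^k is magnified by `A ^ k`, compared there by the Euclidean triangle
inequality, and brought back by homogeneity (`exists_pseudoNorm_le_pow`).

A positive left Perron vector p cuts [0, p_j] into intervals of length λ_M^(-k) p_i, indexed by the
walks of length k in lexicographic order (i is the end of the walk). A coding map sends each
parameter, at every level, into the cylinder of a walk whose interval contains it. Linearity makes
consecutive cylinders meet, so close parameters have close images (`IsCoding.exists_holder`). The
open set condition bounds the number of cylinders that a set of comparable size can meet; the mass
distribution principle (`IsCoding.exists_volume_preimage_le`) then gives H^α(E_j) > 0. Covers by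
cylinders give H^α(E_j) < ∞, so the dimension is α.

For the measure isomorphism the weights must be H^α(E_i) themselves. Subadditivity gives one
inequality of the eigenvector equation, and pairing with a positive right Perron vector turns it
into equality (`IsWeight.isWeight_omegaHausdorff`). With these weights normalized Hausdorff measure
is dominated by the image of Lebesgue measure; both are probabilities, hence equal
(`IsCoding.volume_preimage_eq`). Distinct cylinders of one level overlap in null sets, which yields
injectivity almost everywhere.

The Euclidean bounds use only the Hölder property of an optimal parametrization. Writing x = A^n v
with v in a fixed annulus, ‖x‖_ω is comparable to q^(n/d), while ‖x‖ is at most a constant times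
r^n, with r slightly above the largest or below the smallest eigenvalue modulus according to the
range of ‖x‖. -/

noncomputable section

/-! ### Perron–Frobenius theory for primitive matrices -/

section PerronFrobenius

variable {V : Type*} [Fintype V] [DecidableEq V]

theorem Matrix.IsPrimitive.transpose {M : Matrix V V ℝ} (hM : M.IsPrimitive) :
    M.transpose.IsPrimitive := by
  obtain ⟨h0, k, hk, hpos⟩ := hM
  refine ⟨fun i j => h0 j i, k, hk, fun i j => ?_⟩
  rw [← Matrix.transpose_pow]
  exact hpos j i

omit [DecidableEq V] in
theorem Matrix.mulVec_pos_of_pos {N : Matrix V V ℝ} (hN : ∀ i j, 0 < N i j) {z : V → ℝ}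
    (hz : ∀ i, 0 ≤ z i) (hz0 : z ≠ 0) (i : V) : 0 < N.mulVec z i := by
  obtain ⟨j, hj⟩ := Function.ne_iff.1 hz0
  have hj' : 0 < z j := lt_of_le_of_ne (hz j) (Ne.symm hj)
  exact Finset.sum_pos' (fun l _ => mul_nonneg (hN i l).le (hz l))
    ⟨j, Finset.mem_univ _, mul_pos (hN i j) hj'⟩

/-- A primitive matrix has a positive eigenvector. -/
theorem Matrix.IsPrimitive.exists_pos_eigenvector [Nonempty V] {M : Matrix V V ℝ}
    (hM : M.IsPrimitive) : ∃ (r : ℝ) (x : V → ℝ), (∀ i, 0 < x i) ∧ M.mulVec x = r • x := by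
  obtain ⟨h0, k, -, hpos⟩ := hM
  set c : ℝ := ∑ i, ∑ j, M i j
  -- Collatz–Wielandt: maximize t over the pairs (t, x), x in the simplex, with t x ≤ M x entrywise.
  -- The entry sum `c` bounds t, so the set is compact.
  let T : Set (ℝ × (V → ℝ)) :=
    (Set.Icc 0 c ×ˢ stdSimplex ℝ V) ∩ {p | ∀ i, p.1 * p.2 i ≤ M.mulVec p.2 i}
  have hTc : IsCompact T := by
    refine (isCompact_Icc.prod (isCompact_stdSimplex ℝ V)).inter_right ?_
    simp only [Set.ofPred_forall]
    refine isClosed_iInter fun i => isClosed_le (by fun_prop) ?_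
    have : Continuous fun p : ℝ × (V → ℝ) => M.mulVec p.2 :=
      Continuous.matrix_mulVec continuous_const continuous_snd
    exact (continuous_apply i).comp this
  have hc : 0 ≤ c := Finset.sum_nonneg fun i _ => Finset.sum_nonneg fun j _ => h0 i j
  have hbound : ∀ (t : ℝ) (x : V → ℝ), x ∈ stdSimplex ℝ V → (∀ i, t * x i ≤ M.mulVec x i) →
      t ≤ c := by
    intro t x hx ht
    calc t = ∑ i, t * x i := by rw [← Finset.mul_sum, hx.2, mul_one]
      _ ≤ ∑ i, M.mulVec x i := Finset.sum_le_sum fun i _ => ht i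
      _ ≤ c := Finset.sum_le_sum fun i _ => Finset.sum_le_sum fun j _ => by
        have h1 : x j ≤ 1 := by
          rw [← hx.2]; exact Finset.single_le_sum (fun l _ => hx.1 l) (Finset.mem_univ j)
        exact mul_le_of_le_one_right (h0 i j) h1
  have hTne : T.Nonempty := by
    obtain ⟨x, hx⟩ : (stdSimplex ℝ V).Nonempty :=
      ⟨_, single_mem_stdSimplex ℝ (Classical.arbitrary V)⟩
    refine ⟨(0, x), ⟨⟨le_rfl, hc⟩, hx⟩, fun i => ?_⟩
    simp only [zero_mul]
    exact Finset.sum_nonneg fun j _ => mul_nonneg (h0 i j) (hx.1 j)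
  obtain ⟨⟨r, x⟩, ⟨⟨⟨hr0, -⟩, hx⟩, hrx⟩, hmax⟩ :=
    hTc.exists_isMaxOn hTne continuous_fst.continuousOn
  simp only at hr0 hx hrx
  have hxne : x ≠ 0 := by
    rintro rfl
    have := hx.2
    simp at this
  have hy : ∀ i, 0 < (M ^ k).mulVec x i := Matrix.mulVec_pos_of_pos hpos hx.1 hxne
  -- If M x ≠ r x, applying the positive matrix M^k to the nonzero vector M x - r x ≥ 0 makes the
  -- inequality strict for y = M^k x; then r can be raised by the least quotient ε, against
  -- maximality.
  have heq : M.mulVec x = r • x := by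
    by_contra hne
    set z : V → ℝ := M.mulVec x - r • x with hz
    have hzpos : ∀ i, 0 < (M ^ k).mulVec z i :=
      Matrix.mulVec_pos_of_pos hpos (fun i => by simpa [hz] using hrx i) (sub_ne_zero.2 hne)
    set y := (M ^ k).mulVec x with hydef
    have hMy : ∀ i, M.mulVec y i = r * y i + (M ^ k).mulVec z i := by
      intro i
      have : M.mulVec y = (M ^ k).mulVec (M.mulVec x) := by
        rw [hydef, Matrix.mulVec_mulVec, Matrix.mulVec_mulVec, (Commute.self_pow M k).eq]
      rw [this, hz, Matrix.mulVec_sub, Matrix.mulVec_smul]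
      simp [hydef]
    obtain ⟨i₀, -, hi₀⟩ := Finset.exists_min_image Finset.univ
      (fun i => (M ^ k).mulVec z i / y i) Finset.univ_nonempty
    set ε := (M ^ k).mulVec z i₀ / y i₀
    have hε : 0 < ε := div_pos (hzpos _) (hy _)
    set s := ∑ i, y i
    have hs : 0 < s := Finset.sum_pos (fun i _ => hy i) Finset.univ_nonempty
    have hmem : s⁻¹ • y ∈ stdSimplex ℝ V := by
      refine ⟨fun i => mul_nonneg (inv_nonneg.2 hs.le) (hy i).le, ?_⟩
      simp only [Pi.smul_apply, smul_eq_mul, ← Finset.mul_sum]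
      exact inv_mul_cancel₀ hs.ne'
    have hle : ∀ i, (r + ε) * (s⁻¹ • y) i ≤ M.mulVec (s⁻¹ • y) i := by
      intro i
      rw [Matrix.mulVec_smul]
      simp only [Pi.smul_apply, smul_eq_mul, hMy]
      have h1 : ε * y i ≤ (M ^ k).mulVec z i := by
        have := hi₀ i (Finset.mem_univ i)
        rwa [le_div_iff₀ (hy i)] at this
      have h2 := mul_le_mul_of_nonneg_left h1 (inv_nonneg.2 hs.le)
      nlinarith
    have hT : ((r + ε, s⁻¹ • y) : ℝ × (V → ℝ)) ∈ T :=
      ⟨⟨⟨by linarith, hbound _ _ hmem hle⟩, hmem⟩, hle⟩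
    have := hmax hT
    simp only [Set.mem_ofPred_eq] at this
    linarith
  refine ⟨r, x, fun i => ?_, heq⟩
  have hpow : ∀ n : ℕ, (M ^ n).mulVec x = r ^ n • x := by
    intro n
    induction n with
    | zero => simp
    | succ n ih =>
      rw [pow_succ', ← Matrix.mulVec_mulVec, ih, Matrix.mulVec_smul, heq, smul_smul, pow_succ]
  have := hy i
  rw [hpow] at this
  refine lt_of_le_of_ne (hx.1 i) fun h => ?_
  simp [← h] at this

/-- Pairing with the positive left eigenvector p shows that left and right eigenvalues agree. For
any real eigenvalue t with eigenvector v, |t| |v| ≤ M |v| entrywise, and pairing with p gives |t| ≤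
r. So the eigenvalue found is the greatest one. -/
theorem Matrix.IsPrimitive.exists_perron [Nonempty V] {M : Matrix V V ℝ}
    (hM : M.IsPrimitive) :
    (∃ u : V → ℝ, (∀ i, 0 < u i) ∧ M.mulVec u = maxEigenvalue M • u) ∧
      ∃ p : V → ℝ, (∀ i, 0 < p i) ∧ M.transpose.mulVec p = maxEigenvalue M • p := by
  obtain ⟨r, u, hu, hru⟩ := hM.exists_pos_eigenvector
  obtain ⟨r', p, hp, hrp⟩ := hM.transpose.exists_pos_eigenvector
  have hpair : ∀ (v : V → ℝ), dotProduct p (M.mulVec v) = r' * dotProduct p v := by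
    intro v
    rw [Matrix.dotProduct_mulVec, ← Matrix.mulVec_transpose, hrp, smul_dotProduct, smul_eq_mul]
  have hpu : 0 < dotProduct p u :=
    Finset.sum_pos (fun i _ => mul_pos (hp i) (hu i)) Finset.univ_nonempty
  have hrr : r = r' := by
    have h := hpair u
    rw [hru, dotProduct_smul, smul_eq_mul] at h
    exact mul_right_cancel₀ hpu.ne' h
  have hgreat : IsGreatest {t : ℝ | Module.End.HasEigenvalue (Matrix.toLin' M) t} r := by
    constructor
    · refine Module.End.hasEigenvalue_of_hasEigenvector (x := u) ?_
      rw [Module.End.hasEigenvector_iff]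
      refine ⟨?_, fun h => ?_⟩
      · rw [Module.End.mem_eigenspace_iff, Matrix.toLin'_apply, hru]
      · have := hu (Classical.arbitrary V)
        simp [h] at this
    · intro t ht
      obtain ⟨v, hv⟩ := ht.exists_hasEigenvector
      have hv1 : M.mulVec v = t • v := by
        have := hv.apply_eq_smul
        rwa [Matrix.toLin'_apply] at this
      have hv0 := hv.2
      obtain ⟨i, hi⟩ := Function.ne_iff.1 hv0
      set w : V → ℝ := fun i => |v i|
      have hle : ∀ i, |t| * w i ≤ M.mulVec w i := by
        intro i
        calc |t| * w i = |M.mulVec v i| := by rw [hv1]; simp [w, abs_mul]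
          _ ≤ ∑ j, |M i j * v j| := Finset.abs_sum_le_sum_abs _ _
          _ = M.mulVec w i := Finset.sum_congr rfl fun j _ => by
            rw [abs_mul, abs_of_nonneg (hM.1 i j)]
      have hw : 0 < dotProduct p w :=
        Finset.sum_pos' (fun i _ => mul_nonneg (hp i).le (abs_nonneg _))
          ⟨i, Finset.mem_univ _, mul_pos (hp i) (abs_pos.2 hi)⟩
      have h2 : |t| * dotProduct p w ≤ r' * dotProduct p w := by
        rw [← hpair]
        unfold dotProduct
        rw [Finset.mul_sum]
        exact Finset.sum_le_sum fun i _ => by nlinarith [hle i, hp i]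
      rw [hrr]
      exact (le_abs_self t).trans (le_of_mul_le_mul_right h2 hw)
  have hmax : maxEigenvalue M = r := hgreat.csSup_eq
  exact ⟨⟨u, hu, by rw [hmax, hru]⟩, ⟨p, hp, by rw [hmax, hrp, hrr]⟩⟩

end PerronFrobenius

/-! ### Eigenvalue moduli and the growth of matrix powers -/

section ExpandingMatrices

open Matrix Filter Topology

/-- Gelfand's formula gives ‖a^n‖ ≤ r^n for large n; the finitely many remaining powers are absorbed
into the constant. -/
theorem spectrum.exists_norm_pow_le {R : Type*} [NormedRing R] [NormedAlgebra ℂ R]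
    [CompleteSpace R] [Nontrivial R] (a : R) {r : ℝ} (hr0 : 0 < r)
    (hr : ∀ z ∈ spectrum ℂ a, ‖z‖ < r) : ∃ C : ℝ, 0 < C ∧ ∀ n : ℕ, ‖a ^ n‖ ≤ C * r ^ n := by
  lift r to NNReal using hr0.le
  have hlt : spectralRadius ℂ a < r := spectrum.spectralRadius_lt_of_forall_lt a
    fun z hz => by exact_mod_cast hr z hz
  have hev := (spectrum.pow_nnnorm_pow_one_div_tendsto_nhds_spectralRadius a).eventually
    (gt_mem_nhds hlt)
  obtain ⟨N, hN⟩ := eventually_atTop.1 hev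
  have hN' : ∀ n ≥ N + 1, ‖a ^ n‖ ≤ r ^ n := by
    intro n hn
    have h := hN n (by omega)
    have hn0 : (0 : ℝ) < n := by exact_mod_cast (by omega : 0 < n)
    have h2 := ENNReal.rpow_le_rpow h.le hn0.le
    rw [← ENNReal.rpow_mul, one_div_mul_cancel hn0.ne', ENNReal.rpow_one,
      ENNReal.rpow_natCast] at h2
    exact_mod_cast h2
  refine ⟨1 + ∑ n ∈ Finset.range (N + 1), ‖a ^ n‖ / (r : ℝ) ^ n, by positivity, fun n => ?_⟩
  have hrn : (0 : ℝ) < (r : ℝ) ^ n := pow_pos hr0 n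
  have hs : 0 ≤ ∑ n ∈ Finset.range (N + 1), ‖a ^ n‖ / (r : ℝ) ^ n := by positivity
  by_cases hn : N + 1 ≤ n
  · nlinarith [hN' n hn]
  · have h1 : ‖a ^ n‖ / (r : ℝ) ^ n ≤ ∑ n ∈ Finset.range (N + 1), ‖a ^ n‖ / (r : ℝ) ^ n :=
      Finset.single_le_sum (f := fun n => ‖a ^ n‖ / (r : ℝ) ^ n) (fun _ _ => by positivity)
        (Finset.mem_range.2 (by omega))
    rw [div_le_iff₀ hrn] at h1
    nlinarith

variable {d : ℕ}

theorem norm_eq_of_mem_spectrum_map {A : Matrix (Fin d) (Fin d) ℝ} {z : ℂ}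
    (hz : z ∈ spectrum ℂ (A.map (fun t : ℝ => (t : ℂ)))) : ‖z‖ ∈ eigenvalueModuli A := by
  refine ⟨z, ?_, rfl⟩
  rw [Module.End.hasEigenvalue_iff_mem_spectrum, Matrix.spectrum_toLin']
  exact hz

theorem mem_spectrum_of_mem_eigenvalueModuli {A : Matrix (Fin d) (Fin d) ℝ} {r : ℝ}
    (hr : r ∈ eigenvalueModuli A) :
    ∃ z ∈ spectrum ℂ (A.map (fun t : ℝ => (t : ℂ))), r = ‖z‖ := by
  obtain ⟨z, hz, rfl⟩ := hr
  rw [Module.End.hasEigenvalue_iff_mem_spectrum, Matrix.spectrum_toLin'] at hz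
  exact ⟨z, hz, rfl⟩

theorem finite_eigenvalueModuli (A : Matrix (Fin d) (Fin d) ℝ) :
    (eigenvalueModuli A).Finite := by
  refine ((Module.End.finite_hasEigenvalue
    (Matrix.toLin' (A.map (fun t : ℝ => (t : ℂ))))).image norm).subset ?_
  rintro r ⟨z, hz, rfl⟩
  exact ⟨z, hz, rfl⟩

theorem eigenvalueModuli_nonempty [NeZero d] (A : Matrix (Fin d) (Fin d) ℝ) :
    (eigenvalueModuli A).Nonempty := by
  obtain ⟨z, hz⟩ := Module.End.exists_eigenvalue (Matrix.toLin' (A.map (fun t : ℝ => (t : ℂ))))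
  exact ⟨_, z, hz, rfl⟩

theorem le_maxModulus {A : Matrix (Fin d) (Fin d) ℝ} {r : ℝ} (hr : r ∈ eigenvalueModuli A) :
    r ≤ maxModulus A := le_csSup (finite_eigenvalueModuli A).bddAbove hr

theorem minModulus_le {A : Matrix (Fin d) (Fin d) ℝ} {r : ℝ} (hr : r ∈ eigenvalueModuli A) :
    minModulus A ≤ r := csInf_le (finite_eigenvalueModuli A).bddBelow hr

theorem one_lt_minModulus [NeZero d] {A : Matrix (Fin d) (Fin d) ℝ} (hA : IsExpanding A) :
    1 < minModulus A :=
  hA _ ((eigenvalueModuli_nonempty A).csInf_mem (finite_eigenvalueModuli A))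

theorem minModulus_le_maxModulus [NeZero d] (A : Matrix (Fin d) (Fin d) ℝ) :
    minModulus A ≤ maxModulus A :=
  minModulus_le ((eigenvalueModuli_nonempty A).csSup_mem (finite_eigenvalueModuli A))

open scoped Matrix.Norms.L2Operator in
-- Complexifying a real vector preserves its norm, so growth bounds from the complex spectrum pass
-- to the real action.
theorem norm_toEuclideanLin_le (A : Matrix (Fin d) (Fin d) ℝ) (x : EuclideanSpace ℝ (Fin d)) :
    ‖toEuclideanLin A x‖ ≤ ‖A.map (fun t : ℝ => (t : ℂ))‖ * ‖x‖ := by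
  let y : EuclideanSpace ℂ (Fin d) := WithLp.toLp 2 fun i => (x i : ℂ)
  have hy : ‖y‖ = ‖x‖ := by simp [EuclideanSpace.norm_eq, y]
  have h := Matrix.l2_opNorm_mulVec (A.map (fun t : ℝ => (t : ℂ))) y
  rw [hy] at h
  refine le_of_eq_of_le ?_ h
  simp only [EuclideanSpace.norm_eq]
  congr 1
  refine Finset.sum_congr rfl fun i _ => ?_
  congr 1
  rw [← Complex.norm_real]
  congr 1
  simp [Matrix.mulVec, dotProduct, y]

open scoped Matrix.Norms.L2Operator in
theorem exists_norm_pow_le [NeZero d] (A : Matrix (Fin d) (Fin d) ℝ) {r : ℝ} (hr0 : 0 < r)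
    (hr : ∀ ρ ∈ eigenvalueModuli A, ρ < r) :
    ∃ C : ℝ, 0 < C ∧ ∀ (n : ℕ) (x : EuclideanSpace ℝ (Fin d)),
      ‖toEuclideanLin (A ^ n) x‖ ≤ C * r ^ n * ‖x‖ := by
  have : CompleteSpace (Matrix (Fin d) (Fin d) ℂ) := FiniteDimensional.complete ℂ _
  obtain ⟨C, hC, h⟩ := spectrum.exists_norm_pow_le (A.map (fun t : ℝ => (t : ℂ))) hr0
    fun z hz => hr _ (norm_eq_of_mem_spectrum_map hz)
  refine ⟨C, hC, fun n x => (norm_toEuclideanLin_le _ x).trans ?_⟩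
  have h1 : (A ^ n).map (fun t : ℝ => (t : ℂ)) = (A.map (fun t : ℝ => (t : ℂ))) ^ n :=
    Matrix.map_pow A Complex.ofRealHom n
  rw [h1]
  exact mul_le_mul_of_nonneg_right (h n) (norm_nonneg _)

theorem IsExpanding.isUnit_det {A : Matrix (Fin d) (Fin d) ℝ} (hA : IsExpanding A) :
    IsUnit A.det := by
  have h0 : (0 : ℂ) ∉ spectrum ℂ (A.map (fun t : ℝ => (t : ℂ))) := fun h => by
    have := hA _ (norm_eq_of_mem_spectrum_map h)
    simp at this
    linarith
  rw [spectrum.zero_notMem_iff, Matrix.isUnit_iff_isUnit_det] at h0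
  have h1 : (A.map (fun t : ℝ => (t : ℂ))).det = (A.det : ℂ) :=
    (RingHom.map_det Complex.ofRealHom A).symm
  rw [h1, isUnit_iff_ne_zero] at h0
  exact isUnit_iff_ne_zero.2 (by exact_mod_cast h0)

theorem eigenvalueModuli_inv {A : Matrix (Fin d) (Fin d) ℝ} (hA : IsExpanding A) {ρ : ℝ}
    (hρ : ρ ∈ eigenvalueModuli A⁻¹) : ρ⁻¹ ∈ eigenvalueModuli A := by
  obtain ⟨z, hz, rfl⟩ := mem_spectrum_of_mem_eigenvalueModuli hρ
  set B := A.map (fun t : ℝ => (t : ℂ))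
  set B' := A⁻¹.map (fun t : ℝ => (t : ℂ))
  have hmul : B * B' = 1 := by
    have := congrArg (fun M : Matrix (Fin d) (Fin d) ℝ => M.map Complex.ofRealHom)
      (Matrix.mul_nonsing_inv A hA.isUnit_det)
    rw [Matrix.map_mul, Matrix.map_one _ (map_zero _) (map_one _)] at this
    exact this
  have hmul' : B' * B = 1 := mul_eq_one_comm.1 hmul
  let b : (Matrix (Fin d) (Fin d) ℂ)ˣ := ⟨B, B', hmul, hmul'⟩
  have hz' : z ∈ spectrum ℂ (↑(b⁻¹) : Matrix (Fin d) (Fin d) ℂ) := hz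
  have hz0 : z ≠ 0 := spectrum.ne_zero_of_mem_of_unit hz'
  have h2 : z⁻¹ ∈ spectrum ℂ (b : Matrix (Fin d) (Fin d) ℂ) := by
    have := (spectrum.inv_mem_iff (r := Units.mk0 z hz0) (a := b⁻¹)).1 (by simpa using hz')
    simpa using this
  rw [← norm_inv]
  exact norm_eq_of_mem_spectrum_map h2

theorem exists_norm_inv_pow_le [NeZero d] {A : Matrix (Fin d) (Fin d) ℝ} (hA : IsExpanding A)
    {r : ℝ} (hr0 : 0 < r) (hr : r < minModulus A) :
    ∃ C : ℝ, 0 < C ∧ ∀ (n : ℕ) (x : EuclideanSpace ℝ (Fin d)),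
      ‖toEuclideanLin (A⁻¹ ^ n) x‖ ≤ C * r⁻¹ ^ n * ‖x‖ := by
  refine exists_norm_pow_le _ (inv_pos.2 hr0) fun ρ hρ => ?_
  have h := eigenvalueModuli_inv hA hρ
  have h1 := hr.trans_le (minModulus_le h)
  have h2 : 0 < ρ⁻¹ := hr0.trans h1
  exact (lt_inv_comm₀ hr0 (inv_pos.1 h2)).1 h1

/-- The powers of A⁻¹ tend to zero, hence by continuity so do the powers of its determinant, which
forces |det A⁻¹| < 1. -/
theorem IsExpanding.one_lt_abs_det [NeZero d] {A : Matrix (Fin d) (Fin d) ℝ}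
    (hA : IsExpanding A) : 1 < |A.det| := by
  obtain ⟨r, hr1, hr⟩ := exists_between (one_lt_minModulus hA)
  have hr0 : 0 < r := by linarith
  obtain ⟨C, hC, h⟩ := exists_norm_inv_pow_le hA hr0 hr
  have hlim : Tendsto (fun n : ℕ => C * r⁻¹ ^ n) atTop (𝓝 0) := by
    simpa using (tendsto_pow_atTop_nhds_zero_of_lt_one (inv_nonneg.2 hr0.le)
      (inv_lt_one_of_one_lt₀ hr1)).const_mul C
  have hmat : Tendsto (fun n : ℕ => A⁻¹ ^ n) atTop (𝓝 0) := by
    refine tendsto_pi_nhds.2 fun i => tendsto_pi_nhds.2 fun j => ?_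
    refine squeeze_zero_norm (fun n => ?_) hlim
    have h1 := (PiLp.norm_apply_le (toEuclideanLin (A⁻¹ ^ n) (EuclideanSpace.single j 1)) i).trans
      (h n _)
    simpa using h1
  have hdet : Tendsto (fun n : ℕ => (A⁻¹ ^ n).det) atTop (𝓝 0) := by
    have hc : Continuous fun M : Matrix (Fin d) (Fin d) ℝ => M.det := continuous_id.matrix_det
    have := (hc.tendsto 0).comp hmat
    rwa [Matrix.det_zero] at this
  simp only [Matrix.det_pow] at hdet
  have h3 := tendsto_pow_atTop_nhds_zero_iff.1 hdet
  rw [Matrix.det_nonsing_inv, Ring.inverse_eq_inv', abs_inv] at h3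
  exact (inv_lt_one₀ (abs_pos.2 hA.isUnit_det.ne_zero)).1 h3

theorem toEuclideanLin_mul_apply (A B : Matrix (Fin d) (Fin d) ℝ) (x : EuclideanSpace ℝ (Fin d)) :
    toEuclideanLin (A * B) x = toEuclideanLin A (toEuclideanLin B x) := by
  simp [Matrix.toLpLin_apply, Matrix.mulVec_mulVec]

theorem toEuclideanLin_one_apply (x : EuclideanSpace ℝ (Fin d)) :
    toEuclideanLin (1 : Matrix (Fin d) (Fin d) ℝ) x = x := by
  simp

theorem toEuclideanLin_zpow_add {A : Matrix (Fin d) (Fin d) ℝ} (hA : IsUnit A.det) (m n : ℤ)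
    (x : EuclideanSpace ℝ (Fin d)) :
    toEuclideanLin (A ^ (m + n)) x = toEuclideanLin (A ^ m) (toEuclideanLin (A ^ n) x) := by
  rw [Matrix.zpow_add hA, toEuclideanLin_mul_apply]

theorem toEuclideanLin_zpow_neg_self {A : Matrix (Fin d) (Fin d) ℝ} (hA : IsUnit A.det) (n : ℤ)
    (x : EuclideanSpace ℝ (Fin d)) :
    toEuclideanLin (A ^ (-n)) (toEuclideanLin (A ^ n) x) = x := by
  rw [← toEuclideanLin_zpow_add hA]
  simp

theorem continuous_toEuclideanLin (A : Matrix (Fin d) (Fin d) ℝ) :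
    Continuous (toEuclideanLin A) := LinearMap.continuous_of_finiteDimensional _

end ExpandingMatrices

/-! ### The pseudo-norm and its comparison with the Euclidean norm -/

section PseudoNorm

open Matrix Filter Topology

variable {d : ℕ} {A : Matrix (Fin d) (Fin d) ℝ} {δ : ℝ} {φ : EuclideanSpace ℝ (Fin d) → ℝ}

theorem exists_norm_toEuclideanLin_le (A : Matrix (Fin d) (Fin d) ℝ) :
    ∃ K : ℝ, 0 < K ∧ ∀ x, ‖toEuclideanLin A x‖ ≤ K * ‖x‖ := by
  obtain ⟨K, hK, h⟩ := (LinearMap.toContinuousLinearMap (toEuclideanLin A)).bound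
  exact ⟨K, hK, h⟩

theorem isOpen_image_ball (hA : IsExpanding A) :
    IsOpen (toEuclideanLin A '' Metric.ball (0 : EuclideanSpace ℝ (Fin d)) 1) := by
  have : toEuclideanLin A '' Metric.ball (0 : EuclideanSpace ℝ (Fin d)) 1 =
      toEuclideanLin (A ^ (-1 : ℤ)) ⁻¹' Metric.ball 0 1 := by
    refine congrFun (Set.image_eq_preimage_of_inverse (fun x => ?_) (fun x => ?_)) _
    · simpa only [zpow_one] using toEuclideanLin_zpow_neg_self hA.isUnit_det 1 x
    · simpa only [neg_neg, zpow_one] using toEuclideanLin_zpow_neg_self hA.isUnit_det (-1) x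
  rw [this]
  exact Metric.isOpen_ball.preimage (continuous_toEuclideanLin _)

theorem measurableSet_annulusSet (hA : IsExpanding A) : MeasurableSet (annulusSet A) :=
  (isOpen_image_ball hA).measurableSet.diff Metric.isOpen_ball.measurableSet

theorem annulusSet_subset_ball (A : Matrix (Fin d) (Fin d) ℝ) :
    ∃ K : ℝ, 0 < K ∧ annulusSet A ⊆ Metric.ball 0 K := by
  obtain ⟨K, hK, h⟩ := exists_norm_toEuclideanLin_le A
  refine ⟨K, hK, ?_⟩
  rintro _ ⟨⟨x, hx, rfl⟩, -⟩
  rw [mem_ball_zero_iff] at hx ⊢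
  nlinarith [h x]

theorem one_le_norm_of_mem_annulusSet {x : EuclideanSpace ℝ (Fin d)} (hx : x ∈ annulusSet A) :
    1 ≤ ‖x‖ := by
  simpa using hx.2

theorem IsSmoothingKernel.hasCompactSupport (hφ : IsSmoothingKernel δ φ) :
    HasCompactSupport φ :=
  HasCompactSupport.of_support_subset_isCompact (isCompact_closedBall 0 δ)
    (hφ.support_subset.trans Metric.ball_subset_closedBall)

theorem continuous_smoothedIndicator (hA : IsExpanding A) (hφ : IsSmoothingKernel δ φ) :
    Continuous (smoothedIndicator A φ) := by
  obtain ⟨K, -, hK⟩ := annulusSet_subset_ball A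
  have hint : Integrable ((annulusSet A).indicator fun _ => (1 : ℝ)) volume := by
    rw [integrable_indicator_iff (measurableSet_annulusSet hA)]
    exact integrableOn_const (ne_top_of_le_ne_top measure_ball_lt_top.ne (measure_mono hK))
  have := hφ.hasCompactSupport.continuous_convolution_left (ContinuousLinearMap.mul ℝ ℝ)
    hφ.contDiff.continuous hint.locallyIntegrable
  convert this using 1
  ext x
  simp only [smoothedIndicator, convolution, ContinuousLinearMap.mul_apply', mul_comm]

theorem smoothedIndicator_nonneg (hφ : IsSmoothingKernel δ φ) (x : EuclideanSpace ℝ (Fin d)) :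
    0 ≤ smoothedIndicator A φ x :=
  integral_nonneg fun y => mul_nonneg (Set.indicator_nonneg (fun _ _ => zero_le_one) _)
    (hφ.nonneg y)

/-- The annulus avoids the unit ball and the kernel moves points by less than δ < 1/2, so the
smoothed indicator lives away from 0 and from infinity. -/
theorem exists_norm_bounds_of_smoothedIndicator_ne_zero (A : Matrix (Fin d) (Fin d) ℝ)
    (hδ : δ < 1 / 2) (hφ : IsSmoothingKernel δ φ) :
    ∃ R : ℝ, 0 < R ∧ ∀ x, smoothedIndicator A φ x ≠ 0 → 1 / 2 < ‖x‖ ∧ ‖x‖ < R := by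
  obtain ⟨K, hK0, hK⟩ := annulusSet_subset_ball A
  refine ⟨K + 1, by positivity, fun x hx => ?_⟩
  obtain ⟨y, hy⟩ : ∃ y, (annulusSet A).indicator (fun _ => (1 : ℝ)) (x - y) * φ y ≠ 0 := by
    by_contra! h
    exact hx (by simp [smoothedIndicator, h])
  have h1 : x - y ∈ annulusSet A := Set.mem_of_indicator_ne_zero (left_ne_zero_of_mul hy)
  have h2 : ‖y‖ < δ := by simpa using hφ.support_subset (right_ne_zero_of_mul hy)
  have h3 := one_le_norm_of_mem_annulusSet h1
  have h4 : ‖x - y‖ < K := by simpa using hK h1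
  have h5 := norm_sub_le x y
  have h6 : ‖x‖ ≤ ‖x - y‖ + ‖y‖ := by simpa using norm_add_le (x - y) y
  constructor <;> linarith

/-- The annulus is not open: v may lie on the unit sphere. Pushing v slightly outward along its ray
reaches the interior while the kernel is still positive, so the integrand is positive on a nonempty
open set. -/
theorem smoothedIndicator_pos (hA : IsExpanding A) (hφ : IsSmoothingKernel δ φ)
    {v : EuclideanSpace ℝ (Fin d)} (hv : v ∈ annulusSet A) : 0 < smoothedIndicator A φ v := by
  have hφc := hφ.contDiff.continuous
  have hφi : Integrable φ volume := hφc.integrable_of_hasCompactSupport hφ.hasCompactSupport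
  have hmeas : MeasurableSet {y | v - y ∈ annulusSet A} :=
    (measurableSet_annulusSet hA).preimage (measurable_const.sub measurable_id)
  have hfun : (fun y => (annulusSet A).indicator (fun _ => (1 : ℝ)) (v - y) * φ y) =
      {y | v - y ∈ annulusSet A}.indicator φ := by
    ext y
    by_cases h : v - y ∈ annulusSet A <;> simp [h]
  have hv1 := one_le_norm_of_mem_annulusSet hv
  unfold smoothedIndicator
  rw [hfun, integral_pos_iff_support_of_nonneg
    (fun y => Set.indicator_nonneg (fun y _ => hφ.nonneg y) y) (hφi.indicator hmeas)]
  set O : Set (EuclideanSpace ℝ (Fin d)) :=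
    {y | v - y ∈ toEuclideanLin A '' Metric.ball 0 1} ∩ {y | 1 < ‖v - y‖} ∩ {y | 0 < φ y}
  have hO : IsOpen O :=
    (((isOpen_image_ball hA).preimage (continuous_const.sub continuous_id)).inter
      (isOpen_lt continuous_const (continuous_const.sub continuous_id).norm)).inter
      (isOpen_lt continuous_const hφc)
  have hsub : O ⊆ Function.support ({y | v - y ∈ annulusSet A}.indicator φ) := by
    rintro y ⟨⟨hy1, hy2⟩, hy3⟩
    have : y ∈ {y | v - y ∈ annulusSet A} := ⟨hy1, by simpa using hy2.le⟩
    rw [Function.mem_support, Set.indicator_of_mem this]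
    exact hy3.ne'
  refine lt_of_lt_of_le (hO.measure_pos volume ?_) (measure_mono hsub)
  have hc : Continuous fun t : ℝ => -(t • v) := by fun_prop
  have h1 : ∀ᶠ t : ℝ in 𝓝 0, v - -(t • v) ∈ toEuclideanLin A '' Metric.ball 0 1 := by
    refine (continuous_const.sub hc).continuousAt.eventually_mem
      ((isOpen_image_ball hA).mem_nhds ?_)
    simpa using hv.1
  have h2 : ∀ᶠ t : ℝ in 𝓝 0, 0 < φ (-(t • v)) :=
    (hφc.comp hc).continuousAt.eventually_mem ((isOpen_Ioi (a := (0 : ℝ))).mem_nhds (by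
      simpa using hφ.pos_zero))
  have h3 := ((h1.and h2).filter_mono nhdsWithin_le_nhds : ∀ᶠ t in 𝓝[>] (0 : ℝ), _)
  obtain ⟨t, ⟨ht1, ht2⟩, ht0⟩ := (h3.and self_mem_nhdsWithin).exists
  refine ⟨-(t • v), ⟨ht1, ?_⟩, ht2⟩
  have ht0' : 0 < t := ht0
  have : v - -(t • v) = (1 + t) • v := by rw [sub_neg_eq_add, add_smul, one_smul]
  simp only [Set.mem_ofPred_eq, this, norm_smul, Real.norm_eq_abs]
  rw [abs_of_pos (by linarith)]
  nlinarith

theorem smoothedIndicator_zero (hδ : δ < 1 / 2) (hφ : IsSmoothingKernel δ φ) :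
    smoothedIndicator A φ 0 = 0 := by
  obtain ⟨R, -, h⟩ := exists_norm_bounds_of_smoothedIndicator_ne_zero A hδ hφ
  by_contra h0
  have := (h 0 h0).1
  simp at this
  linarith

theorem pseudoNorm_zero (hδ : δ < 1 / 2) (hφ : IsSmoothingKernel δ φ) :
    pseudoNorm A φ 0 = 0 := by
  simp [pseudoNorm, smoothedIndicator_zero hδ hφ]

theorem pseudoNorm_nonneg (hφ : IsSmoothingKernel δ φ) (x : EuclideanSpace ℝ (Fin d)) :
    0 ≤ pseudoNorm A φ x :=
  tsum_nonneg fun _ => mul_nonneg (Real.rpow_nonneg (abs_nonneg _) _)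
    (smoothedIndicator_nonneg hφ _)

/-- Applying `A ^ m` shifts the index of the defining series by m. -/
theorem pseudoNorm_zpow [NeZero d] (hA : IsExpanding A) (φ : EuclideanSpace ℝ (Fin d) → ℝ)
    (m : ℤ) (x : EuclideanSpace ℝ (Fin d)) :
    pseudoNorm A φ (toEuclideanLin (A ^ m) x) =
      |A.det| ^ ((m : ℝ) / (d : ℝ)) * pseudoNorm A φ x := by
  have hq : 0 < |A.det| := by linarith [hA.one_lt_abs_det]
  unfold pseudoNorm
  rw [← tsum_mul_left, ← (Equiv.addRight m).tsum_eq (fun n : ℤ => |A.det| ^ ((m : ℝ) / (d : ℝ)) *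
    (|A.det| ^ (-(n : ℝ) / (d : ℝ)) * smoothedIndicator A φ (toEuclideanLin (A ^ n) x)))]
  refine tsum_congr fun n => ?_
  simp only [Equiv.coe_addRight]
  rw [toEuclideanLin_zpow_add hA.isUnit_det, ← mul_assoc, ← Real.rpow_add hq]
  congr 2
  push_cast
  ring

theorem exists_contraction [NeZero d] (hA : IsExpanding A) :
    ∃ r C : ℝ, 1 < r ∧ 0 < C ∧ ∀ (n : ℕ) (x : EuclideanSpace ℝ (Fin d)),
      ‖toEuclideanLin (A ^ (-(n : ℤ))) x‖ ≤ C * r⁻¹ ^ n * ‖x‖ := by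
  obtain ⟨r, hr1, hr⟩ := exists_between (one_lt_minModulus hA)
  obtain ⟨C, hC, h⟩ := exists_norm_inv_pow_le hA (by linarith) hr
  refine ⟨r, C, hr1, hC, fun n x => ?_⟩
  rw [Matrix.zpow_neg hA.isUnit_det, zpow_natCast, ← Matrix.inv_pow']
  exact h n x

theorem exists_forall_contraction_lt [NeZero d] (hA : IsExpanding A) {ε : ℝ} (hε : 0 < ε)
    (R : ℝ) : ∃ N : ℕ, ∀ n : ℕ, N ≤ n → ∀ x : EuclideanSpace ℝ (Fin d), ‖x‖ ≤ R →
      ‖toEuclideanLin (A ^ (-(n : ℤ))) x‖ < ε := by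
  obtain ⟨r, C, hr, hC, h⟩ := exists_contraction hA
  have hlim : Tendsto (fun n : ℕ => C * r⁻¹ ^ n * R) atTop (𝓝 0) := by
    simpa using ((tendsto_pow_atTop_nhds_zero_of_lt_one (inv_nonneg.2 (by linarith))
      (inv_lt_one_of_one_lt₀ hr)).const_mul C).mul_const R
  obtain ⟨N, hN⟩ := eventually_atTop.1 (hlim.eventually (gt_mem_nhds hε))
  refine ⟨N, fun n hn x hx => (h n x).trans_lt (lt_of_le_of_lt ?_ (hN n hn))⟩
  have : 0 ≤ C * r⁻¹ ^ n := by positivity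
  exact mul_le_mul_of_nonneg_left hx this

/-- Very negative n contract x below norm 1/2. For very positive n, a nonzero value would put A^n x
in a fixed ball, and contracting back would make ‖x‖ < ρ. So the series is a finite sum, uniformly
on closed annuli. -/
theorem exists_smoothedIndicator_zpow_eq_zero [NeZero d] (hA : IsExpanding A) (hδ : δ < 1 / 2)
    (hφ : IsSmoothingKernel δ φ) {ρ : ℝ} (hρ : 0 < ρ) (R : ℝ) :
    ∃ N : ℕ, ∀ x : EuclideanSpace ℝ (Fin d), ρ ≤ ‖x‖ → ‖x‖ ≤ R → ∀ n : ℤ,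
      n ∉ Finset.Icc (-(N : ℤ)) N → smoothedIndicator A φ (toEuclideanLin (A ^ n) x) = 0 := by
  obtain ⟨R', -, hR'⟩ := exists_norm_bounds_of_smoothedIndicator_ne_zero A hδ hφ
  obtain ⟨N₁, h₁⟩ := exists_forall_contraction_lt hA (by norm_num : (0 : ℝ) < 1 / 2) R
  obtain ⟨N₂, h₂⟩ := exists_forall_contraction_lt hA hρ R'
  refine ⟨max N₁ N₂, fun x hx hxR n hn => ?_⟩
  by_contra hne
  obtain ⟨hb1, hb2⟩ := hR' _ hne
  rw [Finset.mem_Icc, not_and_or, not_le, not_le] at hn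
  rcases hn with hn | hn
  · have := h₁ n.natAbs (by omega) x hxR
    rw [show -(n.natAbs : ℤ) = n by omega] at this
    linarith
  · have := h₂ n.natAbs (by omega) _ hb2.le
    rw [show (n.natAbs : ℤ) = n by omega, toEuclideanLin_zpow_neg_self hA.isUnit_det] at this
    linarith

theorem continuousOn_pseudoNorm [NeZero d] (hA : IsExpanding A) (hδ : δ < 1 / 2)
    (hφ : IsSmoothingKernel δ φ) {ρ : ℝ} (hρ : 0 < ρ) (R : ℝ) :
    ContinuousOn (pseudoNorm A φ) {x | ρ ≤ ‖x‖ ∧ ‖x‖ ≤ R} := by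
  obtain ⟨N, hN⟩ := exists_smoothedIndicator_zpow_eq_zero hA hδ hφ hρ R
  have hc : Continuous fun x => ∑ n ∈ Finset.Icc (-(N : ℤ)) N, |A.det| ^ (-(n : ℝ) / (d : ℝ)) *
      smoothedIndicator A φ (toEuclideanLin (A ^ n) x) :=
    continuous_finsetSum _ fun n _ => continuous_const.mul
      ((continuous_smoothedIndicator hA hφ).comp (continuous_toEuclideanLin _))
  refine hc.continuousOn.congr fun x hx => ?_
  exact tsum_eq_sum fun n hn => by rw [hN x hx.1 hx.2 n hn, mul_zero]

theorem exists_zpow_mem_annulusSet [NeZero d] (hA : IsExpanding A)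
    {x : EuclideanSpace ℝ (Fin d)} (hx : x ≠ 0) :
    ∃ n : ℤ, toEuclideanLin (A ^ n) x ∈ annulusSet A := by
  obtain ⟨N₁, h₁⟩ := exists_forall_contraction_lt hA one_pos ‖x‖
  have hx0 : 0 < ‖x‖ := norm_pos_iff.2 hx
  obtain ⟨N₂, h₂⟩ := exists_forall_contraction_lt hA hx0 1
  have hup : ∃ k : ℕ, 1 ≤ ‖toEuclideanLin (A ^ (-(N₁ : ℤ) + k)) x‖ := by
    refine ⟨N₁ + N₂, ?_⟩
    by_contra! hlt
    have := h₂ N₂ le_rfl _ hlt.le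
    rw [show -(N₁ : ℤ) + (N₁ + N₂ : ℕ) = N₂ by push_cast; ring,
      toEuclideanLin_zpow_neg_self hA.isUnit_det] at this
    exact lt_irrefl _ this
  -- The first exponent at which the orbit leaves the open unit ball: its predecessor is still
  -- inside, so the point lies in A(B(0,1)) \ B(0,1).
  classical
  have hspec := Nat.find_spec hup
  have hmin := fun m => Nat.find_min hup (m := m)
  set k := Nat.find hup
  have hk : k ≠ 0 := by
    intro hk
    rw [hk] at hspec
    have := h₁ N₁ le_rfl x le_rfl
    simp only [Nat.cast_zero, add_zero] at hspec
    linarith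
  refine ⟨-(N₁ : ℤ) + k, ⟨toEuclideanLin (A ^ (-(N₁ : ℤ) + (k - 1 : ℕ))) x, ?_, ?_⟩, by simpa using hspec⟩
  · simpa using hmin (k - 1) (by omega)
  · have := toEuclideanLin_zpow_add hA.isUnit_det 1 (-(N₁ : ℤ) + (k - 1 : ℕ)) x
    rw [zpow_one] at this
    rw [← this]
    congr 3
    omega

/-- Every nonzero vector lies in a translate of the fundamental annulus, on which the pseudo-norm
is bounded from above and below. -/
theorem exists_annulus_decomposition [NeZero d] (hA : IsExpanding A) (hδ : δ < 1 / 2)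
    (hφ : IsSmoothingKernel δ φ) :
    ∃ m M R : ℝ, 0 < m ∧ 0 < M ∧ 0 < R ∧ ∀ x : EuclideanSpace ℝ (Fin d), x ≠ 0 →
      ∃ (n : ℤ) (v : EuclideanSpace ℝ (Fin d)), x = toEuclideanLin (A ^ n) v ∧ 1 ≤ ‖v‖ ∧
        ‖v‖ ≤ R ∧ m * |A.det| ^ ((n : ℝ) / (d : ℝ)) ≤ pseudoNorm A φ x ∧
        pseudoNorm A φ x ≤ M * |A.det| ^ ((n : ℝ) / (d : ℝ)) := by
  have hq : 0 < |A.det| := by linarith [hA.one_lt_abs_det]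
  obtain ⟨R, hR0, hR⟩ := annulusSet_subset_ball A
  set K : Set (EuclideanSpace ℝ (Fin d)) := {x | 1 ≤ ‖x‖ ∧ ‖x‖ ≤ R}
  have hcont : ContinuousOn (pseudoNorm A φ) K := continuousOn_pseudoNorm hA hδ hφ one_pos R
  have hKc : IsCompact K := by
    refine (isCompact_closedBall (0 : EuclideanSpace ℝ (Fin d)) R).of_isClosed_subset
      ((isClosed_le continuous_const continuous_norm).inter
        (isClosed_le continuous_norm continuous_const)) fun x hx => ?_
    simpa using hx.2
  have hsub : annulusSet A ⊆ K := fun x hx =>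
    ⟨one_le_norm_of_mem_annulusSet hx, (mem_ball_zero_iff.1 (hR hx)).le⟩
  have hpos : ∀ x ∈ K, 0 < pseudoNorm A φ x := by
    intro x hx
    have hx0 : x ≠ 0 := by
      rintro rfl
      have := hx.1
      simp at this
      linarith
    obtain ⟨n, hn⟩ := exists_zpow_mem_annulusSet hA hx0
    obtain ⟨N, hN⟩ := exists_smoothedIndicator_zpow_eq_zero hA hδ hφ one_pos R
    have hsum : Summable fun n : ℤ => |A.det| ^ (-(n : ℝ) / (d : ℝ)) *
        smoothedIndicator A φ (toEuclideanLin (A ^ n) x) :=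
      summable_of_ne_finset_zero (s := Finset.Icc (-(N : ℤ)) N)
        fun n hn => by rw [hN x hx.1 hx.2 n hn, mul_zero]
    exact hsum.tsum_pos (fun _ => mul_nonneg (Real.rpow_nonneg hq.le _)
      (smoothedIndicator_nonneg hφ _)) n
      (mul_pos (Real.rpow_pos_of_pos hq _) (smoothedIndicator_pos hA hφ hn))
  obtain ⟨m, hm0, hm⟩ : ∃ m : ℝ, 0 < m ∧ ∀ x ∈ K, m ≤ pseudoNorm A φ x := by
    rcases K.eq_empty_or_nonempty with h | h
    · exact ⟨1, one_pos, by simp [h]⟩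
    · obtain ⟨x, hx, hmin⟩ := hKc.exists_isMinOn h hcont
      exact ⟨_, hpos x hx, fun y hy => hmin hy⟩
  obtain ⟨M, hM⟩ := hKc.bddAbove_image hcont
  refine ⟨m, max M 1, R, hm0, by positivity, hR0, fun x hx => ?_⟩
  obtain ⟨n, hn⟩ := exists_zpow_mem_annulusSet hA hx
  have hx' : x = toEuclideanLin (A ^ (-n)) (toEuclideanLin (A ^ n) x) :=
    (toEuclideanLin_zpow_neg_self hA.isUnit_det n x).symm
  refine ⟨-n, _, hx', (hsub hn).1, (hsub hn).2, ?_⟩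
  have hq' := Real.rpow_pos_of_pos hq (((-n : ℤ) : ℝ) / (d : ℝ))
  have h1 := hm _ (hsub hn)
  have h2 := (hM (Set.mem_image_of_mem _ (hsub hn))).trans (le_max_left M 1)
  have h3 := pseudoNorm_zpow hA φ (-n) (toEuclideanLin (A ^ n) x)
  rw [← hx'] at h3
  rw [h3]
  constructor <;> nlinarith

/-- Exchange rate between the scale q^(n/d) of the pseudo-norm and a geometric scale r^n. -/
theorem rpow_div_rpow_log [NeZero d] {q r : ℝ} (hq : 1 < q) (hr : 0 < r) (n : ℤ) :
    (q ^ ((n : ℝ) / (d : ℝ))) ^ ((d : ℝ) * Real.log r / Real.log q) = r ^ n := by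
  have hq0 : 0 < q := by linarith
  have hlq : Real.log q ≠ 0 := (Real.log_pos hq).ne'
  have hd : (d : ℝ) ≠ 0 := NeZero.ne _
  rw [← Real.rpow_mul hq0.le, ← Real.rpow_intCast, Real.rpow_def_of_pos hq0,
    Real.rpow_def_of_pos hr]
  congr 1
  field_simp

theorem exists_pseudoNorm_le [NeZero d] (hA : IsExpanding A) (hδ : δ < 1 / 2)
    (hφ : IsSmoothingKernel δ φ) (R : ℝ) :
    ∃ C : ℝ, 0 < C ∧ ∀ x : EuclideanSpace ℝ (Fin d), ‖x‖ ≤ R → pseudoNorm A φ x ≤ C := by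
  obtain ⟨m, M, R', hm, hM, hR', h⟩ := exists_annulus_decomposition hA hδ hφ
  have hq := hA.one_lt_abs_det
  obtain ⟨N, hN⟩ := exists_forall_contraction_lt hA one_pos R
  have hqN : 0 < |A.det| ^ ((N : ℝ) / (d : ℝ)) := Real.rpow_pos_of_pos (by linarith) _
  refine ⟨M * |A.det| ^ ((N : ℝ) / (d : ℝ)), by positivity, fun x hx => ?_⟩
  rcases eq_or_ne x 0 with rfl | hx0
  · rw [pseudoNorm_zero hδ hφ]; positivity
  obtain ⟨n, v, rfl, hv1, hvR, h1, h2⟩ := h x hx0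
  refine h2.trans (mul_le_mul_of_nonneg_left ?_ hM.le)
  refine Real.rpow_le_rpow_of_exponent_le hq.le ?_
  have hnN : n ≤ N := by
    by_contra! hlt
    have := hN n.natAbs (by omega) _ hx
    rw [show (n.natAbs : ℤ) = n by omega, toEuclideanLin_zpow_neg_self hA.isUnit_det] at this
    linarith
  have : (n : ℝ) ≤ N := by exact_mod_cast hnN
  gcongr

theorem exists_norm_lt_of_pseudoNorm_le [NeZero d] (hA : IsExpanding A) (hδ : δ < 1 / 2)
    (hφ : IsSmoothingKernel δ φ) {ρ : ℝ} (hρ : 0 < ρ) :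
    ∃ η : ℝ, 0 < η ∧ ∀ x : EuclideanSpace ℝ (Fin d), pseudoNorm A φ x ≤ η → ‖x‖ < ρ := by
  obtain ⟨m, M, R', hm, hM, hR', h⟩ := exists_annulus_decomposition hA hδ hφ
  have hq := hA.one_lt_abs_det
  obtain ⟨N, hN⟩ := exists_forall_contraction_lt hA hρ R'
  have hqN : 0 < |A.det| ^ ((-N : ℝ) / (d : ℝ)) := Real.rpow_pos_of_pos (by linarith) _
  refine ⟨m * |A.det| ^ ((-N : ℝ) / (d : ℝ)), by positivity, fun x hx => ?_⟩
  rcases eq_or_ne x 0 with rfl | hx0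
  · simpa using hρ
  obtain ⟨n, v, rfl, hv1, hvR, h1, h2⟩ := h x hx0
  have h3 := le_of_mul_le_mul_left (h1.trans hx) hm
  rw [Real.rpow_le_rpow_left_iff hq] at h3
  have hd : (0 : ℝ) < d := by exact_mod_cast NeZero.pos d
  have h4 : (n : ℝ) ≤ -N := by rwa [div_le_div_iff_of_pos_right hd] at h3
  have h5 : n ≤ -N := by exact_mod_cast h4
  have := hN n.natAbs (by omega) v hvR
  rwa [show -(n.natAbs : ℤ) = n by omega] at this

/-- By homogeneity a fixed power A^(-k) shrinks the pseudo-norm unit ball to one so small that it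
lies in the Euclidean unit ball; then A^k is applied, which is bounded. -/
theorem exists_norm_le_of_pseudoNorm_le_one [NeZero d] (hA : IsExpanding A) (hδ : δ < 1 / 2)
    (hφ : IsSmoothingKernel δ φ) :
    ∃ R : ℝ, 0 < R ∧ ∀ x : EuclideanSpace ℝ (Fin d), pseudoNorm A φ x ≤ 1 → ‖x‖ ≤ R := by
  obtain ⟨η, hη, h⟩ := exists_norm_lt_of_pseudoNorm_le hA hδ hφ one_pos
  have hq := hA.one_lt_abs_det
  have hd : (0 : ℝ) < d := by exact_mod_cast NeZero.pos d
  obtain ⟨k, hk⟩ : ∃ k : ℕ, |A.det| ^ (((-(k : ℤ) : ℤ) : ℝ) / (d : ℝ)) < η := by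
    have h1 : (|A.det| ^ (-1 / (d : ℝ))) < 1 :=
      Real.rpow_lt_one_of_one_lt_of_neg hq (div_neg_of_neg_of_pos (by norm_num) hd)
    obtain ⟨k, hk⟩ := exists_pow_lt_of_lt_one hη h1
    refine ⟨k, ?_⟩
    rw [← Real.rpow_natCast, ← Real.rpow_mul (by linarith)] at hk
    have e : -1 / (d : ℝ) * k = ((-(k : ℤ) : ℤ) : ℝ) / (d : ℝ) := by push_cast; ring
    rwa [e] at hk
  obtain ⟨K, hK, hKb⟩ := exists_norm_toEuclideanLin_le (A ^ (k : ℤ))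
  refine ⟨K, hK, fun x hx => ?_⟩
  have h1 : ‖toEuclideanLin (A ^ (-(k : ℤ))) x‖ < 1 := by
    refine h _ ?_
    rw [pseudoNorm_zpow hA]
    have := Real.rpow_pos_of_pos (by linarith : 0 < |A.det|) (((-(k : ℤ) : ℤ) : ℝ) / (d : ℝ))
    nlinarith [pseudoNorm_nonneg (A := A) hφ x]
  have h2 := hKb (toEuclideanLin (A ^ (-(k : ℤ))) x)
  rw [← toEuclideanLin_zpow_add hA.isUnit_det] at h2
  simp only [add_neg_cancel, zpow_zero, toEuclideanLin_one_apply] at h2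
  nlinarith

theorem norm_le_pseudoNorm_rpow_of_one_le [NeZero d] (hA : IsExpanding A) (hδ : δ < 1 / 2)
    (hφ : IsSmoothingKernel δ φ) {r : ℝ} (hr : maxModulus A < r) :
    ∃ C : ℝ, 0 < C ∧ ∀ x : EuclideanSpace ℝ (Fin d), 1 ≤ ‖x‖ →
      ‖x‖ ≤ C * pseudoNorm A φ x ^ ((d : ℝ) * Real.log r / Real.log |A.det|) := by
  obtain ⟨m, M, R, hm, hM, hR, h⟩ := exists_annulus_decomposition hA hδ hφ
  have hq := hA.one_lt_abs_det
  have hq0 : 0 < |A.det| := by linarith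
  have hd : (0 : ℝ) < d := by exact_mod_cast NeZero.pos d
  have hr1 : 1 < r := (one_lt_minModulus hA).trans_le ((minModulus_le_maxModulus A).trans hr.le)
  have hr0 : 0 < r := by linarith
  set s := (d : ℝ) * Real.log r / Real.log |A.det| with hs
  have hs0 : 0 < s := div_pos (mul_pos hd (Real.log_pos hr1)) (Real.log_pos hq)
  obtain ⟨C, hC, hpow⟩ := exists_norm_pow_le A hr0 fun ρ hρ => (le_maxModulus hρ).trans_lt hr
  obtain ⟨N, hN⟩ := exists_forall_contraction_lt hA one_pos R
  have hms : 0 < m ^ s := Real.rpow_pos_of_pos hm s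
  have hgr : ∀ x : EuclideanSpace ℝ (Fin d), ∀ n : ℤ, m * |A.det| ^ ((n : ℝ) / (d : ℝ)) ≤
      pseudoNorm A φ x → r ^ n ≤ (m ^ s)⁻¹ * pseudoNorm A φ x ^ s := by
    intro x n hx
    have h1 := Real.rpow_le_rpow (by positivity) hx hs0.le
    rw [Real.mul_rpow hm.le (Real.rpow_nonneg hq0.le _), hs, rpow_div_rpow_log hq hr0, ← hs] at h1
    rwa [le_inv_mul_iff₀ hms]
  refine ⟨C * r ^ N * (m ^ s)⁻¹, by positivity, fun x hx => ?_⟩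
  have hx0 : x ≠ 0 := by
    rintro rfl
    simp at hx
    linarith
  obtain ⟨n, v, rfl, hv1, hvR, h1, h2⟩ := h x hx0
  -- Since ‖x‖ ≥ 1, n is bounded below. Factoring A^n = A^(n+N) A^(-N) leaves a nonnegative power,
  -- to which the growth bound applies.
  have hnN : -(N : ℤ) < n := by
    by_contra! hlt
    have := hN n.natAbs (by omega) v hvR
    rw [show -(n.natAbs : ℤ) = n by omega] at this
    linarith
  obtain ⟨k, hk⟩ : ∃ k : ℕ, n + N = k := ⟨(n + N).toNat, by omega⟩
  have hw := hpow k (toEuclideanLin (A ^ (-(N : ℤ))) v)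
  rw [← zpow_natCast A k, ← toEuclideanLin_zpow_add hA.isUnit_det,
    show (k : ℤ) + -(N : ℤ) = n by omega] at hw
  have hv' : ‖toEuclideanLin (A ^ (-(N : ℤ))) v‖ ≤ 1 := (hN N le_rfl v hvR).le
  have h3 := hgr _ n h1
  have hrk : r ^ k = r ^ n * r ^ N := by
    rw [← zpow_natCast r k, ← hk, zpow_add₀ hr0.ne', zpow_natCast]
  calc _ ≤ C * r ^ k * 1 := hw.trans (mul_le_mul_of_nonneg_left hv' (by positivity))
    _ = C * r ^ N * r ^ n := by rw [hrk]; ring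
    _ ≤ C * r ^ N * ((m ^ s)⁻¹ * pseudoNorm A φ (toEuclideanLin (A ^ n) v) ^ s) :=
      mul_le_mul_of_nonneg_left h3 (by positivity)
    _ = _ := by ring

theorem norm_le_pseudoNorm_rpow_of_le_one [NeZero d] (hA : IsExpanding A) (hδ : δ < 1 / 2)
    (hφ : IsSmoothingKernel δ φ) {r : ℝ} (hr1 : 1 < r) (hr : r < minModulus A) :
    ∃ C : ℝ, 0 < C ∧ ∀ x : EuclideanSpace ℝ (Fin d), ‖x‖ ≤ 1 →
      ‖x‖ ≤ C * pseudoNorm A φ x ^ ((d : ℝ) * Real.log r / Real.log |A.det|) := by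
  obtain ⟨m, M, R, hm, hM, hR, h⟩ := exists_annulus_decomposition hA hδ hφ
  have hq := hA.one_lt_abs_det
  have hq0 : 0 < |A.det| := by linarith
  have hd : (0 : ℝ) < d := by exact_mod_cast NeZero.pos d
  have hr0 : 0 < r := by linarith
  set s := (d : ℝ) * Real.log r / Real.log |A.det| with hs
  have hs0 : 0 < s := div_pos (mul_pos hd (Real.log_pos hr1)) (Real.log_pos hq)
  obtain ⟨C, hC, hpow⟩ := exists_norm_inv_pow_le hA hr0 hr
  have hms : 0 < m ^ s := Real.rpow_pos_of_pos hm s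
  refine ⟨(1 + C * R) * (m ^ s)⁻¹, by positivity, fun x hx => ?_⟩
  rcases eq_or_ne x 0 with rfl | hx0
  · rw [norm_zero]
    have := Real.rpow_nonneg (pseudoNorm_nonneg (A := A) hφ 0) s
    positivity
  obtain ⟨n, v, hxv, hv1, hvR, h1, h2⟩ := h x hx0
  have h3 : r ^ n ≤ (m ^ s)⁻¹ * pseudoNorm A φ x ^ s := by
    have h1 := Real.rpow_le_rpow (by positivity) h1 hs0.le
    rw [Real.mul_rpow hm.le (Real.rpow_nonneg hq0.le _), hs, rpow_div_rpow_log hq hr0, ← hs] at h1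
    rwa [le_inv_mul_iff₀ hms]
  rw [mul_assoc]
  -- For n ≥ 0 the summand 1 suffices, as ‖x‖ ≤ 1 ≤ r^n; for n ≤ 0 the summand C * R comes from the
  -- decay of powers of A⁻¹.
  have h4 : ‖x‖ ≤ (1 + C * R) * r ^ n := by
    rcases le_total 0 n with hn | hn
    · have := one_le_zpow₀ hr1.le hn
      nlinarith [mul_pos hC hR]
    · have h5 := hpow n.natAbs v
      have h6 : A⁻¹ ^ n.natAbs = A ^ n := by
        conv_rhs => rw [show n = -(n.natAbs : ℤ) by omega]
        rw [Matrix.zpow_neg hA.isUnit_det, zpow_natCast, ← Matrix.inv_pow']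
      have h7 : r⁻¹ ^ n.natAbs = r ^ n := by
        conv_rhs => rw [show n = -(n.natAbs : ℤ) by omega]
        rw [_root_.zpow_neg, zpow_natCast, inv_pow]
      rw [h6, h7, ← hxv] at h5
      have h8 : 0 < r ^ n := zpow_pos hr0 n
      nlinarith [mul_le_mul_of_nonneg_left hvR (mul_pos hC h8).le]
  exact h4.trans (mul_le_mul_of_nonneg_left h3 (by positivity))

end PseudoNorm

/-! ### Hausdorff measure for the pseudo-norm as an outer measure -/

section OmegaHausdorff

open Matrix Filter Topology

variable {d : ℕ} {A : Matrix (Fin d) (Fin d) ℝ} {δ : ℝ} {φ : EuclideanSpace ℝ (Fin d) → ℝ}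

theorem ofReal_pseudoNorm_le_omegaDiam {S : Set (EuclideanSpace ℝ (Fin d))}
    {x y : EuclideanSpace ℝ (Fin d)} (hx : x ∈ S) (hy : y ∈ S) :
    ENNReal.ofReal (pseudoNorm A φ (x - y)) ≤ omegaDiam A φ S :=
  le_iSup₂_of_le x hx (le_iSup₂_of_le y hy le_rfl)

theorem omegaDiam_le_iff {S : Set (EuclideanSpace ℝ (Fin d))} {c : ℝ≥0∞} :
    omegaDiam A φ S ≤ c ↔
      ∀ x ∈ S, ∀ y ∈ S, ENNReal.ofReal (pseudoNorm A φ (x - y)) ≤ c := by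
  simp only [omegaDiam, iSup_le_iff]

theorem omegaDiam_empty : omegaDiam A φ ∅ = 0 := by simp [omegaDiam]

/-- The outer measure `H^s_{ω,δ}`. -/
def omegaOuterPre (A : Matrix (Fin d) (Fin d) ℝ) (φ : EuclideanSpace ℝ (Fin d) → ℝ) (s δ : ℝ) :
    OuterMeasure (EuclideanSpace ℝ (Fin d)) :=
  OuterMeasure.boundedBy fun U => ⨅ (_ : omegaDiam A φ U ≤ ENNReal.ofReal δ), omegaDiam A φ U ^ s

/-- The outer measure `H^s_ω`. -/
def omegaOuter (A : Matrix (Fin d) (Fin d) ℝ) (φ : EuclideanSpace ℝ (Fin d) → ℝ) (s : ℝ) :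
    OuterMeasure (EuclideanSpace ℝ (Fin d)) :=
  ⨆ (δ : ℝ) (_ : 0 < δ), omegaOuterPre A φ s δ

/-- Giving sets of diameter above δ the value ∞ amounts to forbidding them in covers. `boundedBy`
makes empty sets cost 0, which matters for s = 0. -/
theorem omegaOuterPre_apply (s δ : ℝ) (S : Set (EuclideanSpace ℝ (Fin d))) :
    omegaOuterPre A φ s δ S = omegaHausdorffPre A φ s δ S := by
  rw [omegaOuterPre, OuterMeasure.boundedBy_apply, omegaHausdorffPre]
  refine iInf_congr fun U => iInf_congr fun hU => ?_
  by_cases h : ∀ n, omegaDiam A φ (U n) ≤ ENNReal.ofReal δ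
  · simp [h]
  · rw [iInf_neg h, eq_top_iff]
    push Not at h
    obtain ⟨n, hn⟩ := h
    have hne : (U n).Nonempty := by
      by_contra h0
      rw [Set.not_nonempty_iff_eq_empty] at h0
      rw [h0, omegaDiam_empty] at hn
      exact not_lt_bot hn
    refine le_trans ?_ (ENNReal.le_tsum n)
    rw [iSup_pos hne, iInf_neg (not_le.2 hn)]

theorem omegaOuter_apply (s : ℝ) (S : Set (EuclideanSpace ℝ (Fin d))) :
    omegaOuter A φ s S = omegaHausdorff A φ s S := by
  simp only [omegaOuter, omegaHausdorff, OuterMeasure.iSup_apply, omegaOuterPre_apply]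

theorem omegaHausdorff_mono (s : ℝ) {S T : Set (EuclideanSpace ℝ (Fin d))} (h : S ⊆ T) :
    omegaHausdorff A φ s S ≤ omegaHausdorff A φ s T := by
  rw [← omegaOuter_apply, ← omegaOuter_apply]
  exact measure_mono h

theorem omegaHausdorff_union_le (s : ℝ) (S T : Set (EuclideanSpace ℝ (Fin d))) :
    omegaHausdorff A φ s (S ∪ T) ≤ omegaHausdorff A φ s S + omegaHausdorff A φ s T := by
  simp only [← omegaOuter_apply]
  exact measure_union_le _ _

theorem omegaOuterPre_anti (s : ℝ) {δ δ' : ℝ} (h : δ ≤ δ') :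
    omegaOuterPre A φ s δ' ≤ omegaOuterPre A φ s δ := by
  refine OuterMeasure.le_boundedBy.2 fun U => le_iInf fun hU => ?_
  refine (OuterMeasure.boundedBy_le U).trans (iInf_le _ (hU.trans (ENNReal.ofReal_le_ofReal h)))

theorem omegaOuterPre_le_omegaHausdorff (s : ℝ) {δ : ℝ} (hδ : 0 < δ)
    (S : Set (EuclideanSpace ℝ (Fin d))) : omegaOuterPre A φ s δ S ≤ omegaHausdorff A φ s S := by
  rw [omegaOuterPre_apply]
  exact le_iSup₂_of_le δ hδ le_rfl

theorem omegaHausdorff_le_iff (s : ℝ) {η : ℝ} (hη : 0 < η) {S : Set (EuclideanSpace ℝ (Fin d))}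
    {c : ℝ≥0∞} : omegaHausdorff A φ s S ≤ c ↔
      ∀ δ, 0 < δ → δ ≤ η → omegaOuterPre A φ s δ S ≤ c := by
  constructor
  · exact fun h δ hδ _ => (omegaOuterPre_le_omegaHausdorff s hδ S).trans h
  · refine fun h => iSup₂_le fun δ hδ => ?_
    rw [← omegaOuterPre_apply]
    exact (omegaOuterPre_anti s (min_le_left δ η) S).trans
      (h _ (lt_min hδ hη) (min_le_right δ η))

theorem omegaHausdorff_eq_iSup_nat (s : ℝ) {η : ℝ} (hη : 0 < η)
    (S : Set (EuclideanSpace ℝ (Fin d))) :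
    omegaHausdorff A φ s S = ⨆ n : ℕ, omegaOuterPre A φ s (η / ((n : ℝ) + 1)) S := by
  refine le_antisymm ((omegaHausdorff_le_iff s hη).2 fun δ hδ _ => ?_)
    (iSup_le fun n => omegaOuterPre_le_omegaHausdorff s (by positivity) S)
  obtain ⟨n, hn⟩ := exists_nat_gt (η / δ)
  refine le_trans (omegaOuterPre_anti s ?_ S) (le_iSup (fun n : ℕ => omegaOuterPre A φ s (η / ((n : ℝ) + 1)) S) n)
  rw [div_lt_iff₀ hδ] at hn
  rw [div_le_iff₀ (by positivity)]
  nlinarith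

/-- A set of small pseudo-norm diameter has small Euclidean diameter, so it cannot meet two sets at
positive Euclidean distance. The small-scale outer measures are therefore additive on such pairs,
and Carathéodory's criterion makes Borel sets measurable. -/
theorem omegaOuter_isMetric [NeZero d] (hA : IsExpanding A) (hδ : δ < 1 / 2)
    (hφ : IsSmoothingKernel δ φ) (s : ℝ) : (omegaOuter A φ s).IsMetric := by
  rintro S T ⟨r, r0, hr⟩
  refine le_antisymm (measure_union_le _ _) ?_
  obtain ⟨ρ, hρ0, hρ⟩ : ∃ ρ : ℝ, 0 < ρ ∧ ENNReal.ofReal ρ ≤ r := by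
    refine ⟨(min r 1).toReal, ENNReal.toReal_pos (by simpa using r0) (by simp), ?_⟩
    rw [ENNReal.ofReal_toReal (by simp)]
    exact min_le_left _ _
  obtain ⟨η, hη, hω⟩ := exists_norm_lt_of_pseudoNorm_le hA hδ hφ hρ0
  have hadd : ∀ t, 0 < t → t ≤ η → omegaOuterPre A φ s t S + omegaOuterPre A φ s t T ≤
      omegaHausdorff A φ s (S ∪ T) := by
    intro t ht htη
    refine le_trans (le_of_eq ?_) (omegaOuterPre_le_omegaHausdorff s ht (S ∪ T))
    refine (OuterMeasure.boundedBy_union_of_top_of_nonempty_inter ?_).symm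
    rintro U ⟨x, hxS, hxU⟩ ⟨y, hyT, hyU⟩
    refine iInf_neg fun hU => ?_
    have h1 := (ofReal_pseudoNorm_le_omegaDiam hxU hyU).trans hU
    rw [ENNReal.ofReal_le_ofReal_iff ht.le] at h1
    have h2 := hω _ (h1.trans htη)
    have h3 := hρ.trans (hr x hxS y hyT)
    rw [edist_dist, dist_eq_norm, ENNReal.ofReal_le_ofReal_iff (norm_nonneg _)] at h3
    linarith
  simp only [omegaOuter_apply]
  rw [omegaHausdorff_eq_iSup_nat s hη S, omegaHausdorff_eq_iSup_nat s hη T,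
    ENNReal.iSup_add_iSup_of_monotone]
  · exact iSup_le fun n => hadd _ (by positivity) (div_le_self hη.le (by linarith [n.cast_nonneg (α := ℝ)]))
  all_goals
    intro m n hmn
    have : (m : ℝ) ≤ n := by exact_mod_cast hmn
    exact omegaOuterPre_anti s (by gcongr) _

/-- Covers are transported by g; c ≤ 1 keeps the image of an admissible set admissible at the same
scale. -/
theorem omegaHausdorff_image_le {g : EuclideanSpace ℝ (Fin d) → EuclideanSpace ℝ (Fin d)}
    {c s : ℝ} (hc0 : 0 < c) (hc1 : c ≤ 1) (hs : 0 ≤ s)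
    (hg : ∀ x y, pseudoNorm A φ (g x - g y) = c * pseudoNorm A φ (x - y))
    (S : Set (EuclideanSpace ℝ (Fin d))) :
    omegaHausdorff A φ s (g '' S) ≤ ENNReal.ofReal (c ^ s) * omegaHausdorff A φ s S := by
  have hdiam : ∀ U, omegaDiam A φ (g '' U) ≤ ENNReal.ofReal c * omegaDiam A φ U := by
    intro U
    rw [omegaDiam_le_iff]
    rintro _ ⟨x, hx, rfl⟩ _ ⟨y, hy, rfl⟩
    rw [hg, ENNReal.ofReal_mul hc0.le]
    exact mul_le_mul_right (ofReal_pseudoNorm_le_omegaDiam hx hy) _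
  refine iSup₂_le fun t ht => ?_
  rw [← omegaOuterPre_apply]
  refine le_trans ?_ (mul_le_mul_right (omegaOuterPre_le_omegaHausdorff s ht S) _)
  have hcs : 0 < c ^ s := Real.rpow_pos_of_pos hc0 s
  have hne : ENNReal.ofReal (c ^ s) ≠ 0 := by simpa using hcs
  have : (ENNReal.ofReal (c ^ s))⁻¹ • OuterMeasure.comap g (omegaOuterPre A φ s t) ≤
      omegaOuterPre A φ s t := by
    refine OuterMeasure.le_boundedBy.2 fun U => le_iInf fun hU => ?_
    simp only [_root_.smul_apply, OuterMeasure.comap_apply, smul_eq_mul]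
    rw [ENNReal.inv_mul_le_iff hne ENNReal.ofReal_ne_top]
    refine (OuterMeasure.boundedBy_le _).trans ((iInf_le _ ?_).trans ?_)
    · refine (hdiam U).trans (le_trans (mul_le_of_le_one_left' ?_) hU)
      simpa using hc1
    · rw [← ENNReal.ofReal_rpow_of_pos hc0, ← ENNReal.mul_rpow_of_nonneg _ _ hs]
      exact ENNReal.rpow_le_rpow (hdiam U) hs
  have h2 := this S
  simp only [_root_.smul_apply, OuterMeasure.comap_apply, smul_eq_mul] at h2
  rwa [ENNReal.inv_mul_le_iff hne ENNReal.ofReal_ne_top] at h2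

theorem omegaHausdorff_le_of_covers {ι : Type*} {s : ℝ} {S : Set (EuclideanSpace ℝ (Fin d))}
    {B : ℝ≥0∞} (h : ∀ η : ℝ, 0 < η → ∃ (W : Finset ι) (F : ι → Set (EuclideanSpace ℝ (Fin d))),
      S ⊆ ⋃ w ∈ W, F w ∧ (∀ w ∈ W, omegaDiam A φ (F w) ≤ ENNReal.ofReal η) ∧
      ∑ w ∈ W, omegaDiam A φ (F w) ^ s ≤ B) : omegaHausdorff A φ s S ≤ B := by
  refine iSup₂_le fun t ht => ?_
  rw [← omegaOuterPre_apply]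
  obtain ⟨W, F, hS, hd, hsum⟩ := h t ht
  calc omegaOuterPre A φ s t S ≤ omegaOuterPre A φ s t (⋃ w ∈ W, F w) := measure_mono hS
    _ ≤ ∑ w ∈ W, omegaOuterPre A φ s t (F w) := measure_biUnion_finset_le _ _
    _ ≤ ∑ w ∈ W, omegaDiam A φ (F w) ^ s := Finset.sum_le_sum fun w hw =>
      (OuterMeasure.boundedBy_le _).trans (iInf_le _ (hd w hw))
    _ ≤ B := hsum

theorem le_omegaHausdorff_of_forall {s η : ℝ} (hη : 0 < η)
    (ν : OuterMeasure (EuclideanSpace ℝ (Fin d)))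
    (h : ∀ U, U.Nonempty → omegaDiam A φ U ≤ ENNReal.ofReal η → ν U ≤ omegaDiam A φ U ^ s)
    (S : Set (EuclideanSpace ℝ (Fin d))) : ν S ≤ omegaHausdorff A φ s S := by
  refine le_trans ?_ (omegaOuterPre_le_omegaHausdorff s hη S)
  exact OuterMeasure.le_boundedBy'.2 (fun U hU => le_iInf fun hd => h U hU hd) S

theorem omegaHausdorff_anti_exponent {s t : ℝ} (hst : s ≤ t)
    (S : Set (EuclideanSpace ℝ (Fin d))) :
    omegaHausdorff A φ t S ≤ omegaHausdorff A φ s S := by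
  rw [omegaHausdorff_le_iff t one_pos]
  intro δ hδ hδ1
  refine le_trans ?_ (omegaOuterPre_le_omegaHausdorff s hδ S)
  refine OuterMeasure.le_boundedBy.2 (fun U => le_iInf fun hU => ?_) S
  refine (OuterMeasure.boundedBy_le U).trans ((iInf_le _ hU).trans ?_)
  refine ENNReal.rpow_le_rpow_of_exponent_ge (hU.trans ?_) hst
  simpa using hδ1

/-- On Borel sets `H^s_ω` is given by a measure. -/
theorem exists_omegaMeasure [NeZero d] (hA : IsExpanding A) (hδ : δ < 1 / 2)
    (hφ : IsSmoothingKernel δ φ) (s : ℝ) :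
    ∃ μ : Measure (EuclideanSpace ℝ (Fin d)),
      ∀ S, MeasurableSet S → μ S = omegaHausdorff A φ s S :=
  ⟨(omegaOuter A φ s).toMeasure (omegaOuter_isMetric hA hδ hφ s).le_caratheodory,
    fun S hS => by rw [toMeasure_apply _ _ hS, omegaOuter_apply]⟩

end OmegaHausdorff

namespace SingleMatrixGIFS

open Matrix

variable {d : ℕ} {V Γ : Type*} {G : SingleMatrixGIFS d V Γ}
  {E : V → Set (EuclideanSpace ℝ (Fin d))}

/-! ### Walks and their cylinder sets -/

section Walks

/-- All edge maps share the linear part A⁻¹, so the linear part along a walk depends on its length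
alone. This is what a single matrix buys. -/
theorem walkMap_sub (hA : IsUnit G.A.det) (w : List Γ) (x y : EuclideanSpace ℝ (Fin d)) :
    G.walkMap w x - G.walkMap w y = toEuclideanLin (G.A ^ (-(w.length : ℤ))) (x - y) := by
  induction w with
  | nil => simp [walkMap]
  | cons e w ih =>
    have h : ∀ a b, G.map e a - G.map e b = toEuclideanLin (G.A ^ (-1 : ℤ)) (a - b) := by
      intro a b
      rw [Matrix.zpow_neg_one, map, map, ← map_sub, add_sub_add_right_eq_sub]
    simp only [walkMap, Function.comp_apply]
    rw [h, ih, ← toEuclideanLin_zpow_add hA]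
    congr 3
    simp

theorem continuous_map (e : Γ) : Continuous (G.map e) :=
  (continuous_toEuclideanLin _).comp (continuous_id.add continuous_const)

theorem continuous_walkMap (w : List Γ) : Continuous (G.walkMap w) := by
  induction w with
  | nil => exact continuous_id
  | cons e w ih => exact (continuous_map e).comp ih

theorem cylinderSet_nil (i : V) : G.cylinderSet E i [] = E i := by
  simp [cylinderSet, walkMap, walkEnd]

theorem cylinderSet_cons (i : V) (e : Γ) (w : List Γ) :
    G.cylinderSet E i (e :: w) = G.map e '' G.cylinderSet E (G.tgt e) w := by
  simp [cylinderSet, walkMap, walkEnd, Set.image_image]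

theorem isCompact_cylinderSet (hE : G.IsInvariantFamily E) (i : V) (w : List Γ) :
    IsCompact (G.cylinderSet E i w) :=
  (hE.2.1 _).image (continuous_walkMap w)

theorem cylinderSet_nonempty (hE : G.IsInvariantFamily E) (i : V) (w : List Γ) :
    (G.cylinderSet E i w).Nonempty :=
  (hE.1 _).image _

theorem image_map_subset (hE : G.IsInvariantFamily E) (e : Γ) :
    G.map e '' E (G.tgt e) ⊆ E (G.src e) := by
  rw [hE.2.2 (G.src e)]
  exact Set.subset_iUnion₂_of_subset e rfl subset_rfl

theorem cylinderSet_subset (hE : G.IsInvariantFamily E) {i : V} {w : List Γ}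
    (hw : G.IsWalk i w) : G.cylinderSet E i w ⊆ E i := by
  induction w generalizing i with
  | nil => rw [cylinderSet_nil]
  | cons e w ih =>
    rw [cylinderSet_cons, ← hw.1]
    exact (Set.image_mono (ih hw.2)).trans (image_map_subset hE e)

theorem exists_walk_of_mem (hE : G.IsInvariantFamily E) (k : ℕ) {i : V}
    {x : EuclideanSpace ℝ (Fin d)} (hx : x ∈ E i) :
    ∃ w ∈ G.walks i k, x ∈ G.cylinderSet E i w := by
  induction k generalizing i x with
  | zero => exact ⟨[], ⟨rfl, trivial⟩, by rwa [cylinderSet_nil]⟩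
  | succ k ih =>
    rw [hE.2.2 i] at hx
    obtain ⟨e, he, y, hy, rfl⟩ := Set.mem_iUnion₂.1 hx
    obtain ⟨w, ⟨hw1, hw2⟩, hyw⟩ := ih hy
    exact ⟨e :: w, ⟨by simp [hw1], he, hw2⟩, by
      rw [cylinderSet_cons]; exact Set.mem_image_of_mem _ hyw⟩

open Classical in
/-- The walks of length `k` starting at `i`, as a finite set. -/
def walkFinset [Fintype Γ] (G : SingleMatrixGIFS d V Γ) : V → ℕ → Finset (List Γ)
  | _, 0 => {[]}
  | i, k + 1 => (Finset.univ.filter fun e => G.src e = i).biUnion fun e =>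
      (walkFinset G (G.tgt e) k).image (List.cons e)

theorem mem_walkFinset [Fintype Γ] {i : V} {k : ℕ} {w : List Γ} :
    w ∈ G.walkFinset i k ↔ w ∈ G.walks i k := by
  classical
  induction k generalizing i w with
  | zero =>
    simp only [walkFinset, Finset.mem_singleton, walks, Set.mem_ofPred_eq, List.length_eq_zero_iff]
    constructor
    · rintro rfl; exact ⟨rfl, trivial⟩
    · exact fun h => h.1
  | succ k ih =>
    simp only [walkFinset, Finset.mem_biUnion, Finset.mem_filter, Finset.mem_univ, true_and,
      Finset.mem_image, ih]
    constructor
    · rintro ⟨e, he, w, ⟨hw1, hw2⟩, rfl⟩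
      exact ⟨by simp [hw1], he, hw2⟩
    · rintro ⟨h1, h2⟩
      cases w with
      | nil => simp at h1
      | cons e w => exact ⟨e, h2.1, w, ⟨by simpa using h1, h2.2⟩, rfl⟩

theorem lex_trichotomy [PartialOrder Γ] (hord : G.IsOrdered) {i : V} {k : ℕ} {v w : List Γ}
    (hv : v ∈ G.walks i k) (hw : w ∈ G.walks i k) :
    v = w ∨ List.Lex (· < ·) v w ∨ List.Lex (· < ·) w v := by
  induction k generalizing i v w with
  | zero =>
    left
    rw [List.length_eq_zero_iff.1 hv.1, List.length_eq_zero_iff.1 hw.1]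
  | succ k ih =>
    obtain ⟨hv1, hv2⟩ := hv
    obtain ⟨hw1, hw2⟩ := hw
    cases v with
    | nil => simp at hv1
    | cons e v =>
      cases w with
      | nil => simp at hw1
      | cons f w =>
        by_cases hef : e = f
        · subst hef
          rcases ih ⟨by simpa using hv1, hv2.2⟩ ⟨by simpa using hw1, hw2.2⟩ with h | h | h
          · exact Or.inl (by rw [h])
          · exact Or.inr (Or.inl (List.Lex.cons h))
          · exact Or.inr (Or.inr (List.Lex.cons h))
        · rcases (hord e f).2 (hv2.1.trans hw2.1.symm) with h | h
          · exact Or.inr (Or.inl (List.Lex.rel (lt_of_le_of_ne h hef)))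
          · exact Or.inr (Or.inr (List.Lex.rel (lt_of_le_of_ne h (Ne.symm hef))))

end Walks

/-! ### Subdivision of an interval by walks, and coding maps -/

section Weights

variable [Fintype Γ] {lam : ℝ} {p : V → ℝ}

open Classical in
/-- A positive weight on the vertices that is an eigenvector of the transposed associated
matrix. -/
structure IsWeight (G : SingleMatrixGIFS d V Γ) (lam : ℝ) (p : V → ℝ) : Prop where
  lam_pos : 0 < lam
  pos : ∀ i, 0 < p i
  sum_eq : ∀ i, ∑ e with G.src e = i, p (G.tgt e) = lam * p i

/-- The length of the interval coded by a walk. -/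
def walkLen (G : SingleMatrixGIFS d V Γ) (lam : ℝ) (p : V → ℝ) (i : V) (w : List Γ) : ℝ :=
  lam⁻¹ ^ w.length * p (G.walkEnd i w)

omit [Fintype Γ] in
theorem walkLen_cons (i : V) (e : Γ) (w : List Γ) :
    G.walkLen lam p i (e :: w) = lam⁻¹ * G.walkLen lam p (G.tgt e) w := by
  simp only [walkLen, walkEnd, List.length_cons, pow_succ]
  ring

theorem IsWeight.walkLen_pos (hp : G.IsWeight lam p) (i : V) (w : List Γ) :
    0 < G.walkLen lam p i w :=
  mul_pos (pow_pos (inv_pos.2 hp.lam_pos) _) (hp.pos _)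

theorem IsWeight.sum_walkLen (hp : G.IsWeight lam p) (i : V) (k : ℕ) :
    ∑ w ∈ G.walkFinset i k, G.walkLen lam p i w = p i := by
  classical
  induction k generalizing i with
  | zero => simp [walkFinset, walkLen, walkEnd]
  | succ k ih =>
    rw [walkFinset, Finset.sum_biUnion]
    · have : ∀ e, ∑ w ∈ (G.walkFinset (G.tgt e) k).image (List.cons e), G.walkLen lam p i w =
          lam⁻¹ * p (G.tgt e) := by
        intro e
        rw [Finset.sum_image (fun _ _ _ _ h => by simpa using h), ← ih, Finset.mul_sum]
        exact Finset.sum_congr rfl fun w _ => walkLen_cons i e w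
      simp only [this]
      rw [← Finset.mul_sum]
      have h := hp.sum_eq i
      have h2 := hp.lam_pos.ne'
      rw [inv_mul_eq_iff_eq_mul₀ h2, ← h]
    · intro e _ f _ hef
      rw [Function.onFun, Finset.disjoint_left]
      intro w hw hw'
      obtain ⟨_, _, rfl⟩ := Finset.mem_image.1 hw
      obtain ⟨_, _, h⟩ := Finset.mem_image.1 hw'
      simp only [List.cons.injEq] at h
      exact hef h.1.symm

variable [PartialOrder Γ]

open Classical in
/-- The left endpoint of the interval coded by an edge. -/
def edgeStart (G : SingleMatrixGIFS d V Γ) (lam : ℝ) (p : V → ℝ) (f : Γ) : ℝ :=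
  lam⁻¹ * ∑ e with e < f, p (G.tgt e)

/-- The left endpoint of the interval coded by a walk. -/
def walkStart (G : SingleMatrixGIFS d V Γ) (lam : ℝ) (p : V → ℝ) : List Γ → ℝ
  | [] => 0
  | e :: w => G.edgeStart lam p e + lam⁻¹ * walkStart G lam p w

theorem IsWeight.edgeStart_nonneg (hp : G.IsWeight lam p) (e : Γ) : 0 ≤ G.edgeStart lam p e :=
  mul_nonneg (inv_nonneg.2 hp.lam_pos.le) (Finset.sum_nonneg fun _ _ => (hp.pos _).le)

theorem edgeStart_add (e : Γ) : G.edgeStart lam p e + lam⁻¹ * p (G.tgt e) =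
    open Classical in lam⁻¹ * ∑ f with f ≤ e, p (G.tgt f) := by
  classical
  rw [edgeStart, ← mul_add]
  congr 1
  have : (Finset.univ.filter fun f => f ≤ e) = insert e (Finset.univ.filter fun f => f < e) := by
    ext f
    simp [le_iff_eq_or_lt]
  rw [this, Finset.sum_insert (by simp), add_comm]

theorem IsWeight.edgeStart_add_le_of_lt (hp : G.IsWeight lam p) {e f : Γ} (hef : e < f) :
    G.edgeStart lam p e + lam⁻¹ * p (G.tgt e) ≤ G.edgeStart lam p f := by
  classical
  rw [edgeStart_add, edgeStart]
  refine mul_le_mul_of_nonneg_left (Finset.sum_le_sum_of_subset_of_nonneg ?_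
    fun _ _ _ => (hp.pos _).le) (inv_nonneg.2 hp.lam_pos.le)
  intro g hg
  simp only [Finset.mem_filter, Finset.mem_univ, true_and] at hg ⊢
  exact hg.trans_lt hef

theorem IsWeight.edgeStart_add_le (hp : G.IsWeight lam p) (hord : G.IsOrdered) (e : Γ) :
    G.edgeStart lam p e + lam⁻¹ * p (G.tgt e) ≤ p (G.src e) := by
  classical
  rw [edgeStart_add, inv_mul_le_iff₀ hp.lam_pos, ← hp.sum_eq]
  refine Finset.sum_le_sum_of_subset_of_nonneg ?_ fun _ _ _ => (hp.pos _).le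
  intro g hg
  simp only [Finset.mem_filter, Finset.mem_univ, true_and] at hg ⊢
  exact (hord g e).1 (Or.inl hg)

theorem IsWeight.walkStart_nonneg (hp : G.IsWeight lam p) (w : List Γ) :
    0 ≤ G.walkStart lam p w := by
  induction w with
  | nil => exact le_rfl
  | cons e w ih =>
    exact add_nonneg (hp.edgeStart_nonneg e) (mul_nonneg (inv_nonneg.2 hp.lam_pos.le) ih)

theorem IsWeight.walkStart_add_le (hp : G.IsWeight lam p) (hord : G.IsOrdered) {i : V}
    {w : List Γ} (hw : G.IsWalk i w) :
    G.walkStart lam p w + G.walkLen lam p i w ≤ p i := by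
  induction w generalizing i with
  | nil => simp [walkStart, walkLen, walkEnd]
  | cons e w ih =>
    rw [walkLen_cons, walkStart, ← hw.1, add_assoc, ← mul_add]
    refine le_trans ?_ (hp.edgeStart_add_le hord e)
    have := inv_pos.2 hp.lam_pos
    have := mul_le_mul_of_nonneg_left (ih hw.2) this.le
    linarith

/-- At the first differing edge the edge intervals are already ordered, and the intervals of longer
walks stay inside them. -/
theorem IsWeight.walkStart_add_le_of_lex (hp : G.IsWeight lam p) (hord : G.IsOrdered) {i : V}
    {k : ℕ} {v w : List Γ} (hv : v ∈ G.walks i k) (hw : w ∈ G.walks i k)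
    (h : List.Lex (· < ·) v w) :
    G.walkStart lam p v + G.walkLen lam p i v ≤ G.walkStart lam p w := by
  have hl := inv_pos.2 hp.lam_pos
  induction h generalizing i k with
  | nil => simp [walks] at hv hw; omega
  | @cons e v w h ih =>
    obtain ⟨hv1, hv2⟩ := hv
    obtain ⟨hw1, hw2⟩ := hw
    have := ih (i := G.tgt e) (k := v.length) ⟨rfl, hv2.2⟩
      ⟨by simp only [List.length_cons] at hv1 hw1; omega, hw2.2⟩
    rw [walkLen_cons, walkStart, walkStart, add_assoc, ← mul_add]
    have := mul_le_mul_of_nonneg_left this hl.le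
    linarith
  | @rel e v f w h =>
    have h1 := mul_le_mul_of_nonneg_left (hp.walkStart_add_le hord hv.2.2) hl.le
    have h2 := hp.edgeStart_add_le_of_lt h
    have h3 := mul_nonneg hl.le (hp.walkStart_nonneg w)
    rw [walkLen_cons, walkStart, walkStart, add_assoc, ← mul_add]
    linarith

/-- The edge intervals at i tile [0, p i]: the greatest edge ends at p i, and each other edge ends
where its successor starts. The right edge is the least one whose right endpoint is at least x. -/
theorem IsWeight.exists_edge (hp : G.IsWeight lam p) (hord : G.IsOrdered) {i : V} {x : ℝ}
    (hx0 : 0 ≤ x) (hx : x ≤ p i) : ∃ e, G.src e = i ∧ G.edgeStart lam p e ≤ x ∧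
      x ≤ G.edgeStart lam p e + lam⁻¹ * p (G.tgt e) := by
  classical
  set S := Finset.univ.filter fun e => G.src e = i
  have htot : ∀ e ∈ S, ∀ f ∈ S, e ≤ f ∨ f ≤ e := by
    intro e he f hf
    simp only [S, Finset.mem_filter, Finset.mem_univ, true_and] at he hf
    exact (hord e f).2 (he.trans hf.symm)
  have hSne : S.Nonempty := by
    by_contra h
    have h1 := hp.sum_eq i
    rw [Finset.not_nonempty_iff_eq_empty] at h
    have h2 := mul_pos hp.lam_pos (hp.pos i)
    rw [← h1] at h2
    simp only [S] at h
    simp [h] at h2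
  set T := S.filter fun e => x ≤ G.edgeStart lam p e + lam⁻¹ * p (G.tgt e)
  have hTne : T.Nonempty := by
    obtain ⟨e, he, hmax⟩ := S.exists_maximal hSne
    refine ⟨e, Finset.mem_filter.2 ⟨he, hx.trans (le_of_eq ?_)⟩⟩
    rw [edgeStart_add, eq_inv_mul_iff_mul_eq₀ hp.lam_pos.ne', ← hp.sum_eq]
    refine Finset.sum_congr ?_ fun _ _ => rfl
    ext f
    simp only [Finset.mem_filter, Finset.mem_univ, true_and]
    constructor
    · intro hf
      have hfS : f ∈ S := by simp [S, hf]
      rcases htot f hfS e he with h | h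
      · exact h
      · exact hmax hfS h
    · intro hf
      exact ((hord f e).1 (Or.inl hf)).trans (Finset.mem_filter.1 he).2
  obtain ⟨e, he, hmin⟩ := T.exists_minimal hTne
  obtain ⟨heS, hxe⟩ := Finset.mem_filter.1 he
  have hei : G.src e = i := (Finset.mem_filter.1 heS).2
  refine ⟨e, hei, ?_, hxe⟩
  rcases (Finset.univ.filter fun f => f < e).eq_empty_or_nonempty with h | h
  · rw [edgeStart, h]
    simpa using hx0
  · obtain ⟨f, hf, hmax⟩ := Finset.exists_maximal h
    have hfe : f < e := (Finset.mem_filter.1 hf).2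
    have hfi : G.src f = i := ((hord f e).1 (Or.inl hfe.le)).trans hei
    have hfT : f ∉ T := fun hfT => (hfe.not_ge (hmin hfT hfe.le))
    have hxf : G.edgeStart lam p f + lam⁻¹ * p (G.tgt f) < x := by
      by_contra! hle
      exact hfT (Finset.mem_filter.2 ⟨by simp [S, hfi], hle⟩)
    refine le_trans (le_of_eq ?_) hxf.le
    rw [edgeStart_add, edgeStart]
    congr 1
    refine Finset.sum_congr ?_ fun _ _ => rfl
    ext g
    simp only [Finset.mem_filter, Finset.mem_univ, true_and]
    refine ⟨fun hg => ?_, fun hg => hg.trans_lt hfe⟩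
    have hgi : G.src g = i := ((hord g e).1 (Or.inl hg.le)).trans hei
    rcases htot g (by simp [S, hgi]) f (by simp [S, hfi]) with h | h
    · exact h
    · exact hmax (by simp [hg]) h

open Classical in
/-- A walk of length `k` starting at `i` whose interval contains `x`. -/
def codingWord (G : SingleMatrixGIFS d V Γ) (lam : ℝ) (p : V → ℝ) : ℕ → V → ℝ → List Γ
  | 0, _, _ => []
  | k + 1, i, x =>
    if h : ∃ e, G.src e = i ∧ G.edgeStart lam p e ≤ x ∧
        x ≤ G.edgeStart lam p e + lam⁻¹ * p (G.tgt e) then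
      h.choose :: codingWord G lam p k (G.tgt h.choose) (lam * (x - G.edgeStart lam p h.choose))
    else []

/-- The recursion chooses the first edge independently of k and rescales x to the interval of its
end vertex, so longer coding words extend shorter ones; hence the nesting of cylinders. -/
theorem IsWeight.codingWord_spec (hp : G.IsWeight lam p) (hord : G.IsOrdered)
    (hE : G.IsInvariantFamily E) (k : ℕ) {i : V} {x : ℝ} (hx0 : 0 ≤ x) (hx : x ≤ p i) :
    G.codingWord lam p k i x ∈ G.walks i k ∧
      G.walkStart lam p (G.codingWord lam p k i x) ≤ x ∧
      x ≤ G.walkStart lam p (G.codingWord lam p k i x) +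
        G.walkLen lam p i (G.codingWord lam p k i x) ∧
      G.cylinderSet E i (G.codingWord lam p (k + 1) i x) ⊆
        G.cylinderSet E i (G.codingWord lam p k i x) := by
  have hl := hp.lam_pos
  induction k generalizing i x with
  | zero =>
    have hex := hp.exists_edge hord hx0 hx
    refine ⟨⟨rfl, trivial⟩, hx0, by simpa [codingWord, walkStart, walkLen, walkEnd] using hx, ?_⟩
    simp only [codingWord, dif_pos hex]
    rw [cylinderSet_cons, cylinderSet_nil, cylinderSet_nil]
    have := hex.choose_spec.1
    conv_rhs => rw [← this]
    exact image_map_subset hE _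
  | succ k ih =>
    have hex := hp.exists_edge hord hx0 hx
    obtain ⟨h1, h2, h3⟩ := hex.choose_spec
    set e := hex.choose with he
    have hstep : ∀ n, G.codingWord lam p (n + 1) i x =
        e :: G.codingWord lam p n (G.tgt e) (lam * (x - G.edgeStart lam p e)) := by
      intro n
      rw [codingWord, dif_pos hex]
    obtain ⟨⟨i1, i2⟩, i3, i4, i5⟩ := ih (i := G.tgt e) (x := lam * (x - G.edgeStart lam p e))
      (mul_nonneg hl.le (sub_nonneg.2 h2)) (by
        rw [← le_inv_mul_iff₀ hl]; linarith)
    rw [hstep k, hstep (k + 1)]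
    refine ⟨⟨by simp [i1], h1, i2⟩, ?_, ?_, ?_⟩
    · rw [walkStart]
      rw [← inv_mul_le_iff₀ hl] at i3
      linarith
    · rw [walkStart, walkLen_cons, add_assoc, ← mul_add]
      rw [← le_inv_mul_iff₀ hl] at i4
      linarith
    · rw [cylinderSet_cons, cylinderSet_cons]
      exact Set.image_mono i5

/-- `ψ` maps every parameter `t` into a cylinder set whose interval contains `t`, at every level. -/
def IsCoding (G : SingleMatrixGIFS d V Γ) (E : V → Set (EuclideanSpace ℝ (Fin d))) (lam : ℝ)
    (p : V → ℝ) (j : V) (ψ : unitInterval → EuclideanSpace ℝ (Fin d)) : Prop :=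
  ∀ (t : unitInterval) (k : ℕ), ∃ w ∈ G.walks j k, G.walkStart lam p w ≤ p j * t ∧
    p j * t ≤ G.walkStart lam p w + G.walkLen lam p j w ∧ ψ t ∈ G.cylinderSet E j w

theorem IsWeight.exists_isCoding (hp : G.IsWeight lam p) (hord : G.IsOrdered)
    (hE : G.IsInvariantFamily E) (j : V) : ∃ ψ, G.IsCoding E lam p j ψ := by
  have key : ∀ t : unitInterval, ∃ y, ∀ k : ℕ,
      y ∈ G.cylinderSet E j (G.codingWord lam p k j (p j * t)) := by
    intro t
    have h0 : 0 ≤ p j * t := mul_nonneg (hp.pos j).le t.2.1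
    have h1 : p j * t ≤ p j := mul_le_of_le_one_right (hp.pos j).le t.2.2
    obtain ⟨y, hy⟩ := IsCompact.nonempty_iInter_of_sequence_nonempty_isCompact_isClosed
      (fun k => G.cylinderSet E j (G.codingWord lam p k j (p j * t)))
      (fun k => (hp.codingWord_spec hord hE k h0 h1).2.2.2)
      (fun k => cylinderSet_nonempty hE _ _) (isCompact_cylinderSet hE _ _)
      (fun k => (isCompact_cylinderSet hE _ _).isClosed)
    exact ⟨y, Set.mem_iInter.1 hy⟩
  choose ψ hψ using key
  refine ⟨ψ, fun t k => ?_⟩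
  obtain ⟨h1, h2, h3, -⟩ := hp.codingWord_spec hord hE k (mul_nonneg (hp.pos j).le t.2.1)
    (mul_le_of_le_one_right (hp.pos j).le t.2.2)
  exact ⟨_, h1, h2, h3, hψ t k⟩

end Weights

end SingleMatrixGIFS

/-! ### The contraction ratio and the similarity dimension -/

section ContractionRatio

open Matrix Filter Topology

variable {d : ℕ} [NeZero d] {A : Matrix (Fin d) (Fin d) ℝ} {δ : ℝ}
  {φ : EuclideanSpace ℝ (Fin d) → ℝ}

/-- The factor by which `A⁻¹` contracts the pseudo-norm. -/
def contractionRatio (A : Matrix (Fin d) (Fin d) ℝ) : ℝ := |A.det| ^ (-1 / (d : ℝ))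

theorem contractionRatio_pos (hA : IsExpanding A) : 0 < contractionRatio A :=
  Real.rpow_pos_of_pos (by linarith [hA.one_lt_abs_det]) _

theorem contractionRatio_lt_one (hA : IsExpanding A) : contractionRatio A < 1 :=
  Real.rpow_lt_one_of_one_lt_of_neg hA.one_lt_abs_det
    (div_neg_of_neg_of_pos (by norm_num) (by exact_mod_cast NeZero.pos d))

theorem pseudoNorm_zpow_neg (hA : IsExpanding A) (φ : EuclideanSpace ℝ (Fin d) → ℝ) (k : ℕ)
    (x : EuclideanSpace ℝ (Fin d)) :
    pseudoNorm A φ (toEuclideanLin (A ^ (-(k : ℤ))) x) =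
      contractionRatio A ^ k * pseudoNorm A φ x := by
  have hq : 0 ≤ |A.det| := abs_nonneg _
  rw [pseudoNorm_zpow hA, contractionRatio, ← Real.rpow_natCast (|A.det| ^ (-1 / (d : ℝ))),
    ← Real.rpow_mul hq]
  congr 2
  push_cast
  ring

/-- The exponent `α` with `q ^ (α / d) = lam`. -/
def similarityDim (A : Matrix (Fin d) (Fin d) ℝ) (lam : ℝ) : ℝ :=
  (d : ℝ) * Real.log lam / Real.log |A.det|

theorem similarityDim_pos (hA : IsExpanding A) {lam : ℝ} (hlam : 1 < lam) :
    0 < similarityDim A lam :=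
  div_pos (mul_pos (by exact_mod_cast NeZero.pos d) (Real.log_pos hlam))
    (Real.log_pos hA.one_lt_abs_det)

theorem contractionRatio_rpow (hA : IsExpanding A) {lam : ℝ} (hlam : 1 < lam) :
    contractionRatio A ^ similarityDim A lam = lam⁻¹ := by
  have := rpow_div_rpow_log (d := d) hA.one_lt_abs_det (by linarith : 0 < lam) (-1)
  rw [_root_.zpow_neg_one] at this
  rw [← this, contractionRatio, similarityDim]
  norm_num

theorem contractionRatio_pow_rpow (hA : IsExpanding A) {lam : ℝ} (hlam : 1 < lam) (k : ℕ) :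
    (contractionRatio A ^ k) ^ similarityDim A lam = lam⁻¹ ^ k := by
  rw [← contractionRatio_rpow hA hlam, ← Real.rpow_natCast, ← Real.rpow_natCast,
    ← Real.rpow_mul (contractionRatio_pos hA).le, ← Real.rpow_mul (contractionRatio_pos hA).le,
    mul_comm]

theorem contractionRatio_pow_eq (hA : IsExpanding A) {lam : ℝ} (hlam : 1 < lam) (k : ℕ) :
    contractionRatio A ^ k = (lam⁻¹ ^ k) ^ (1 / similarityDim A lam) := by
  rw [← contractionRatio_pow_rpow hA hlam, ← Real.rpow_mul (pow_pos (contractionRatio_pos hA) k).le,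
    mul_one_div_cancel (similarityDim_pos hA hlam).ne', Real.rpow_one]

/-- Substitute for a quasi-triangle inequality: differences are bounded in the Euclidean norm after
magnification by A^k, then returned by homogeneity. -/
theorem exists_pseudoNorm_le_pow (hA : IsExpanding A) (hδ : δ < 1 / 2)
    (hφ : IsSmoothingKernel δ φ) (R : ℝ) :
    ∃ C : ℝ, 0 < C ∧ ∀ (k : ℕ) (x : EuclideanSpace ℝ (Fin d)),
      ‖toEuclideanLin (A ^ (k : ℤ)) x‖ ≤ R → pseudoNorm A φ x ≤ C * contractionRatio A ^ k := by
  obtain ⟨C, hC, h⟩ := exists_pseudoNorm_le hA hδ hφ R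
  refine ⟨C, hC, fun k x hx => ?_⟩
  have h1 := pseudoNorm_zpow_neg hA φ k (toEuclideanLin (A ^ (k : ℤ)) x)
  rw [toEuclideanLin_zpow_neg_self hA.isUnit_det] at h1
  rw [h1, mul_comm]
  exact mul_le_mul_of_nonneg_right (h _ hx) (pow_pos (contractionRatio_pos hA) k).le

end ContractionRatio

theorem exists_pos_le_of_finite {ι : Type*} [Finite ι] (p : ι → ℝ) (hp : ∀ i, 0 < p i) :
    ∃ m : ℝ, 0 < m ∧ ∀ i, m ≤ p i := by
  rcases isEmpty_or_nonempty ι with h | h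
  · exact ⟨1, one_pos, fun i => h.elim i⟩
  · obtain ⟨i, hi⟩ := Finite.exists_min p
    exact ⟨p i, hp i, hi⟩

theorem exists_pos_ge_of_finite {ι : Type*} [Finite ι] (p : ι → ℝ) :
    ∃ m : ℝ, 0 < m ∧ ∀ i, p i ≤ m := by
  obtain ⟨m, hm⟩ := (Set.finite_range p).bddAbove
  exact ⟨max m 1, by positivity, fun i => (hm ⟨i, rfl⟩).trans (le_max_left _ _)⟩

namespace SingleMatrixGIFS

open Matrix Filter Topology

variable {d : ℕ} [NeZero d] {V Γ : Type*} [Finite V] {G : SingleMatrixGIFS d V Γ}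
  {E : V → Set (EuclideanSpace ℝ (Fin d))} {δ : ℝ} {φ : EuclideanSpace ℝ (Fin d) → ℝ}

/-! ### Size and separation of cylinder sets -/

section Cylinders

omit [NeZero d] in
theorem IsInvariantFamily.exists_norm_le (hE : G.IsInvariantFamily E) :
    ∃ R : ℝ, 0 < R ∧ ∀ i, ∀ x ∈ E i, ‖x‖ ≤ R := by
  choose R hR using fun i => (hE.2.1 i).isBounded.exists_norm_le
  obtain ⟨m, hm, h⟩ := exists_pos_ge_of_finite R
  exact ⟨m, hm, fun i x hx => (hR i x hx).trans (h i)⟩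

omit [NeZero d] [Finite V] in
theorem norm_zpow_sub_le_of_mem_cylinderSet (hA : IsUnit G.A.det) {R : ℝ}
    (hR : ∀ i, ∀ x ∈ E i, ‖x‖ ≤ R) {i : V} {k : ℕ} {w : List Γ} (hw : w ∈ G.walks i k)
    {x y : EuclideanSpace ℝ (Fin d)} (hx : x ∈ G.cylinderSet E i w)
    (hy : y ∈ G.cylinderSet E i w) :
    ‖toEuclideanLin (G.A ^ (k : ℤ)) (x - y)‖ ≤ 2 * R := by
  obtain ⟨x', hx', rfl⟩ := hx
  obtain ⟨y', hy', rfl⟩ := hy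
  rw [walkMap_sub hA, hw.1, ← toEuclideanLin_zpow_add hA]
  simp only [add_neg_cancel, zpow_zero, toEuclideanLin_one_apply]
  linarith [norm_sub_le x' y', hR _ x' hx', hR _ y' hy']

theorem exists_pseudoNorm_cylinderSet_le (hA : IsExpanding G.A) (hδ : δ < 1 / 2)
    (hφ : IsSmoothingKernel δ φ) (hE : G.IsInvariantFamily E) :
    ∃ C : ℝ, 0 < C ∧ ∀ (i : V) (k : ℕ), ∀ w ∈ G.walks i k, ∀ x ∈ G.cylinderSet E i w,
      ∀ y ∈ G.cylinderSet E i w,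
        pseudoNorm G.A φ (x - y) ≤ C * contractionRatio G.A ^ k := by
  obtain ⟨R, hR0, hR⟩ := hE.exists_norm_le
  obtain ⟨C, hC, h⟩ := exists_pseudoNorm_le_pow hA hδ hφ (2 * R)
  exact ⟨C, hC, fun i k w hw x hx y hy =>
    h k _ (norm_zpow_sub_le_of_mem_cylinderSet hA.isUnit_det hR hw hx hy)⟩

omit [NeZero d] [Finite V] in
theorem image_walkMap_subset {U : V → Set (EuclideanSpace ℝ (Fin d))}
    (hU : ∀ e, G.map e '' U (G.tgt e) ⊆ U (G.src e)) {i : V} {w : List Γ} (hw : G.IsWalk i w) :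
    G.walkMap w '' U (G.walkEnd i w) ⊆ U i := by
  induction w generalizing i with
  | nil => simp [walkMap, walkEnd]
  | cons e w ih =>
    rw [walkMap, Set.image_comp, walkEnd, ← hw.1]
    exact (Set.image_mono (ih hw.2)).trans (hU e)

omit [NeZero d] [Finite V] in
theorem map_injective (hA : IsUnit G.A.det) (e : Γ) : Function.Injective (G.map e) := by
  intro x y hxy
  have h := walkMap_sub hA [e] x y
  simp only [walkMap, Function.comp_apply, id, hxy, sub_self] at h
  have h2 := toEuclideanLin_zpow_neg_self hA (-([e].length : ℤ)) (x - y)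
  rw [← h, map_zero] at h2
  exact sub_eq_zero.1 h2.symm

omit [NeZero d] [Finite V] in
theorem disjoint_image_walkMap (hA : IsUnit G.A.det) {U : V → Set (EuclideanSpace ℝ (Fin d))}
    (hU : ∀ e, G.map e '' U (G.tgt e) ⊆ U (G.src e))
    (hdisj : ∀ e f, e ≠ f → G.src e = G.src f →
      Disjoint (G.map e '' U (G.tgt e)) (G.map f '' U (G.tgt f)))
    {i : V} {k : ℕ} {v w : List Γ} (hv : v ∈ G.walks i k) (hw : w ∈ G.walks i k) (hvw : v ≠ w) :
    Disjoint (G.walkMap v '' U (G.walkEnd i v)) (G.walkMap w '' U (G.walkEnd i w)) := by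
  induction k generalizing i v w with
  | zero => exact absurd ((List.length_eq_zero_iff.1 hv.1).trans
      (List.length_eq_zero_iff.1 hw.1).symm) hvw
  | succ k ih =>
    obtain ⟨hv1, hv2⟩ := hv
    obtain ⟨hw1, hw2⟩ := hw
    cases v with
    | nil => simp at hv1
    | cons e v =>
      cases w with
      | nil => simp at hw1
      | cons f w =>
        rw [walkMap, walkMap, Set.image_comp, Set.image_comp, walkEnd, walkEnd]
        by_cases hef : e = f
        · subst hef
          rw [Set.disjoint_image_iff (map_injective hA e)]
          exact ih ⟨by simpa using hv1, hv2.2⟩ ⟨by simpa using hw1, hw2.2⟩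
            fun h => hvw (by rw [h])
        · exact (hdisj e f hef (hv2.1.trans hw2.1.symm)).mono
            (Set.image_mono (image_walkMap_subset hU hv2.2))
            (Set.image_mono (image_walkMap_subset hU hw2.2))

open Classical in
/-- Under the open set condition a set of small `ω`-diameter meets boundedly many cylinder sets of
comparable size. -/
theorem OpenSetCondition.exists_card_le [Fintype Γ] (hosc : G.OpenSetCondition)
    (hA : IsExpanding G.A) (hδ : δ < 1 / 2) (hφ : IsSmoothingKernel δ φ)
    (hE : G.IsInvariantFamily E) :
    ∃ N : ℕ, ∀ (i : V) (k : ℕ) (S : Set (EuclideanSpace ℝ (Fin d))),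
      omegaDiam G.A φ S ≤ ENNReal.ofReal (contractionRatio G.A ^ k) →
      ((G.walkFinset i k).filter fun w => (G.cylinderSet E i w ∩ S).Nonempty).card ≤ N := by
  obtain ⟨U, hUo, hUne, hUsub, hUdisj⟩ := hosc
  have hdet := hA.isUnit_det
  choose c hc using hUne
  choose ρ hρ0 hρ using fun i => Metric.isOpen_iff.1 (hUo i) (c i) (hc i)
  obtain ⟨r, hr0, hr⟩ := exists_pos_le_of_finite ρ hρ0
  obtain ⟨R, hR0, hR⟩ := hE.exists_norm_le
  obtain ⟨Rc, -, hRc⟩ := exists_pos_ge_of_finite fun i => ‖c i‖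
  obtain ⟨R', hR'0, hR'⟩ := exists_norm_le_of_pseudoNorm_le_one hA hδ hφ
  obtain ⟨t, -, htfin, ht⟩ := finite_cover_balls_of_compact
    (isCompact_closedBall (0 : EuclideanSpace ℝ (Fin d)) (Rc + R + R')) (half_pos hr0)
  refine ⟨htfin.toFinset.card, fun i k S hS => ?_⟩
  rcases S.eq_empty_or_nonempty with rfl | ⟨u, hu⟩
  · simp
  have hκ : 0 < contractionRatio G.A ^ k := pow_pos (contractionRatio_pos hA) k
  -- Position, seen from u and magnified by A^k, of the marked point of the copy of the open set
  -- belonging to w. The magnified copy contains the r-ball around `z w`, and all relevant `z w` lie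
  -- in one fixed ball.
  set z : List Γ → EuclideanSpace ℝ (Fin d) := fun w =>
    toEuclideanLin (G.A ^ (k : ℤ)) (G.walkMap w (c (G.walkEnd i w)) - u)
  have hz : ∀ w ∈ (G.walkFinset i k).filter fun w => (G.cylinderSet E i w ∩ S).Nonempty,
      ∃ y ∈ htfin.toFinset, z w ∈ Metric.ball y (r / 2) := by
    intro w hw
    obtain ⟨hw, _, ⟨y, hy, rfl⟩, hyS⟩ := Finset.mem_filter.1 hw
    have hwk : w.length = k := (mem_walkFinset.1 hw).1
    have hmem : z w ∈ Metric.closedBall (0 : EuclideanSpace ℝ (Fin d)) (Rc + R + R') := by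
      have hsplit : z w = (c (G.walkEnd i w) - y) +
          toEuclideanLin (G.A ^ (k : ℤ)) (G.walkMap w y - u) := by
        have h1 := walkMap_sub hdet w (c (G.walkEnd i w)) y
        have h2 : toEuclideanLin (G.A ^ (k : ℤ))
            (G.walkMap w (c (G.walkEnd i w)) - G.walkMap w y) = c (G.walkEnd i w) - y := by
          rw [h1, hwk, ← toEuclideanLin_zpow_add hdet]
          simp
        rw [← h2, ← map_add, sub_add_sub_cancel]
      have h3 : ‖toEuclideanLin (G.A ^ (k : ℤ)) (G.walkMap w y - u)‖ ≤ R' := by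
        refine hR' _ ?_
        have h4 := (ofReal_pseudoNorm_le_omegaDiam hyS hu).trans hS
        rw [ENNReal.ofReal_le_ofReal_iff hκ.le] at h4
        have h5 := pseudoNorm_zpow_neg hA φ k
          (toEuclideanLin (G.A ^ (k : ℤ)) (G.walkMap w y - u))
        rw [toEuclideanLin_zpow_neg_self hdet] at h5
        rw [h5] at h4
        exact le_of_mul_le_mul_left (by linarith) hκ
      rw [mem_closedBall_zero_iff, hsplit]
      linarith [norm_add_le (c (G.walkEnd i w) - y)
        (toEuclideanLin (G.A ^ (k : ℤ)) (G.walkMap w y - u)),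
        norm_sub_le (c (G.walkEnd i w)) y, hRc (G.walkEnd i w), hR _ y hy]
    obtain ⟨y, hy, hzy⟩ := Set.mem_iUnion₂.1 (ht hmem)
    exact ⟨y, htfin.mem_toFinset.2 hy, hzy⟩
  choose! f hf1 hf2 using hz
  -- Two walks assigned to the same r/2-ball have `z` values closer than r, so the marked point of
  -- one copy lies in the other copy, against disjointness.
  refine Finset.card_le_card_of_injOn f hf1 ?_
  intro w hw v hv hwv
  by_contra hne
  have hwk := mem_walkFinset.1 (Finset.mem_filter.1 hw).1
  have hvk := mem_walkFinset.1 (Finset.mem_filter.1 hv).1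
  have hdist : ‖z w - z v‖ < r := by
    have h1 := hf2 w hw
    have h2 := hf2 v hv
    rw [← hwv] at h2
    rw [← dist_eq_norm]
    linarith [dist_triangle_right (z w) (z v) (f w), Metric.mem_ball.1 h1, Metric.mem_ball.1 h2]
  refine Set.disjoint_left.1 (disjoint_image_walkMap hdet hUsub hUdisj hwk hvk hne)
    (?_ : G.walkMap v (c (G.walkEnd i v)) ∈ _) (Set.mem_image_of_mem _ (hc _))
  -- The preimage under `G.walkMap w` of the marked point of v.
  refine ⟨c (G.walkEnd i w) - (z w - z v), ?_, ?_⟩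
  · refine hρ _ ?_
    rw [mem_ball_iff_norm]
    have := hr (G.walkEnd i w)
    simp only [sub_sub_cancel_left, norm_neg]
    linarith
  · have h1 := walkMap_sub hdet w (c (G.walkEnd i w)) (c (G.walkEnd i w) - (z w - z v))
    have h2 : z w - z v = toEuclideanLin (G.A ^ (k : ℤ))
        (G.walkMap w (c (G.walkEnd i w)) - G.walkMap v (c (G.walkEnd i v))) := by
      simp only [z, ← map_sub, sub_sub_sub_cancel_right]
    rw [sub_sub_cancel, h2, hwk.1, toEuclideanLin_zpow_neg_self hdet] at h1
    rw [h2]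
    exact sub_right_injective h1

end Cylinders

end SingleMatrixGIFS

namespace SingleMatrixGIFS

open Matrix Filter Topology

variable {d : ℕ} [NeZero d] {V Γ : Type*} [Finite V] [Fintype Γ] {G : SingleMatrixGIFS d V Γ}
  {E : V → Set (EuclideanSpace ℝ (Fin d))} {δ : ℝ} {φ : EuclideanSpace ℝ (Fin d) → ℝ}
  {lam : ℝ} {p : V → ℝ}

/-! ### Upper bounds for the Hausdorff measure from cylinder covers -/

section Dimension

/-- The sums of `s`-th powers of diameters over the cylinder sets of a level. -/
theorem IsWeight.exists_sum_omegaDiam_le (hp : G.IsWeight lam p) (hA : IsExpanding G.A)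
    (hδ : δ < 1 / 2) (hφ : IsSmoothingKernel δ φ) (hE : G.IsInvariantFamily E) (j : V) {s : ℝ}
    (hs : 0 ≤ s) :
    ∃ C : ℝ, 0 < C ∧ ∀ k : ℕ, ∑ w ∈ G.walkFinset j k, omegaDiam G.A φ (G.cylinderSet E j w) ^ s ≤
      ENNReal.ofReal (C * (lam * contractionRatio G.A ^ s) ^ k) := by
  obtain ⟨C, hC, h⟩ := exists_pseudoNorm_cylinderSet_le hA hδ hφ hE
  obtain ⟨m, hm, hmp⟩ := exists_pos_le_of_finite p hp.pos
  have hκ := contractionRatio_pos hA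
  have hl := hp.lam_pos
  refine ⟨C ^ s * (p j / m), mul_pos (Real.rpow_pos_of_pos hC s) (div_pos (hp.pos j) hm),
    fun k => ?_⟩
  -- The intervals of level k have total length p j and each has length at least m / lam^k.
  have hcard : ((G.walkFinset j k).card : ℝ) ≤ p j / m * lam ^ k := by
    have h1 : ((G.walkFinset j k).card : ℝ) * (lam⁻¹ ^ k * m) ≤ p j := by
      rw [← hp.sum_walkLen j k, ← nsmul_eq_mul]
      refine Finset.card_nsmul_le_sum _ _ _ fun w hw => ?_
      rw [walkLen, (mem_walkFinset.1 hw).1]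
      exact mul_le_mul_of_nonneg_left (hmp _) (pow_pos (inv_pos.2 hl) k).le
    rw [inv_pow] at h1
    have hlk := pow_pos hl k
    rw [div_mul_eq_mul_div, le_div_iff₀ hm]
    calc ((G.walkFinset j k).card : ℝ) * m
        = ((G.walkFinset j k).card : ℝ) * ((lam ^ k)⁻¹ * m) * lam ^ k := by field_simp
      _ ≤ p j * lam ^ k := mul_le_mul_of_nonneg_right h1 hlk.le
  have hterm : ∀ w ∈ G.walkFinset j k, omegaDiam G.A φ (G.cylinderSet E j w) ^ s ≤
      ENNReal.ofReal ((C * contractionRatio G.A ^ k) ^ s) := by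
    intro w hw
    rw [← ENNReal.ofReal_rpow_of_nonneg (by positivity) hs]
    refine ENNReal.rpow_le_rpow (omegaDiam_le_iff.2 fun x hx y hy => ?_) hs
    exact ENNReal.ofReal_le_ofReal (h j k w (mem_walkFinset.1 hw) x hx y hy)
  refine (Finset.sum_le_card_nsmul _ _ _ hterm).trans ?_
  rw [nsmul_eq_mul, ← ENNReal.ofReal_natCast, ← ENNReal.ofReal_mul (by positivity)]
  refine ENNReal.ofReal_le_ofReal ?_
  rw [Real.mul_rpow hC.le (by positivity)]
  have h2 : (contractionRatio G.A ^ k) ^ s = (contractionRatio G.A ^ s) ^ k := by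
    rw [← Real.rpow_natCast, ← Real.rpow_natCast, ← Real.rpow_mul hκ.le, ← Real.rpow_mul hκ.le,
      mul_comm]
  rw [h2, mul_pow]
  have h3 : 0 ≤ C ^ s * (contractionRatio G.A ^ s) ^ k := by positivity
  nlinarith [mul_le_mul_of_nonneg_right hcard h3]

theorem omegaHausdorff_le_of_levels (hA : IsExpanding G.A)
    (hδ : δ < 1 / 2) (hφ : IsSmoothingKernel δ φ) (hE : G.IsInvariantFamily E) (j : V) {s : ℝ}
    {B : ℝ≥0∞} {K : ℕ} (hB : ∀ k, K ≤ k →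
      ∑ w ∈ G.walkFinset j k, omegaDiam G.A φ (G.cylinderSet E j w) ^ s ≤ B) :
    omegaHausdorff G.A φ s (E j) ≤ B := by
  obtain ⟨C, hC, h⟩ := exists_pseudoNorm_cylinderSet_le hA hδ hφ hE
  refine omegaHausdorff_le_of_covers (ι := List Γ) fun η hη => ?_
  obtain ⟨k, hk⟩ := exists_pow_lt_of_lt_one (div_pos hη hC) (contractionRatio_lt_one hA)
  have hkK : contractionRatio G.A ^ (max k K) < η / C :=
    (pow_le_pow_of_le_one (contractionRatio_pos hA).le (contractionRatio_lt_one hA).le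
      (le_max_left k K)).trans_lt hk
  rw [lt_div_iff₀ hC] at hkK
  refine ⟨G.walkFinset j (max k K), fun w => G.cylinderSet E j w, fun x hx => ?_, fun w hw => ?_,
    hB _ (le_max_right k K)⟩
  · obtain ⟨w, hw, hxw⟩ := exists_walk_of_mem hE (max k K) hx
    exact Set.mem_iUnion₂.2 ⟨w, mem_walkFinset.2 hw, hxw⟩
  · refine omegaDiam_le_iff.2 fun x hx y hy => ENNReal.ofReal_le_ofReal ?_
    have := h j _ w (mem_walkFinset.1 hw) x hx y hy
    linarith

theorem IsWeight.omegaHausdorff_lt_top (hp : G.IsWeight lam p) (hlam : 1 < lam)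
    (hA : IsExpanding G.A) (hδ : δ < 1 / 2) (hφ : IsSmoothingKernel δ φ)
    (hE : G.IsInvariantFamily E) (j : V) :
    omegaHausdorff G.A φ (similarityDim G.A lam) (E j) < ⊤ := by
  obtain ⟨C, hC, h⟩ := hp.exists_sum_omegaDiam_le hA hδ hφ hE j (similarityDim_pos hA hlam).le
  refine (omegaHausdorff_le_of_levels hA hδ hφ hE j (B := ENNReal.ofReal C) (K := 0)
    fun k _ => ?_).trans_lt ENNReal.ofReal_lt_top
  simpa [contractionRatio_rpow hA hlam, hp.lam_pos.ne'] using h k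

theorem IsWeight.omegaHausdorff_eq_zero (hp : G.IsWeight lam p) (hlam : 1 < lam)
    (hA : IsExpanding G.A) (hδ : δ < 1 / 2) (hφ : IsSmoothingKernel δ φ)
    (hE : G.IsInvariantFamily E) (j : V) {s : ℝ} (hs : similarityDim G.A lam < s) :
    omegaHausdorff G.A φ s (E j) = 0 := by
  have hs0 := (similarityDim_pos hA hlam).trans hs
  have hκ := contractionRatio_pos hA
  obtain ⟨C, hC, h⟩ := hp.exists_sum_omegaDiam_le hA hδ hφ hE j hs0.le
  have hθ : lam * contractionRatio G.A ^ s < 1 := by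
    have h1 := Real.rpow_lt_rpow_of_exponent_gt hκ (contractionRatio_lt_one hA) hs
    rw [contractionRatio_rpow hA hlam] at h1
    have := mul_lt_mul_of_pos_left h1 hp.lam_pos
    rwa [mul_inv_cancel₀ hp.lam_pos.ne'] at this
  have hθ0 : 0 ≤ lam * contractionRatio G.A ^ s := by have := hp.lam_pos; positivity
  refine le_antisymm (ENNReal.le_of_forall_pos_le_add fun ε hε _ => ?_) (zero_le)
  rw [zero_add]
  have hε' : (0 : ℝ) < ε := hε
  obtain ⟨K, hK⟩ := exists_pow_lt_of_lt_one (div_pos hε' hC) hθ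
  rw [lt_div_iff₀ hC] at hK
  refine omegaHausdorff_le_of_levels hA hδ hφ hE j (K := K) fun k hk => (h k).trans ?_
  rw [← ENNReal.ofReal_coe_nnreal]
  refine ENNReal.ofReal_le_ofReal ?_
  have := pow_le_pow_of_le_one hθ0 hθ.le hk
  nlinarith

end Dimension

/-! ### Hölder continuity and surjectivity of coding maps -/

section Coding

variable [PartialOrder Γ] {j : V} {ψ : unitInterval → EuclideanSpace ℝ (Fin d)}

omit [NeZero d] [Finite V] [PartialOrder Γ] in
theorem IsWeight.volume_Icc_le (hp : G.IsWeight lam p) (j : V) (a b : ℝ) :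
    volume {t : unitInterval | a ≤ p j * t ∧ p j * t ≤ b} ≤ ENNReal.ofReal ((b - a) / p j) := by
  have hpj := hp.pos j
  rw [unitInterval.volume_apply, sub_div, ← Real.volume_Icc]
  refine measure_mono ?_
  rintro _ ⟨t, ⟨h1, h2⟩, rfl⟩
  exact ⟨by rw [div_le_iff₀ hpj]; linarith, by rw [le_div_iff₀ hpj]; linarith⟩

omit [NeZero d] [Finite V] [PartialOrder Γ] in
theorem IsWeight.volume_Ioo (hp : G.IsWeight lam p) (j : V) {a b : ℝ} (ha : 0 ≤ a)
    (hb : b ≤ p j) :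
    volume {t : unitInterval | a < p j * t ∧ p j * t < b} = ENNReal.ofReal ((b - a) / p j) := by
  have hpj := hp.pos j
  rw [unitInterval.volume_apply, sub_div, ← Real.volume_Ioo]
  congr 1
  ext x
  constructor
  · rintro ⟨t, ⟨h1, h2⟩, rfl⟩
    exact ⟨by rw [div_lt_iff₀ hpj]; linarith, by rw [lt_div_iff₀ hpj]; linarith⟩
  · rintro ⟨h1, h2⟩
    rw [div_lt_iff₀ hpj] at h1
    rw [lt_div_iff₀ hpj] at h2
    refine ⟨⟨x, ?_, ?_⟩, ⟨by simpa [mul_comm] using h1, by simpa [mul_comm] using h2⟩, rfl⟩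
    · by_contra! h
      nlinarith
    · by_contra! h
      nlinarith

omit [NeZero d] [Finite V] in
-- A parameter strictly inside the interval of w lies in no other interval of that level, so the
-- walk supplied by the coding is w.
theorem IsCoding.mem_cylinderSet (hψ : G.IsCoding E lam p j ψ) (hp : G.IsWeight lam p)
    (hord : G.IsOrdered) {k : ℕ} {w : List Γ} (hw : w ∈ G.walks j k) {t : unitInterval}
    (h1 : G.walkStart lam p w < p j * t) (h2 : p j * t < G.walkStart lam p w + G.walkLen lam p j w) :
    ψ t ∈ G.cylinderSet E j w := by
  obtain ⟨v, hv, h3, h4, h5⟩ := hψ t k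
  rcases lex_trichotomy hord hv hw with h | h | h
  · rwa [← h]
  · have := hp.walkStart_add_le_of_lex hord hv hw h
    linarith
  · have := hp.walkStart_add_le_of_lex hord hw hv h
    linarith

omit [NeZero d] [Finite V] in
theorem IsCoding.mem (hψ : G.IsCoding E lam p j ψ) (t : unitInterval) : ψ t ∈ E j := by
  obtain ⟨w, hw, -, -, h⟩ := hψ t 0
  rw [List.length_eq_zero_iff.1 hw.1, cylinderSet_nil] at h
  exact h

theorem IsCoding.exists_holder (hψ : G.IsCoding E lam p j ψ) (hp : G.IsWeight lam p)
    (hlam : 1 < lam) (hA : IsExpanding G.A) (hδ : δ < 1 / 2) (hφ : IsSmoothingKernel δ φ)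
    (hord : G.IsOrdered) (hE : G.IsInvariantFamily E) (hlin : G.IsLinear E) :
    ∃ C : ℝ, 0 < C ∧ ∀ s t : unitInterval, pseudoNorm G.A φ (ψ s - ψ t) ≤
      C * |(s : ℝ) - (t : ℝ)| ^ (1 / similarityDim G.A lam) := by
  have hl := hp.lam_pos
  have hα := similarityDim_pos hA hlam
  have hpj := hp.pos j
  set β := 1 / similarityDim G.A lam with hβdef
  have hβ : 0 < β := one_div_pos.2 hα
  obtain ⟨m, hm, hmp⟩ := exists_pos_le_of_finite p hp.pos
  obtain ⟨R, hR0, hR⟩ := hE.exists_norm_le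
  obtain ⟨C, hC, hCb⟩ := exists_pseudoNorm_le_pow hA hδ hφ (4 * R)
  have hclose : ∀ (k : ℕ) (s t : unitInterval), (s : ℝ) < t → p j * (t - s) < lam⁻¹ ^ k * m →
      ∀ x y, (x = ψ s ∧ y = ψ t ∨ x = ψ t ∧ y = ψ s) →
      ‖toEuclideanLin (G.A ^ (k : ℤ)) (x - y)‖ ≤ 4 * R := by
    intro k s t hst hlt x y hxy
    obtain ⟨v, hv, v1, v2, v3⟩ := hψ s k
    obtain ⟨w, hw, w1, w2, w3⟩ := hψ t k
    have hlen : ∀ u ∈ G.walks j k, lam⁻¹ ^ k * m ≤ G.walkLen lam p j u := fun u hu => by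
      rw [walkLen, hu.1]
      exact mul_le_mul_of_nonneg_left (hmp _) (pow_pos (inv_pos.2 hl) k).le
    have hstp : p j * s < p j * t := mul_lt_mul_of_pos_left hst hpj
    -- No interval of level k fits strictly between the two parameters, so the walks are equal or
    -- adjacent; linearity supplies a common point. At level 0 only the empty walk exists.
    have hinter : (G.cylinderSet E j v ∩ G.cylinderSet E j w).Nonempty := by
      rcases lex_trichotomy hord hv hw with h | h | h
      · exact ⟨ψ s, v3, h ▸ v3⟩
      · rcases Nat.eq_zero_or_pos k with rfl | hk
        · have h1 := List.length_eq_zero_iff.1 hv.1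
          have h2 := List.length_eq_zero_iff.1 hw.1
          rw [h1, h2] at h
          cases h
        · refine hlin j k hk v w ⟨hv, hw, h, ?_⟩
          rintro ⟨u, hu, hvu, huw⟩
          have h1 := hp.walkStart_add_le_of_lex hord hv hu hvu
          have h2 := hp.walkStart_add_le_of_lex hord hu hw huw
          have h3 := hlen u hu
          linarith
      · have := hp.walkStart_add_le_of_lex hord hw hv h
        linarith
    obtain ⟨z, hzv, hzw⟩ := hinter
    have hsplit : toEuclideanLin (G.A ^ (k : ℤ)) (x - y) =
        toEuclideanLin (G.A ^ (k : ℤ)) (x - z) + toEuclideanLin (G.A ^ (k : ℤ)) (z - y) := by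
      rw [← map_add, sub_add_sub_cancel]
    have hdet := hA.isUnit_det
    rw [hsplit]
    refine (norm_add_le _ _).trans ?_
    rcases hxy with ⟨rfl, rfl⟩ | ⟨rfl, rfl⟩
    · linarith [norm_zpow_sub_le_of_mem_cylinderSet hdet hR hv v3 hzv,
        norm_zpow_sub_le_of_mem_cylinderSet hdet hR hw hzw w3]
    · linarith [norm_zpow_sub_le_of_mem_cylinderSet hdet hR hw w3 hzw,
        norm_zpow_sub_le_of_mem_cylinderSet hdet hR hv hzv v3]
  have hclose' : ∀ (k : ℕ) (s t : unitInterval), s ≠ t → p j * |(s : ℝ) - t| < lam⁻¹ ^ k * m →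
      ‖toEuclideanLin (G.A ^ (k : ℤ)) (ψ s - ψ t)‖ ≤ 4 * R := by
    intro k s t hst h
    rcases lt_or_gt_of_ne (Subtype.coe_injective.ne hst) with h1 | h1
    · rw [abs_of_neg (by linarith)] at h
      exact hclose k s t h1 (by linarith) _ _ (Or.inl ⟨rfl, rfl⟩)
    · rw [abs_of_pos (by linarith)] at h
      exact hclose k t s h1 (by linarith) _ _ (Or.inr ⟨rfl, rfl⟩)
  have hlβ : 1 ≤ lam ^ β := Real.one_le_rpow hlam.le hβ.le
  refine ⟨C * lam ^ β * (2 * p j / m) ^ β, by positivity, fun s t => ?_⟩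
  rcases eq_or_ne s t with rfl | hst
  · rw [sub_self, pseudoNorm_zero hδ hφ]
    positivity
  have habs : 0 < |(s : ℝ) - t| := abs_pos.2 (sub_ne_zero.2 (Subtype.coe_injective.ne hst))
  rw [mul_assoc, ← Real.mul_rpow (by positivity) habs.le]
  -- The factor 2 makes X ≤ lam^(-k) imply the strict inequality needed by `hclose'`. For X > 1
  -- boundedness of E_j suffices; otherwise k is chosen with lam^(-(k+1)) < X ≤ lam^(-k).
  set X := 2 * p j / m * |(s : ℝ) - t| with hX
  have hX0 : 0 < X := by positivity
  have hXm : X * m = 2 * (p j * |(s : ℝ) - t|) := by rw [hX]; field_simp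
  rcases lt_or_ge 1 X with hX1 | hX1
  · have h0 : ‖toEuclideanLin (G.A ^ ((0 : ℕ) : ℤ)) (ψ s - ψ t)‖ ≤ 4 * R := by
      simp only [Nat.cast_zero, zpow_zero, toEuclideanLin_one_apply]
      linarith [norm_sub_le (ψ s) (ψ t), hR j _ (hψ.mem s), hR j _ (hψ.mem t)]
    have h1 := hCb 0 _ h0
    rw [pow_zero, mul_one] at h1
    have h2 := Real.one_le_rpow hX1.le hβ.le
    calc pseudoNorm G.A φ (ψ s - ψ t) ≤ C * 1 * 1 := by linarith
      _ ≤ C * lam ^ β * X ^ β := by gcongr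
  · obtain ⟨k, hk1, hk2⟩ := exists_nat_pow_near_of_lt_one hX0 hX1 (inv_pos.2 hl)
      (inv_lt_one_of_one_lt₀ hlam)
    have h1 := hCb k _ (hclose' k s t hst (by
      have := mul_le_mul_of_nonneg_right hk2 hm.le
      have : 0 < p j * |(s : ℝ) - t| := by positivity
      linarith))
    rw [contractionRatio_pow_eq hA hlam] at h1
    refine h1.trans ?_
    rw [mul_assoc, ← Real.mul_rpow hl.le hX0.le]
    refine mul_le_mul_of_nonneg_left (Real.rpow_le_rpow (by positivity) ?_ hβ.le) hC.le
    rw [pow_succ] at hk1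
    have h3 := mul_lt_mul_of_pos_left hk1 hl
    have h4 : lam * (lam⁻¹ ^ k * lam⁻¹) = lam⁻¹ ^ k := by
      rw [mul_comm, mul_assoc, inv_mul_cancel₀ hl.ne', mul_one]
    rw [h4] at h3
    exact h3.le

omit [Finite V] [Fintype Γ] [PartialOrder Γ] in
theorem continuous_of_holder (hA : IsExpanding G.A) (hδ : δ < 1 / 2)
    (hφ : IsSmoothingKernel δ φ) {C β : ℝ} (hβ : 0 < β)
    (h : ∀ s t : unitInterval, pseudoNorm G.A φ (ψ s - ψ t) ≤ C * |(s : ℝ) - (t : ℝ)| ^ β) :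
    Continuous ψ := by
  rw [continuous_iff_continuousAt]
  intro t
  rw [Metric.continuousAt_iff']
  intro ε hε
  obtain ⟨η, hη, hlt⟩ := exists_norm_lt_of_pseudoNorm_le hA hδ hφ hε
  have hc : Continuous fun s : unitInterval => C * |(s : ℝ) - (t : ℝ)| ^ β := by
    refine continuous_const.mul (Continuous.rpow_const (by fun_prop) fun _ => Or.inr hβ.le)
  have h0 : (fun s : unitInterval => C * |(s : ℝ) - (t : ℝ)| ^ β) t < η := by
    simpa [Real.zero_rpow hβ.ne'] using hη
  filter_upwards [hc.continuousAt.eventually_lt_const h0] with s hs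
  rw [dist_eq_norm]
  exact hlt _ ((h s t).trans hs.le)

/-- Every cylinder contains the image of the midpoint of its interval, so the range is dense in E_j;
being compact, it is closed. -/
theorem IsCoding.range_eq (hψ : G.IsCoding E lam p j ψ) (hψc : Continuous ψ)
    (hp : G.IsWeight lam p) (hA : IsExpanding G.A) (hδ : δ < 1 / 2)
    (hφ : IsSmoothingKernel δ φ) (hord : G.IsOrdered) (hE : G.IsInvariantFamily E) :
    Set.range ψ = E j := by
  refine Set.Subset.antisymm (Set.range_subset_iff.2 hψ.mem) fun x hx => ?_
  rw [← (isCompact_range hψc).isClosed.closure_eq, Metric.mem_closure_range_iff]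
  intro ε hε
  obtain ⟨η, hη, hlt⟩ := exists_norm_lt_of_pseudoNorm_le hA hδ hφ hε
  obtain ⟨C, hC, h⟩ := exists_pseudoNorm_cylinderSet_le hA hδ hφ hE
  obtain ⟨k, hk⟩ := exists_pow_lt_of_lt_one (div_pos hη hC) (contractionRatio_lt_one hA)
  rw [lt_div_iff₀ hC] at hk
  obtain ⟨w, hw, hxw⟩ := exists_walk_of_mem hE k hx
  have hpj := hp.pos j
  have h1 := hp.walkStart_nonneg w
  have h2 := hp.walkStart_add_le hord hw.2
  have h3 := hp.walkLen_pos j w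
  set y := (G.walkStart lam p w + G.walkLen lam p j w / 2) / p j with hy
  have hyp : p j * y = G.walkStart lam p w + G.walkLen lam p j w / 2 := by rw [hy]; field_simp
  let t : unitInterval := ⟨y, by positivity, by rw [hy, div_le_one hpj]; linarith⟩
  have ht := hψ.mem_cylinderSet hp hord hw (t := t) (by simp only [t]; linarith)
    (by simp only [t]; linarith)
  refine ⟨t, ?_⟩
  rw [dist_eq_norm]
  exact hlt _ ((h j k w hw x hxw _ ht).trans (by linarith))

end Coding

end SingleMatrixGIFS

namespace SingleMatrixGIFS

open Matrix Filter Topology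

variable {d : ℕ} [NeZero d] {V Γ : Type*} [Finite V] [Fintype Γ] [PartialOrder Γ]
  {G : SingleMatrixGIFS d V Γ} {E : V → Set (EuclideanSpace ℝ (Fin d))} {δ : ℝ}
  {φ : EuclideanSpace ℝ (Fin d) → ℝ} {lam : ℝ} {p : V → ℝ} {j : V}
  {ψ : unitInterval → EuclideanSpace ℝ (Fin d)}

/-! ### Mass distribution and the dimension of the invariant sets -/

section MassDistribution

omit [NeZero d] [Finite V] in
open Classical in
theorem IsCoding.volume_preimage_le (hψ : G.IsCoding E lam p j ψ) (hp : G.IsWeight lam p)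
    (k : ℕ) (S : Set (EuclideanSpace ℝ (Fin d))) :
    volume (ψ ⁻¹' S) ≤
      ∑ w ∈ (G.walkFinset j k).filter fun w => (G.cylinderSet E j w ∩ S).Nonempty,
        ENNReal.ofReal (G.walkLen lam p j w / p j) := by
  set W := (G.walkFinset j k).filter fun w => (G.cylinderSet E j w ∩ S).Nonempty
  have hsub : ψ ⁻¹' S ⊆ ⋃ w ∈ W, {t : unitInterval | G.walkStart lam p w ≤ p j * t ∧
      p j * t ≤ G.walkStart lam p w + G.walkLen lam p j w} := by
    intro t ht
    obtain ⟨w, hw, h1, h2, h3⟩ := hψ t k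
    exact Set.mem_iUnion₂.2
      ⟨w, Finset.mem_filter.2 ⟨mem_walkFinset.2 hw, ψ t, h3, ht⟩, h1, h2⟩
  refine (measure_mono hsub).trans ((measure_biUnion_finset_le _ _).trans ?_)
  refine Finset.sum_le_sum fun w _ => ?_
  have := hp.volume_Icc_le j (G.walkStart lam p w) (G.walkStart lam p w + G.walkLen lam p j w)
  rwa [add_sub_cancel_left] at this

/-- The mass distribution principle for a coding map. -/
theorem IsCoding.exists_volume_preimage_le (hψ : G.IsCoding E lam p j ψ) (hp : G.IsWeight lam p)
    (hlam : 1 < lam) (hosc : G.OpenSetCondition) (hA : IsExpanding G.A) (hδ : δ < 1 / 2)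
    (hφ : IsSmoothingKernel δ φ) (hE : G.IsInvariantFamily E) :
    ∃ C : ℝ, 0 < C ∧ ∀ S : Set (EuclideanSpace ℝ (Fin d)), volume (ψ ⁻¹' S) ≤
      ENNReal.ofReal C * omegaHausdorff G.A φ (similarityDim G.A lam) S := by
  classical
  obtain ⟨N, hN⟩ := hosc.exists_card_le hA hδ hφ hE
  obtain ⟨M, hM, hpM⟩ := exists_pos_ge_of_finite p
  have hpj := hp.pos j
  have hl := hp.lam_pos
  have hκ := contractionRatio_pos hA
  have hα := similarityDim_pos hA hlam
  set α := similarityDim G.A lam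
  -- `N + 1` instead of `N` keeps the constant positive when N = 0.
  set K : ℝ := (N + 1) * (M / p j) with hK
  have hK0 : 0 < K := by positivity
  have hlevel : ∀ (k : ℕ) (U : Set (EuclideanSpace ℝ (Fin d))),
      omegaDiam G.A φ U ≤ ENNReal.ofReal (contractionRatio G.A ^ k) →
      volume (ψ ⁻¹' U) ≤ ENNReal.ofReal (K * lam⁻¹ ^ k) := by
    intro k U hU
    refine (hψ.volume_preimage_le hp k U).trans ?_
    refine (Finset.sum_le_card_nsmul _ _ (ENNReal.ofReal (M / p j * lam⁻¹ ^ k))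
      fun w hw => ENNReal.ofReal_le_ofReal ?_).trans ?_
    · rw [walkLen, (mem_walkFinset.1 (Finset.mem_filter.1 hw).1).1, div_mul_eq_mul_div,
        mul_comm M]
      have := hpM (G.walkEnd j w)
      gcongr
    · rw [nsmul_eq_mul, ← ENNReal.ofReal_natCast, ← ENNReal.ofReal_mul (by positivity)]
      refine ENNReal.ofReal_le_ofReal ?_
      have h1 : (((G.walkFinset j k).filter
          fun w => (G.cylinderSet E j w ∩ U).Nonempty).card : ℝ) ≤ N := by
        exact_mod_cast hN j k U hU
      have h2 : 0 ≤ M / p j * lam⁻¹ ^ k := by positivity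
      rw [hK, mul_assoc]
      nlinarith
  -- The extra factor lam pays for rounding a diameter up to the next power of the contraction
  -- ratio.
  refine ⟨K * lam, by positivity, fun S => ?_⟩
  have hne : ENNReal.ofReal (K * lam) ≠ 0 := by
    simp only [ne_eq, ENNReal.ofReal_eq_zero, not_le]
    positivity
  rw [← ENNReal.inv_mul_le_iff hne ENNReal.ofReal_ne_top]
  refine le_omegaHausdorff_of_forall (η := 1) one_pos
    ((ENNReal.ofReal (K * lam))⁻¹ • OuterMeasure.map ψ (volume : Measure unitInterval).toOuterMeasure)
    (fun U _ hU => ?_) S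
  simp only [_root_.smul_apply, OuterMeasure.map_apply, smul_eq_mul, Measure.coe_toOuterMeasure]
  rw [ENNReal.inv_mul_le_iff hne ENNReal.ofReal_ne_top]
  -- A set of diameter 0 matches no single level; it satisfies the bound at every level, so its mass
  -- is 0.
  rcases eq_or_ne (omegaDiam G.A φ U) 0 with h0 | h0
  · have hlim : Tendsto (fun k : ℕ => ENNReal.ofReal (K * lam⁻¹ ^ k)) atTop (𝓝 0) := by
      rw [← ENNReal.ofReal_zero]
      refine (ENNReal.continuous_ofReal.tendsto 0).comp ?_
      simpa using (tendsto_pow_atTop_nhds_zero_of_lt_one (inv_pos.2 hl).le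
        (inv_lt_one_of_one_lt₀ hlam)).const_mul K
    exact (ge_of_tendsto' hlim fun k => hlevel k U (by rw [h0]; exact zero_le)).trans (zero_le)
  · have hfin : omegaDiam G.A φ U ≠ ⊤ := ne_top_of_le_ne_top ENNReal.ofReal_ne_top hU
    set D := (omegaDiam G.A φ U).toReal
    have hD : omegaDiam G.A φ U = ENNReal.ofReal D := (ENNReal.ofReal_toReal hfin).symm
    have hD0 : 0 < D := ENNReal.toReal_pos h0 hfin
    have hD1 : D ≤ 1 := by
      rw [hD] at hU
      exact (ENNReal.ofReal_le_ofReal_iff zero_le_one).1 hU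
    obtain ⟨k, hk1, hk2⟩ := exists_nat_pow_near_of_lt_one hD0 hD1 hκ (contractionRatio_lt_one hA)
    refine (hlevel k U (hD ▸ ENNReal.ofReal_le_ofReal hk2)).trans ?_
    rw [hD, ENNReal.ofReal_rpow_of_pos hD0, ← ENNReal.ofReal_mul (by positivity)]
    refine ENNReal.ofReal_le_ofReal ?_
    have h1 := Real.rpow_le_rpow (by positivity) hk1.le hα.le
    rw [contractionRatio_pow_rpow hA hlam, pow_succ] at h1
    have h3 := mul_le_mul_of_nonneg_left h1 hl.le
    have h4 : lam * (lam⁻¹ ^ k * lam⁻¹) = lam⁻¹ ^ k := by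
      rw [mul_comm, mul_assoc, inv_mul_cancel₀ hl.ne', mul_one]
    rw [h4] at h3
    rw [mul_assoc K lam]
    exact mul_le_mul_of_nonneg_left h3 hK0.le

theorem IsWeight.omegaHausdorff_pos (hp : G.IsWeight lam p) (hlam : 1 < lam)
    (hosc : G.OpenSetCondition) (hA : IsExpanding G.A) (hδ : δ < 1 / 2)
    (hφ : IsSmoothingKernel δ φ) (hord : G.IsOrdered) (hE : G.IsInvariantFamily E) (j : V) :
    0 < omegaHausdorff G.A φ (similarityDim G.A lam) (E j) := by
  obtain ⟨ψ, hψ⟩ := hp.exists_isCoding hord hE j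
  obtain ⟨C, hC, h⟩ := hψ.exists_volume_preimage_le hp hlam hosc hA hδ hφ hE
  have h1 := h (E j)
  have h2 : ψ ⁻¹' E j = Set.univ := Set.eq_univ_of_forall hψ.mem
  rw [h2, measure_univ] at h1
  refine pos_iff_ne_zero.2 fun h0 => ?_
  rw [h0, mul_zero] at h1
  exact not_lt_of_ge h1 zero_lt_one

theorem IsWeight.omegaDim_eq (hp : G.IsWeight lam p) (hlam : 1 < lam)
    (hosc : G.OpenSetCondition) (hA : IsExpanding G.A) (hδ : δ < 1 / 2)
    (hφ : IsSmoothingKernel δ φ) (hord : G.IsOrdered) (hE : G.IsInvariantFamily E) (j : V) :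
    omegaDim G.A φ (E j) = similarityDim G.A lam := by
  have hα := similarityDim_pos hA hlam
  -- Positivity at the critical exponent, with monotonicity in the exponent, excludes everything up
  -- to and including it.
  have hset : {s : ℝ | 0 ≤ s ∧ omegaHausdorff G.A φ s (E j) = 0} =
      Set.Ioi (similarityDim G.A lam) := by
    ext s
    constructor
    · rintro ⟨-, h0⟩
      by_contra hs
      have h1 := omegaHausdorff_anti_exponent (A := G.A) (φ := φ) (not_lt.1 hs) (E j)
      rw [h0] at h1
      exact (hp.omegaHausdorff_pos hlam hosc hA hδ hφ hord hE j).not_ge h1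
    · exact fun hs => ⟨hα.le.trans (le_of_lt hs), hp.omegaHausdorff_eq_zero hlam hA hδ hφ hE j hs⟩
  rw [omegaDim, hset, csInf_Ioi]

end MassDistribution

/-! ### Hausdorff measures as Perron weights -/

section HausdorffWeight

omit [Finite V] [Fintype Γ] [PartialOrder Γ] in
theorem omegaHausdorff_map_image_le (hlam : 1 < lam) (hA : IsExpanding G.A) (w : List Γ)
    (S : Set (EuclideanSpace ℝ (Fin d))) :
    omegaHausdorff G.A φ (similarityDim G.A lam) (G.walkMap w '' S) ≤
      ENNReal.ofReal (lam⁻¹ ^ w.length) *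
        omegaHausdorff G.A φ (similarityDim G.A lam) S := by
  have hκ := contractionRatio_pos hA
  rw [← contractionRatio_pow_rpow hA hlam]
  refine omegaHausdorff_image_le (pow_pos hκ _)
    (pow_le_one₀ hκ.le (contractionRatio_lt_one hA).le) (similarityDim_pos hA hlam).le
    (fun x y => ?_) S
  rw [walkMap_sub hA.isUnit_det, pseudoNorm_zpow_neg hA]

open Classical in
/-- The Hausdorff measures of the invariant sets form a weight. -/
theorem IsWeight.isWeight_omegaHausdorff [Fintype V] (hp : G.IsWeight lam p) (hlam : 1 < lam)
    (hosc : G.OpenSetCondition) (hA : IsExpanding G.A) (hδ : δ < 1 / 2)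
    (hφ : IsSmoothingKernel δ φ) (hord : G.IsOrdered) (hE : G.IsInvariantFamily E)
    {u : V → ℝ} (hu : ∀ i, 0 < u i) (hMu : ∀ i, ∑ e with G.tgt e = i, u (G.src e) = lam * u i) :
    G.IsWeight lam fun i => (omegaHausdorff G.A φ (similarityDim G.A lam) (E i)).toReal := by
  have hl := hp.lam_pos
  have hfin := hp.omegaHausdorff_lt_top hlam hA hδ hφ hE
  have hpos := hp.omegaHausdorff_pos hlam hosc hA hδ hφ hord hE
  set P : V → ℝ := fun i => (omegaHausdorff G.A φ (similarityDim G.A lam) (E i)).toReal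
  have hsub : ∀ i, lam * P i ≤ ∑ e with G.src e = i, P (G.tgt e) := by
    intro i
    have h1 : omegaHausdorff G.A φ (similarityDim G.A lam) (E i) ≤
        ∑ e with G.src e = i, ENNReal.ofReal (lam⁻¹ * P (G.tgt e)) := by
      have hcov : E i ⊆ ⋃ e ∈ Finset.univ.filter fun e => G.src e = i,
          G.walkMap [e] '' E (G.tgt e) := by
        conv_lhs => rw [hE.2.2 i]
        simp [walkMap]
      refine (omegaHausdorff_mono _ hcov).trans ?_
      rw [← omegaOuter_apply]
      refine (measure_biUnion_finset_le _ _).trans (Finset.sum_le_sum fun e _ => ?_)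
      rw [omegaOuter_apply, ENNReal.ofReal_mul (inv_pos.2 hl).le,
        ENNReal.ofReal_toReal (hfin _).ne]
      simpa using omegaHausdorff_map_image_le (φ := φ) hlam hA [e] (E (G.tgt e))
    rw [← ENNReal.ofReal_sum_of_nonneg
      (fun e _ => mul_nonneg (inv_pos.2 hl).le ENNReal.toReal_nonneg), ← Finset.mul_sum] at h1
    have h2 := ENNReal.toReal_mono ENNReal.ofReal_ne_top h1
    rw [ENNReal.toReal_ofReal (mul_nonneg (inv_pos.2 hl).le
      (Finset.sum_nonneg fun _ _ => ENNReal.toReal_nonneg))] at h2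
    rwa [le_inv_mul_iff₀ hl] at h2
  refine ⟨hl, fun i => ENNReal.toReal_pos (hpos i).ne' (hfin i).ne, fun i => ?_⟩
  -- Summing over edges by source or by target shows that the two sides of `hsub`, weighted by u,
  -- have equal totals. As u > 0, every inequality in `hsub` is an equality.
  have hsum : ∑ i, u i * (lam * P i) = ∑ i, u i * ∑ e with G.src e = i, P (G.tgt e) := by
    have h1 : ∑ i, u i * ∑ e with G.src e = i, P (G.tgt e) =
        ∑ e, u (G.src e) * P (G.tgt e) := by
      rw [← Finset.sum_fiberwise Finset.univ G.src]
      refine Finset.sum_congr rfl fun i _ => ?_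
      rw [Finset.mul_sum]
      exact Finset.sum_congr rfl fun e he => by rw [(Finset.mem_filter.1 he).2]
    have h2 : ∑ i, P i * ∑ e with G.tgt e = i, u (G.src e) =
        ∑ e, u (G.src e) * P (G.tgt e) := by
      rw [← Finset.sum_fiberwise Finset.univ G.tgt]
      refine Finset.sum_congr rfl fun i _ => ?_
      rw [Finset.mul_sum]
      exact Finset.sum_congr rfl fun e he => by rw [(Finset.mem_filter.1 he).2, mul_comm]
    rw [h1, ← h2]
    exact Finset.sum_congr rfl fun i _ => by rw [hMu]; ring
  have := (Finset.sum_eq_sum_iff_of_le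
    fun i _ => mul_le_mul_of_nonneg_left (hsub i) (hu i).le).1 hsum i (Finset.mem_univ i)
  exact (mul_left_cancel₀ (hu i).ne' this).symm

end HausdorffWeight

end SingleMatrixGIFS

/-- An overlap of positive measure is counted twice in the sum, which would then exceed the finite
measure of the union. -/
theorem measure_inter_eq_zero_of_sum_le {X ι : Type*} [MeasurableSpace X] {μ : Measure X}
    {s : Finset ι} {A : ι → Set X} (hA : ∀ i ∈ s, MeasurableSet (A i))
    (hfin : μ (⋃ i ∈ s, A i) ≠ ⊤) (hle : ∑ i ∈ s, μ (A i) ≤ μ (⋃ i ∈ s, A i)) {i j : ι}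
    (hi : i ∈ s) (hj : j ∈ s) (hij : i ≠ j) : μ (A i ∩ A j) = 0 := by
  classical
  set r := (s.erase i).erase j with hr
  have hji : j ∈ s.erase i := Finset.mem_erase.2 ⟨hij.symm, hj⟩
  have hsum : ∑ i ∈ s, μ (A i) = μ (A i) + μ (A j) + ∑ l ∈ r, μ (A l) := by
    rw [← Finset.add_sum_erase s _ hi, ← Finset.add_sum_erase (s.erase i) _ hji, add_assoc]
  have hunion : (⋃ l ∈ s, A l) ⊆ (A i ∪ A j) ∪ ⋃ l ∈ r, A l := by
    intro x hx
    obtain ⟨l, hl, hxl⟩ := Set.mem_iUnion₂.1 hx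
    by_cases h1 : l = i
    · exact Or.inl (Or.inl (h1 ▸ hxl))
    by_cases h2 : l = j
    · exact Or.inl (Or.inr (h2 ▸ hxl))
    exact Or.inr (Set.mem_iUnion₂.2 ⟨l, by simp [hr, h1, h2, hl], hxl⟩)
  have h1 : μ (⋃ l ∈ s, A l) ≤ μ (A i ∪ A j) + ∑ l ∈ r, μ (A l) :=
    (measure_mono hunion).trans ((measure_union_le _ _).trans
      (by gcongr; exact measure_biUnion_finset_le _ _))
  have h2 : μ (A i ∩ A j) + μ (⋃ l ∈ s, A l) ≤ μ (⋃ l ∈ s, A l) :=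
    calc μ (A i ∩ A j) + μ (⋃ l ∈ s, A l)
        ≤ μ (A i ∩ A j) + (μ (A i ∪ A j) + ∑ l ∈ r, μ (A l)) := by gcongr
      _ = μ (A i ∪ A j) + μ (A i ∩ A j) + ∑ l ∈ r, μ (A l) := by
        rw [← add_assoc, add_comm (μ (A i ∩ A j))]
      _ = ∑ i ∈ s, μ (A i) := by rw [measure_union_add_inter _ (hA j hj), hsum]
      _ ≤ _ := hle
  by_contra h0
  have := ENNReal.lt_add_right hfin h0
  rw [add_comm] at this
  exact this.not_ge h2

namespace SingleMatrixGIFS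

open Matrix Filter Topology

variable {d : ℕ} [NeZero d] {V Γ : Type*} [Finite V] [Fintype Γ] [PartialOrder Γ]
  {G : SingleMatrixGIFS d V Γ} {E : V → Set (EuclideanSpace ℝ (Fin d))} {δ : ℝ}
  {φ : EuclideanSpace ℝ (Fin d) → ℝ} {lam : ℝ} {p : V → ℝ} {j : V}
  {ψ : unitInterval → EuclideanSpace ℝ (Fin d)}

omit [Fintype Γ] [PartialOrder Γ] in
theorem exists_norm_cylinderSet_lt (hA : IsExpanding G.A) (hδ : δ < 1 / 2)
    (hφ : IsSmoothingKernel δ φ) (hE : G.IsInvariantFamily E) {ε : ℝ} (hε : 0 < ε) :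
    ∃ k : ℕ, ∀ i, ∀ w ∈ G.walks i k, ∀ x ∈ G.cylinderSet E i w, ∀ y ∈ G.cylinderSet E i w,
      ‖x - y‖ < ε := by
  obtain ⟨η, hη, hlt⟩ := exists_norm_lt_of_pseudoNorm_le hA hδ hφ hε
  obtain ⟨C, hC, h⟩ := exists_pseudoNorm_cylinderSet_le hA hδ hφ hE
  obtain ⟨k, hk⟩ := exists_pow_lt_of_lt_one (div_pos hη hC) (contractionRatio_lt_one hA)
  rw [lt_div_iff₀ hC] at hk
  exact ⟨k, fun i w hw x hx y hy => hlt _ ((h i k w hw x hx y hy).trans (by linarith))⟩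

omit [NeZero d] [Finite V] in
/-- A coding map gives every union of cylinder sets at least the total length of their intervals. -/
theorem IsCoding.sum_le_volume (hψ : G.IsCoding E lam p j ψ) (hp : G.IsWeight lam p)
    (hord : G.IsOrdered) {k : ℕ} {W : Finset (List Γ)} (hW : W ⊆ G.walkFinset j k) :
    ∑ w ∈ W, ENNReal.ofReal (G.walkLen lam p j w / p j) ≤
      volume (ψ ⁻¹' ⋃ w ∈ W, G.cylinderSet E j w) := by
  set J : List Γ → Set unitInterval := fun w => {t | G.walkStart lam p w < p j * t ∧
    p j * t < G.walkStart lam p w + G.walkLen lam p j w}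
  have hwalk : ∀ w ∈ W, w ∈ G.walks j k := fun w hw => mem_walkFinset.1 (hW hw)
  have hvol : ∀ w ∈ W, volume (J w) = ENNReal.ofReal (G.walkLen lam p j w / p j) := by
    intro w hw
    rw [hp.volume_Ioo j (hp.walkStart_nonneg w) (hp.walkStart_add_le hord (hwalk w hw).2),
      add_sub_cancel_left]
  rw [← Finset.sum_congr rfl hvol, ← measure_biUnion_finset]
  · refine measure_mono fun t ht => ?_
    obtain ⟨w, hw, h1, h2⟩ := Set.mem_iUnion₂.1 ht
    exact Set.mem_iUnion₂.2 ⟨w, hw, hψ.mem_cylinderSet hp hord (hwalk w hw) h1 h2⟩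
  · intro v hv w hw hvw
    refine Set.disjoint_left.2 ?_
    rintro t ⟨h1, h2⟩ ⟨h3, h4⟩
    rcases lex_trichotomy hord (hwalk v hv) (hwalk w hw) with h | h | h
    · exact hvw h
    · linarith [hp.walkStart_add_le_of_lex hord (hwalk v hv) (hwalk w hw) h]
    · linarith [hp.walkStart_add_le_of_lex hord (hwalk w hw) (hwalk v hv) h]
  · intro w _
    have hm : Measurable fun t : unitInterval => p j * (t : ℝ) :=
      measurable_subtype_coe.const_mul (p j)
    exact (measurableSet_lt measurable_const hm).inter (measurableSet_lt hm measurable_const)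

/-! ### The coding map as a measure isomorphism -/

section MeasureIso

variable (hp : G.IsWeight lam fun i =>
    (omegaHausdorff G.A φ (similarityDim G.A lam) (E i)).toReal) (hlam : 1 < lam)
  (hA : IsExpanding G.A) (hδ : δ < 1 / 2) (hφ : IsSmoothingKernel δ φ) (hord : G.IsOrdered)
  (hE : G.IsInvariantFamily E)
  (hψ : G.IsCoding E lam
    (fun i => (omegaHausdorff G.A φ (similarityDim G.A lam) (E i)).toReal) j ψ)
include hp hlam hA

omit [PartialOrder Γ] in
theorem omegaHausdorff_cylinderSet_le (i : V) (w : List Γ) (hδ : δ < 1 / 2) (hφ : IsSmoothingKernel δ φ) (hE : G.IsInvariantFamily E) :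
    omegaHausdorff G.A φ (similarityDim G.A lam) (G.cylinderSet E i w) ≤
      ENNReal.ofReal (G.walkLen lam
        (fun i => (omegaHausdorff G.A φ (similarityDim G.A lam) (E i)).toReal) i w) := by
  rw [walkLen, ENNReal.ofReal_mul (pow_pos (inv_pos.2 hp.lam_pos) _).le,
    ENNReal.ofReal_toReal (hp.omegaHausdorff_lt_top hlam hA hδ hφ hE _).ne]
  exact omegaHausdorff_map_image_le hlam hA w _

include hδ hφ hord hE hψ

/-- The coding map transports Lebesgue measure to normalized Hausdorff measure. -/
theorem IsCoding.volume_preimage_eq (hψc : Continuous ψ)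
    {B : Set (EuclideanSpace ℝ (Fin d))} (hB : MeasurableSet B) (hBE : B ⊆ E j) :
    volume (ψ ⁻¹' B) = (omegaHausdorff G.A φ (similarityDim G.A lam) (E j))⁻¹ *
      omegaHausdorff G.A φ (similarityDim G.A lam) B := by
  classical
  obtain ⟨μ, hμ⟩ := exists_omegaMeasure hA hδ hφ (similarityDim G.A lam)
  have hEm : ∀ i, MeasurableSet (E i) := fun i => (hE.2.1 i).measurableSet
  have hfin := hp.omegaHausdorff_lt_top hlam hA hδ hφ hE j
  have hpj := hp.pos j
  have hcyl := fun w => omegaHausdorff_cylinderSet_le hp hlam hA j w hδ hφ hE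
  set c := omegaHausdorff G.A φ (similarityDim G.A lam) (E j) with hc
  set P : V → ℝ := fun i => (omegaHausdorff G.A φ (similarityDim G.A lam) (E i)).toReal
  have hcP : c = ENNReal.ofReal (P j) := (ENNReal.ofReal_toReal hfin.ne).symm
  have hc0 : c ≠ 0 := by rw [hcP]; simpa using hpj
  set ν : Measure (EuclideanSpace ℝ (Fin d)) := c⁻¹ • μ.restrict (E j) with hν
  set m : Measure (EuclideanSpace ℝ (Fin d)) := Measure.map ψ volume with hm
  have hmapply : ∀ S, MeasurableSet S → m S = volume (ψ ⁻¹' S) := fun S hS =>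
    Measure.map_apply hψc.measurable hS
  have hmprob : IsProbabilityMeasure m := Measure.isProbabilityMeasure_map hψc.aemeasurable
  have hνuniv : ν Set.univ = 1 := by
    rw [hν, Measure.smul_apply, Measure.restrict_apply_univ, hμ _ (hEm j), smul_eq_mul,
      ENNReal.inv_mul_cancel hc0 hfin.ne]
  have hνprob : IsProbabilityMeasure ν := ⟨hνuniv⟩
  -- The small cylinders meeting K cover K ∩ E_j and stay in a thickening of K. Each has normalized
  -- Hausdorff measure at most its normalized interval length, and their union has image measure at
  -- least the total of these lengths. Then the thickening shrinks to K.
  have hclosed : ∀ K, IsClosed K → ν K ≤ m K := by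
    intro K hK
    have hlim := (tendsto_measure_cthickening_of_isClosed (μ := m)
      ⟨1, one_pos, measure_ne_top _ _⟩ hK).mono_left (nhdsWithin_le_nhds (s := Set.Ioi 0))
    refine ge_of_tendsto hlim ?_
    filter_upwards [self_mem_nhdsWithin] with ε hε
    obtain ⟨k, hk⟩ := exists_norm_cylinderSet_lt hA hδ hφ hE hε
    set W := (G.walkFinset j k).filter fun w => (G.cylinderSet E j w ∩ K).Nonempty
    have hWsub : (⋃ w ∈ W, G.cylinderSet E j w) ⊆ Metric.cthickening ε K := by
      refine Set.iUnion₂_subset fun w hw x hx => ?_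
      obtain ⟨hw1, y, hy, hyK⟩ := Finset.mem_filter.1 hw
      refine Metric.mem_cthickening_of_dist_le x y ε K hyK ?_
      rw [dist_eq_norm]
      exact (hk j w (mem_walkFinset.1 hw1) x hx y hy).le
    have hcov : K ∩ E j ⊆ ⋃ w ∈ W, G.cylinderSet E j w := by
      rintro x ⟨hxK, hxE⟩
      obtain ⟨w, hw, hxw⟩ := exists_walk_of_mem hE k hxE
      exact Set.mem_iUnion₂.2
        ⟨w, Finset.mem_filter.2 ⟨mem_walkFinset.2 hw, x, hxw, hxK⟩, hxw⟩
    have hmeas : ∀ w, MeasurableSet (G.cylinderSet E j w) := fun w =>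
      (isCompact_cylinderSet hE j w).measurableSet
    calc ν K = c⁻¹ * μ (K ∩ E j) := by
          rw [hν, Measure.smul_apply, Measure.restrict_apply hK.measurableSet, smul_eq_mul]
      _ ≤ c⁻¹ * ∑ w ∈ W, μ (G.cylinderSet E j w) := by
          gcongr
          exact (measure_mono hcov).trans (measure_biUnion_finset_le _ _)
      _ ≤ c⁻¹ * ∑ w ∈ W, ENNReal.ofReal (G.walkLen lam P j w) := by
          gcongr with w hw
          rw [hμ _ (hmeas w)]
          exact hcyl w
      _ = ∑ w ∈ W, ENNReal.ofReal (G.walkLen lam P j w / P j) := by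
          rw [Finset.mul_sum]
          refine Finset.sum_congr rfl fun w _ => ?_
          rw [ENNReal.ofReal_div_of_pos hpj, ← hcP, ENNReal.div_eq_inv_mul]
      _ ≤ volume (ψ ⁻¹' ⋃ w ∈ W, G.cylinderSet E j w) :=
          hψ.sum_le_volume hp hord (Finset.filter_subset _ _)
      _ ≤ m (Metric.cthickening ε K) := by
          rw [hmapply _ Metric.isClosed_cthickening.measurableSet]
          exact measure_mono (Set.preimage_mono hWsub)
  have hle : ν ≤ m := by
    refine Measure.le_iff.2 fun S hS => ?_
    rw [hS.measure_eq_iSup_isClosed_of_ne_top (measure_ne_top ν S)]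
    exact iSup₂_le fun K hKS => iSup_le fun hK => (hclosed K hK).trans (measure_mono hKS)
  -- One-sided domination is enough, because both measures have total mass 1.
  have heq : ν = m := Measure.eq_of_le_of_isProbabilityMeasure hle
  rw [← hmapply B hB, ← heq, hν, Measure.smul_apply, Measure.restrict_apply hB, smul_eq_mul,
    Set.inter_eq_left.2 hBE, hμ B hB]

theorem IsCoding.isMeasureIso (hψc : Continuous ψ) (hψr : Set.range ψ = E j) :
    IsMeasureIso (omegaHausdorff G.A φ (similarityDim G.A lam)) (E j) ψ := by
  classical
  obtain ⟨μ, hμ⟩ := exists_omegaMeasure hA hδ hφ (similarityDim G.A lam)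
  have hpre := fun B hB hBE => hψ.volume_preimage_eq hp hlam hA hδ hφ hord hE hψc (B := B) hB hBE
  have hfin := hp.omegaHausdorff_lt_top hlam hA hδ hφ hE j
  have hpj := hp.pos j
  have hcyl := fun w => omegaHausdorff_cylinderSet_le hp hlam hA j w hδ hφ hE
  have hEm : MeasurableSet (E j) := (hE.2.1 j).measurableSet
  have hmeas : ∀ w, MeasurableSet (G.cylinderSet E j w) := fun w =>
    (isCompact_cylinderSet hE j w).measurableSet
  set H := omegaHausdorff G.A φ (similarityDim G.A lam)
  set P : V → ℝ := fun i => (H (E i)).toReal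
  have hc0 : H (E j) ≠ 0 := fun h => by
    simp [h] at hpj
  -- All overlaps of distinct cylinders of equal level. Off this set a point determines its walk at
  -- every level, hence its parameter, since the interval lengths tend to 0.
  set N : Set (EuclideanSpace ℝ (Fin d)) := ⋃ k : ℕ, ⋃ v ∈ G.walkFinset j k,
    ⋃ w ∈ G.walkFinset j k, ⋃ (_ : v ≠ w), G.cylinderSet E j v ∩ G.cylinderSet E j w with hN
  have hNm : MeasurableSet N := MeasurableSet.iUnion fun k =>
    Finset.measurableSet_biUnion _ fun v _ => Finset.measurableSet_biUnion _ fun w _ =>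
      MeasurableSet.iUnion fun _ => (hmeas v).inter (hmeas w)
  have hN0 : μ N = 0 := by
    refine measure_iUnion_null fun k => (measure_biUnion_null_iff (Finset.countable_toSet _)).2
      fun v hv => (measure_biUnion_null_iff (Finset.countable_toSet _)).2 fun w hw =>
        measure_iUnion_null fun hvw => ?_
    have hunion : (⋃ w ∈ G.walkFinset j k, G.cylinderSet E j w) = E j := by
      refine Set.Subset.antisymm (Set.iUnion₂_subset fun w hw =>
        cylinderSet_subset hE (mem_walkFinset.1 hw).2) fun x hx => ?_
      obtain ⟨w, hw, hxw⟩ := exists_walk_of_mem hE k hx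
      exact Set.mem_iUnion₂.2 ⟨w, mem_walkFinset.2 hw, hxw⟩
    refine measure_inter_eq_zero_of_sum_le (fun w _ => hmeas w) ?_ ?_ hv hw hvw
    · rw [hunion, hμ _ hEm]
      exact hfin.ne
    · rw [hunion, hμ _ hEm]
      calc ∑ w ∈ G.walkFinset j k, μ (G.cylinderSet E j w)
          ≤ ∑ w ∈ G.walkFinset j k, ENNReal.ofReal (G.walkLen lam P j w) :=
            Finset.sum_le_sum fun w hw => by
              rw [hμ _ (hmeas w)]; exact hcyl w
        _ = ENNReal.ofReal (P j) := by
            rw [← ENNReal.ofReal_sum_of_nonneg fun w _ => (hp.walkLen_pos j w).le,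
              hp.sum_walkLen]
        _ = H (E j) := ENNReal.ofReal_toReal hfin.ne
  have hHN : H (E j ∩ N) = 0 := by
    rw [← hμ _ (hEm.inter hNm)]
    exact measure_mono_null Set.inter_subset_right hN0
  set S' := E j \ N with hS'
  have hS'm : MeasurableSet S' := hEm.diff hNm
  have hdiff : E j \ S' = E j ∩ N := Set.sdiff_sdiff_right_self _ _
  have hI'm : MeasurableSet (ψ ⁻¹' S') := hS'm.preimage hψc.measurable
  have hI'c : (ψ ⁻¹' S')ᶜ = ψ ⁻¹' (E j ∩ N) := by
    ext t
    simp only [Set.mem_compl_iff, Set.mem_preimage, hS', Set.mem_sdiff, Set.mem_inter_iff,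
      hψ.mem t, true_and, not_not]
  have hI'0 : volume (ψ ⁻¹' S')ᶜ = 0 := by
    rw [hI'c, hpre _ (hEm.inter hNm) Set.inter_subset_left, hHN, mul_zero]
  obtain ⟨M, hM, hPM⟩ := exists_pos_ge_of_finite P
  have hl := hp.lam_pos
  have hinj' : ∀ s t, ψ s ∈ S' → ψ s = ψ t → s = t := by
    intro s t hs hst
    have hclose : ∀ k : ℕ, |P j * s - P j * t| ≤ M * lam⁻¹ ^ k := by
      intro k
      obtain ⟨v, hv, v1, v2, v3⟩ := hψ s k
      obtain ⟨w, hw, w1, w2, w3⟩ := hψ t k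
      have hvw : v = w := by
        by_contra hne
        refine hs.2 (Set.mem_iUnion.2 ⟨k, Set.mem_iUnion₂.2 ⟨v, mem_walkFinset.2 hv,
          Set.mem_iUnion₂.2 ⟨w, mem_walkFinset.2 hw, Set.mem_iUnion.2 ⟨hne, v3, ?_⟩⟩⟩⟩)
        rw [hst]
        exact w3
      subst hvw
      have hlen : G.walkLen lam P j v ≤ M * lam⁻¹ ^ k := by
        rw [walkLen, hv.1, mul_comm]
        exact mul_le_mul_of_nonneg_right (hPM _) (pow_pos (inv_pos.2 hl) k).le
      rw [abs_le]
      constructor <;> linarith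
    have hlim : Tendsto (fun k : ℕ => M * lam⁻¹ ^ k) atTop (𝓝 0) := by
      simpa using (tendsto_pow_atTop_nhds_zero_of_lt_one (inv_pos.2 hl).le
        (inv_lt_one_of_one_lt₀ hlam)).const_mul M
    have h0 := abs_nonpos_iff.1 (ge_of_tendsto' hlim hclose)
    exact Subtype.ext (mul_left_cancel₀ hpj.ne' (sub_eq_zero.1 h0))
  have hrange : Set.SurjOn ψ (ψ ⁻¹' S') S' := by
    intro x hx
    obtain ⟨t, rfl⟩ : x ∈ Set.range ψ := hψr ▸ hx.1
    exact ⟨t, hx, rfl⟩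
  refine ⟨⟨ψ ⁻¹' S', S', hI'm, hS'm, Set.sdiff_subset, hI'0, by rw [hdiff, hHN],
    fun t ht => ht, fun s hs t _ hst => hinj' s t hs hst, hrange⟩, fun F hF => ?_, hpre⟩
  have hFm : MeasurableSet (F ∩ ψ ⁻¹' S') := hF.inter hI'm
  -- Lusin–Souslin: a continuous injective image of a Borel set is Borel, so the preimage formula
  -- applies to it.
  have himg : MeasurableSet (ψ '' (F ∩ ψ ⁻¹' S')) :=
    hFm.image_of_continuousOn_injOn hψc.continuousOn
      fun s hs t _ hst => hinj' s t hs.2 hst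
  have himgsub : ψ '' (F ∩ ψ ⁻¹' S') ⊆ E j := by
    rintro _ ⟨t, -, rfl⟩
    exact hψ.mem t
  have hpreimg : ψ ⁻¹' (ψ '' (F ∩ ψ ⁻¹' S')) = F ∩ ψ ⁻¹' S' := by
    refine Set.Subset.antisymm ?_ (Set.subset_preimage_image _ _)
    rintro t ⟨s, hs, hst⟩
    rwa [← hinj' s t hs.2 hst]
  have hvolF : volume (F ∩ ψ ⁻¹' S') = volume F :=
    measure_inter_conull hI'0
  have hmain : H (ψ '' (F ∩ ψ ⁻¹' S')) = H (E j) * volume F := by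
    rw [← hvolF]
    conv_rhs => rw [← hpreimg]
    rw [hpre _ himg himgsub, ← mul_assoc, ENNReal.mul_inv_cancel hc0 hfin.ne, one_mul]
  rw [← hmain]
  refine le_antisymm ?_ (omegaHausdorff_mono _ (Set.image_mono Set.inter_subset_left))
  -- The full image of F is not shown to be Borel; monotonicity and subadditivity of the outer
  -- measure suffice, as the rest lands in a null set.
  have hcov : ψ '' F ⊆ ψ '' (F ∩ ψ ⁻¹' S') ∪ (E j ∩ N) := by
    rintro _ ⟨t, ht, rfl⟩
    by_cases h : t ∈ ψ ⁻¹' S'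
    · exact Or.inl ⟨t, ⟨ht, h⟩, rfl⟩
    · right
      have : t ∈ (ψ ⁻¹' S')ᶜ := h
      rwa [hI'c] at this
  calc H (ψ '' F) ≤ H (ψ '' (F ∩ ψ ⁻¹' S') ∪ (E j ∩ N)) := omegaHausdorff_mono _ hcov
    _ ≤ H (ψ '' (F ∩ ψ ⁻¹' S')) + H (E j ∩ N) := omegaHausdorff_union_le _ _ _
    _ = _ := by rw [hHN, add_zero]

end MeasureIso

end SingleMatrixGIFS

/-! ### Euclidean estimates and conclusion -/

/-- A Hölder bound in the pseudo-norm becomes Euclidean Hölder bounds. -/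
theorem exists_euclidean_holder {d : ℕ} [NeZero d] {A : Matrix (Fin d) (Fin d) ℝ} {δ : ℝ}
    {φ : EuclideanSpace ℝ (Fin d) → ℝ} (hA : IsExpanding A)
    (hφ : IsSmoothingKernel δ φ) {lam r : ℝ} (hlam : 1 < lam) (hr : 1 < r)
    {P : EuclideanSpace ℝ (Fin d) → Prop}
    (hcomp : ∃ C : ℝ, 0 < C ∧ ∀ x : EuclideanSpace ℝ (Fin d), P x →
      ‖x‖ ≤ C * pseudoNorm A φ x ^ ((d : ℝ) * Real.log r / Real.log |A.det|))
    {ψ : unitInterval → EuclideanSpace ℝ (Fin d)}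
    (hψ : ∃ c : ℝ, 0 < c ∧ ∀ x y : unitInterval,
      pseudoNorm A φ (ψ x - ψ y) ≤ c * |(x : ℝ) - (y : ℝ)| ^ (1 / similarityDim A lam)) :
    ∃ C : ℝ, 0 < C ∧ ∀ x y : unitInterval, P (ψ x - ψ y) →
      ‖ψ x - ψ y‖ ≤ C * |(x : ℝ) - (y : ℝ)| ^ (Real.log r / Real.log lam) := by
  obtain ⟨C, hC, h⟩ := hcomp
  obtain ⟨c, hc, hc'⟩ := hψ
  set s := (d : ℝ) * Real.log r / Real.log |A.det| with hs
  have hd : (0 : ℝ) < d := by exact_mod_cast NeZero.pos d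
  have hq := Real.log_pos hA.one_lt_abs_det
  have hlr := Real.log_pos hr
  have hll := Real.log_pos hlam
  have hs0 : 0 < s := by positivity
  refine ⟨C * c ^ s, by positivity, fun x y hxy => (h _ hxy).trans ?_⟩
  have h1 := Real.rpow_le_rpow (pseudoNorm_nonneg hφ _) (hc' x y) hs0.le
  rw [Real.mul_rpow hc.le (by positivity), ← Real.rpow_mul (abs_nonneg _)] at h1
  -- Both d and log q cancel, which is why the final exponent does not involve the determinant.
  have h2 : 1 / similarityDim A lam * s = Real.log r / Real.log lam := by
    rw [similarityDim, hs]
    field_simp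
  rw [h2] at h1
  rw [mul_assoc]
  exact mul_le_mul_of_nonneg_left h1 hC.le

end

theorem corollary1p2 {d : ℕ} [NeZero d] {V Γ : Type*} [Fintype V] [DecidableEq V] [Finite Γ]
    [PartialOrder Γ] (G : SingleMatrixGIFS d V Γ)
    (hA : IsExpanding G.A)
    (hord : G.IsOrdered)
    (hprim : G.assocMatrix.IsPrimitive)
    (hM : 1 < maxEigenvalue G.assocMatrix)
    (hosc : G.OpenSetCondition)
    (E : V → Set (EuclideanSpace ℝ (Fin d)))
    (hE : G.IsInvariantFamily E)
    (hlin : G.IsLinear E)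
    (δ : ℝ) (hδ : 0 < δ) (hδ' : δ < 1 / 2)
    (φ : EuclideanSpace ℝ (Fin d) → ℝ) (hφ : IsSmoothingKernel δ φ)
    (j : V) :
    (∃ ψ : unitInterval → EuclideanSpace ℝ (Fin d),
        IsOptimalParametrization G.A φ (E j) ψ) ∧
      ∀ ψ : unitInterval → EuclideanSpace ℝ (Fin d),
        IsOptimalParametrization G.A φ (E j) ψ →
        ∀ ε : ℝ, 0 < ε → ε < minModulus G.A - 1 →
          (∃ C : ℝ, 0 < C ∧ ∀ x y : unitInterval, 1 ≤ ‖ψ x - ψ y‖ →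
            ‖ψ x - ψ y‖ ≤ C * |(x : ℝ) - (y : ℝ)| ^
              (Real.log (maxModulus G.A + ε) / Real.log (maxEigenvalue G.assocMatrix))) ∧
          (∃ C : ℝ, 0 < C ∧ ∀ x y : unitInterval, ‖ψ x - ψ y‖ ≤ 1 →
            ‖ψ x - ψ y‖ ≤ C * |(x : ℝ) - (y : ℝ)| ^
              (Real.log (minModulus G.A - ε) / Real.log (maxEigenvalue G.assocMatrix))) := by
  classical
  have := Fintype.ofFinite Γ
  have : Nonempty V := ⟨j⟩
  obtain ⟨⟨u, hu, hMu⟩, p, hp0, hMp⟩ := hprim.exists_perron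
  set lam := maxEigenvalue G.assocMatrix
  have hentry : ∀ i i', G.assocMatrix i i' =
      ∑ e : Γ, if G.src e = i' ∧ G.tgt e = i then (1 : ℝ) else 0 := by
    intro i i'
    rw [Finset.sum_boole]
    simp only [SingleMatrixGIFS.assocMatrix, Matrix.of_apply, Nat.card_eq_fintype_card, Fintype.card_subtype]
  have hp : G.IsWeight lam p := by
    refine ⟨by linarith, hp0, fun i => ?_⟩
    have h1 := congrFun hMp i
    simp only [Matrix.mulVec, dotProduct, Matrix.transpose_apply, hentry, Pi.smul_apply,
      smul_eq_mul, Finset.sum_mul] at h1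
    rw [← h1, Finset.sum_comm, Finset.sum_filter]
    refine Finset.sum_congr rfl fun e _ => ?_
    by_cases h : G.src e = i <;> simp [h]
  have hu' : ∀ i, ∑ e with G.tgt e = i, u (G.src e) = lam * u i := by
    intro i
    have h1 := congrFun hMu i
    simp only [Matrix.mulVec, dotProduct, hentry, Pi.smul_apply,
      smul_eq_mul, Finset.sum_mul] at h1
    rw [← h1, Finset.sum_comm, Finset.sum_filter]
    refine Finset.sum_congr rfl fun e _ => ?_
    by_cases h : G.tgt e = i <;> simp [h]
  have hdim := hp.omegaDim_eq hM hosc hA hδ' hφ hord hE j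
  refine ⟨?_, fun ψ hψ ε hε hε' => ?_⟩
  -- The Perron vector p has served to find the dimension; the parametrization itself is coded with
  -- the Hausdorff weights.
  · have hP := hp.isWeight_omegaHausdorff hM hosc hA hδ' hφ hord hE hu (by convert hu')
    obtain ⟨ψ, hψ⟩ := hP.exists_isCoding hord hE j
    have hhol := hψ.exists_holder hP hM hA hδ' hφ hord hE hlin
    have hψc : Continuous ψ := by
      obtain ⟨C, -, h⟩ := hhol
      exact SingleMatrixGIFS.continuous_of_holder hA hδ' hφ (one_div_pos.2 (similarityDim_pos hA hM)) h
    have hψr := hψ.range_eq hψc hP hA hδ' hφ hord hE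
    refine ⟨ψ, hψc, hψr, ?_, ?_⟩
    · rw [hdim]
      exact hψ.isMeasureIso hP hM hA hδ' hφ hord hE hψc hψr
    · rw [hdim]
      exact hhol
  · have hhol := hψ.holder
    rw [hdim] at hhol
    have h1 := one_lt_minModulus hA
    have h2 := minModulus_le_maxModulus G.A
    -- Here r is `maxModulus G.A + ε` and then `minModulus G.A - ε`; the upper bound on ε keeps the
    -- latter above 1.
    exact ⟨exists_euclidean_holder hA hφ hM (by linarith)
        (norm_le_pseudoNorm_rpow_of_one_le hA hδ' hφ (by linarith)) hhol,
      exists_euclidean_holder hA hφ hM (by linarith)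
        (norm_le_pseudoNorm_rpow_of_le_one hA hδ' hφ (by linarith) (by linarith)) hhol⟩
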